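/- **Theorem.** Let $n\ge 2$ and let $\mathbb G$ be an index $n$ toroidal grid diagram: a torus with $n$ horizontal circles $\alpha_1,\dots,\alpha_n$ and $n$ vertical circles $\beta_1,\dots,\beta_n$, with markings $O_1,\dots,O_n$ and $X_1,\dots,X_n$ in the square regions such that each horizontal and each vertical annulus contains exactly one $O$ and exactly one $X$; $H_j$ and $V_j$ denote the horizontal and the vertical annulus through $O_j$. A generator is an $n$-tuple of points, one on each $\alpha$-circle and one on each $\beta$-circle. A positive domain $D\in\mathscr D^+(x,y)$ between generators $x,y$ is a combination of square regions with nonnegative integer coefficients such that $\partial(\partial D\cap\alpha)=y-x$; domains are composed by adding their coefficients ($D*E\in\mathscr D^+(x,z)$ for $D\in\mathscr D^+(x,y)$, $E\in\mathscr D^+(y,z)$). Its Maslov index is $\mu(D)=n_x(D)+n_y(D)$, where $n_p(D)$ is the average of the coefficients of $D$ at the four squares around $p$, summed over the points $p$ of the generator. A rectangle in $\mathscr D^+(x,y)$ is an embedded rectangle whose bottom left and top right corners are in $x$, whose bottom right and top left corners are in $y$, such that the other $n-2$ points of $x$ and $y$ agree and do not lie in it. Let $\mathit{CDP}_*=\mathit{CDP}_*(\mathbb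 G;\mathbb Z/2)$ be the $\mathbb Z/2$-vector space with basis the triples $(D,\vec N,\vec\lambda)$, where $D\in\mathscr D^+(x,y)$ for some generators $x,y$ (which are part of the data), $\vec N\in\mathbb N^n$, and $\vec\lambda=(\lambda_1,\dots,\lambda_n)$ with $\lambda_j$ an ordered partition of $N_j$ into positive integers (empty if $N_j=0$). The grading of $(D,\vec N,\vec\lambda)$ is $\mu(D)$ plus the sum of the lengths of the $\lambda_j$. The differential $\partial$ of $(D,\vec N,\vec\lambda)$ is the sum modulo 2, with $\vec N$ changed accordingly, of 1. all $(E,\vec N,\vec\lambda)$ for decompositions $D=R*E$, and for decompositions $D=E*R$, with $R$ a rectangle and $E$ a positive domain; 2. for each $j$, each decomposition $D=E*H_j$ or $D=E*V_j$ with $E$ a positive domain, and each of the $l(\lambda_j)+1$ positions, the triple in which $D$ is replaced by $E$ and an entry $1$ is inserted into $\lambda_j$ at that position; 3. for each $j$ and each pair of consecutive entries of $\lambda_j$, the triple in which these two entries are replaced by their sum; 4. for each $j$ with $\lambda_j$ nonempty, the triple in which the first entry of $\lambda_j$ is removed, and the triple in which the last entry of $\lambda_j$ is removed. Then every triple has a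 nonnegative integer grading, $\partial$ lowers the grading by one (and vanishes in grading $0$), $\partial^2=0$, and $$H_0(\mathit{CDP}_*;\mathbb Z/2)\cong\mathbb Z/2,\qquad H_1(\mathit{CDP}_*;\mathbb Z/2)\cong(\mathbb Z/2)^n,$$ $$H_2(\mathit{CDP}_*;\mathbb Z/2)\cong(\mathbb Z/2)^{\binom n2+1},\qquad H_3(\mathit{CDP}_*;\mathbb Z/2)\cong(\mathbb Z/2)^{\binom n3+n}.$$ -/

import Mathlib

noncomputable section

namespace GridCDP

/-- An index `n` grid diagram.  The columns (vertical annuli) and the rows (horizontal annuli) of the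
torus are indexed by `Fin n`.  The marking `O_j` lies in column `oCol j` and row `oRow j`, the marking
`X_j` in column `xCol j` and row `xRow j`; that these are permutations says that every vertical and
every horizontal annulus contains exactly one `O` and exactly one `X`. -/
structure GridDiagram (n : ℕ) where
  oCol : Equiv.Perm (Fin n)
  oRow : Equiv.Perm (Fin n)
  xCol : Equiv.Perm (Fin n)
  xRow : Equiv.Perm (Fin n)

/-- A generator: the permutation `x` stands for the `n`-tuple of points `α_{x i} ∩ β_i`. -/
abbrev State (n : ℕ) : Type := Equiv.Perm (Fin n)

/-- A 2-chain on the torus: `D i j` is the coefficient of the square region in column `i` (between the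
circles `β_i` and `β_{i+1}`) and row `j` (between `α_j` and `α_{j+1}`), indices being cyclic. -/
abbrev TwoChain (n : ℕ) : Type := Fin n → Fin n → ℤ

/-- The cyclic predecessor in `Fin n`. -/
def cycPred {n : ℕ} (i : Fin n) : Fin n := (finRotate n).symm i

/-- The part `∂D ∩ α` of the boundary of `D` on the horizontal circles: the coefficient of the edge of
`α_j` from `β_i` to `β_{i+1}`, oriented to the right.  That edge is the bottom of the square `(i, j)`
and the top of the square `(i, j - 1)`. -/
def alphaBoundary {n : ℕ} (D : TwoChain n) (i j : Fin n) : ℤ :=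
  D i j - D i (cycPred j)

/-- The coefficient of `∂(∂D ∩ α)` at the point `α_j ∩ β_i`, which is the right end of the edge
`(i - 1, j)` and the left end of the edge `(i, j)`. -/
def cornerCoeff {n : ℕ} (D : TwoChain n) (i j : Fin n) : ℤ :=
  alphaBoundary D (cycPred i) j - alphaBoundary D i j

/-- The generator `x` as a `ℤ`-linear combination of points. -/
def pointCoeff {n : ℕ} (x : State n) (i j : Fin n) : ℤ := if x i = j then 1 else 0

/-- `D` is a domain from `x` to `y`: `∂(∂D ∩ α) = y - x`. -/
def IsGridDomain {n : ℕ} (x y : State n) (D : TwoChain n) : Prop :=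
  ∀ i j : Fin n, cornerCoeff D i j = pointCoeff y i j - pointCoeff x i j

/-- `D` is a positive domain from `x` to `y`. -/
def IsPosDomain {n : ℕ} (x y : State n) (D : TwoChain n) : Prop :=
  IsGridDomain x y D ∧ ∀ i j : Fin n, 0 ≤ D i j

/-- The average of the coefficients of `D` at the four squares around the point `α_j ∩ β_i`. -/
def pointMeasure {n : ℕ} (D : TwoChain n) (i j : Fin n) : ℚ :=
  ((D i j + D (cycPred i) j + D i (cycPred j) + D (cycPred i) (cycPred j) : ℤ) : ℚ) / 4

/-- The Maslov index of a domain `D` from `x` to `y`, by Lipshitz's formula `e(D) + n_x(D) + n_y(D)`;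
the Euler measure `e(D)` of a combination of squares is zero. -/
def maslov {n : ℕ} (x y : State n) (D : TwoChain n) : ℚ :=
  (∑ i : Fin n, pointMeasure D i (x i)) + ∑ i : Fin n, pointMeasure D i (y i)

/-- `k` lies in the cyclic half-open interval `[a, b)` (empty if `a = b`); the subtraction of `Fin n`
is modulo `n`. -/
def InArc {n : ℕ} (a b k : Fin n) : Prop := k - a < b - a

/-- The square region in column `k` and row `l` lies in the rectangle whose left, right, bottom and top
sides are on `β_a`, `β_b`, `α_{x a}` and `α_{x b}`. -/
def InRect {n : ℕ} (x : State n) (a b k l : Fin n) : Prop := InArc a b k ∧ InArc (x a) (x b) l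

open scoped Classical in
/-- The 2-chain of the rectangle whose bottom left and top right corners are the points of `x` on `β_a`
and on `β_b`. -/
def rectChain {n : ℕ} (x : State n) (a b : Fin n) : TwoChain n :=
  fun k l => if InRect x a b k l then 1 else 0

/-- The pair `(a, b)` is the pair of left and right sides of a rectangle starting at `x`: no other point
of `x` lies in it.  The rectangles starting at `x` correspond bijectively to such pairs; the rectangle
goes from `x` to `x * Equiv.swap a b`, which has its bottom right and top left corners as points.  (A point
`α_{x k} ∩ β_k` with `k ≠ a, b` is not on the lines that bound the rectangle, so it lies in the
rectangle exactly when the square to the upper right of it does.) -/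
def IsRect {n : ℕ} (x : State n) (a b : Fin n) : Prop :=
  a ≠ b ∧ ∀ k : Fin n, k ≠ a → k ≠ b → ¬ InRect x a b k (x k)

/-- The vertical annulus through `O_j`. -/
def vertAnnulus {n : ℕ} (G : GridDiagram n) (j : Fin n) : TwoChain n :=
  fun k _ => if k = G.oCol j then 1 else 0

/-- The horizontal annulus through `O_j`. -/
def horizAnnulus {n : ℕ} (G : GridDiagram n) (j : Fin n) : TwoChain n :=
  fun _ l => if l = G.oRow j then 1 else 0

/-- An ordered partition: a finite sequence of positive integers. It is an ordered partition of the
sum of its entries. -/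
abbrev OrdPartition : Type := List ℕ+

/-- Unit enlargements, one for each of the `m + 1` positions, with multiplicity. -/
def unitEnlargements (p : OrdPartition) : List OrdPartition :=
  (List.range (p.length + 1)).map fun k => p.take k ++ 1 :: p.drop k

/-- Elementary coarsenings: two consecutive entries are replaced by their sum. -/
def elemCoarsenings : OrdPartition → List OrdPartition
  | [] => []
  | [_] => []
  | a :: b :: p => ((a + b) :: p) :: (elemCoarsenings (b :: p)).map (a :: ·)

/-- The initial reduction (none for the empty partition). -/
def initialReductions : OrdPartition → List OrdPartition
  | [] => []
  | _ :: p => [p]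

/-- The final reduction (none for the empty partition). -/
def finalReductions : OrdPartition → List OrdPartition
  | [] => []
  | a :: p => [(a :: p).dropLast]

/-- A triple `(D, N, λ)`, with `D` a positive domain from `x` to `y` and `λ` an `n`-tuple of ordered
partitions; `λ_j` is an ordered partition of `N_j`, so `N` is determined by `λ`. -/
@[ext]
structure Triple (n : ℕ) where
  x : State n
  y : State n
  D : TwoChain n
  isPos : IsPosDomain x y D
  part : Fin n → OrdPartition

namespace Triple

/-- The number `N_j`. -/
def size {n : ℕ} (T : Triple n) (j : Fin n) : ℕ := ((T.part j).map fun a => (a : ℕ)).sum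

/-- The total length of the partitions. -/
def totalLength {n : ℕ} (T : Triple n) : ℕ := ∑ j : Fin n, (T.part j).length

/-- The grading: Maslov index plus total length. -/
def grading {n : ℕ} (T : Triple n) : ℚ := maslov T.x T.y T.D + (T.totalLength : ℚ)

/-- The triple with the `j`-th partition replaced by `p`. -/
def setPart {n : ℕ} (T : Triple n) (j : Fin n) (p : OrdPartition) : Triple n :=
  { T with part := Function.update T.part j p }

end Triple

/-- The `ℤ/2`-vector space (of all gradings together) with basis the triples. -/
abbrev Chains (n : ℕ) : Type := Triple n →₀ ZMod 2

instance (n : ℕ) : AddCommGroup (Chains n) := Finsupp.instAddCommGroup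

open scoped Classical in
/-- The basis element `(E, N, λ)` with `E` from `x` to `y`, if `E` is a positive domain from `x` to `y`,
and `0` otherwise. -/
def basisOrZero {n : ℕ} (x y : State n) (E : TwoChain n) (part : Fin n → OrdPartition) : Chains n :=
  if h : IsPosDomain x y E then Finsupp.single ⟨x, y, E, h, part⟩ 1 else 0

open scoped Classical in
/-- Type I terms.  The first sum is over the decompositions `D = R * E` with `R` a rectangle starting at
the initial generator of `D`, the second over the decompositions `D = E * R` with `R` a rectangle
from `T.y * Equiv.swap a b` to `T.y`. -/
def diffI {n : ℕ} (T : Triple n) : Chains n :=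
  (∑ a : Fin n, ∑ b : Fin n,
    if IsRect T.x a b then
      basisOrZero (T.x * Equiv.swap a b) T.y (T.D - rectChain T.x a b) T.part
    else 0) +
  ∑ a : Fin n, ∑ b : Fin n,
    if IsRect (T.y * Equiv.swap a b) a b then
      basisOrZero T.x (T.y * Equiv.swap a b) (T.D - rectChain (T.y * Equiv.swap a b) a b) T.part
    else 0

/-- Type II terms: taking out an annulus through `O_j` and enlarging the `j`-th partition. -/
def diffII {n : ℕ} (G : GridDiagram n) (T : Triple n) : Chains n :=
  ∑ j : Fin n, ((unitEnlargements (T.part j)).map fun p =>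
    basisOrZero T.x T.y (T.D - horizAnnulus G j) (Function.update T.part j p) +
    basisOrZero T.x T.y (T.D - vertAnnulus G j) (Function.update T.part j p)).sum

/-- Type III terms: elementary coarsenings. -/
def diffIII {n : ℕ} (T : Triple n) : Chains n :=
  ∑ j : Fin n, ((elemCoarsenings (T.part j)).map fun p =>
    (Finsupp.single (T.setPart j p) 1 : Chains n)).sum

/-- Type IV terms: initial and final reductions. -/
def diffIV {n : ℕ} (T : Triple n) : Chains n :=
  (∑ j : Fin n, ((initialReductions (T.part j)).map fun p =>
    (Finsupp.single (T.setPart j p) 1 : Chains n)).sum) +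
  ∑ j : Fin n, ((finalReductions (T.part j)).map fun p =>
    (Finsupp.single (T.setPart j p) 1 : Chains n)).sum

/-- The differential of the complex of positive domains with partitions. -/
def diff {n : ℕ} (G : GridDiagram n) : Chains n →ₗ[ZMod 2] Chains n :=
  Finsupp.linearCombination (ZMod 2) fun T => diffI T + diffII G T + diffIII T + diffIV T

/-- The chains of grading `k`: the span of the triples of grading `k`. -/
def gradedChains (n k : ℕ) : Submodule (ZMod 2) (Chains n) :=
  Finsupp.supported (ZMod 2) (ZMod 2) {T : Triple n | T.grading = (k : ℚ)}

/-- The `k`-cycles. -/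
def cycles {n : ℕ} (G : GridDiagram n) (k : ℕ) : Submodule (ZMod 2) (Chains n) :=
  gradedChains n k ⊓ LinearMap.ker (diff G)

/-- The `k`-boundaries. -/
def boundaries {n : ℕ} (G : GridDiagram n) (k : ℕ) : Submodule (ZMod 2) (Chains n) :=
  (gradedChains n (k + 1)).map (diff G)

/-- The homology in grading `k`: cycles modulo boundaries. -/
abbrev Homology {n : ℕ} (G : GridDiagram n) (k : ℕ) : Type :=
  cycles G k ⧸ (boundaries G k).submoduleOf (cycles G k)

end GridCDP

end

/-!
Positive domains on a toroidal grid, with ordered partitions attached to the markings.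

As a graded vector space the complex is the tensor product of the complex `DomChains` of positive
domains, whose differential `domDiff` removes rectangles at the start or at the end, with one copy
of the complex `PartChains` of ordered partitions for each marking `O_j`. The differential is the
one of the tensor product, plus an interaction for each `j` that takes out an annulus through
`O_j` and enters a `1` into the `j`-th partition (`diff_eq`).

*The interaction can be removed.* Counting the rectangles at the start with their coefficient at
`O_j` is a null-homotopy `h_j` of the operator that takes out the two annuli through `O_j`
(`domDiff_capMap`). Since the enlargement `e_j` squares to zero and commutes with the differential
of the partitions, `1 + e_j h_j` is an involution that conjugates the differential without the
`j`-th interaction into the one with it (`exists_gauge`). In particular the differential squares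
to zero because the two factors' differentials do. For `domDiff` this is the usual count: two
composable rectangles are composable in exactly one other way, except when they form an annulus
(`sum_pairTerm`); the annuli at the start cancel those at the end.

*The partitions.* The complex of ordered partitions contracts onto the span of `∅` and `(1)`, on
which its differential vanishes (`partDiff_partHomotopy`). The homology is therefore the sum over
the subsets `S` of the markings of the homology of `DomChains`, shifted by `|S|`.

*The domains.* The homology of `DomChains` is one-dimensional in each even degree and zero in each
odd degree. Taking out the last row is a surjective chain map of degree `-2`, and its kernel is
spanned by the domains on which the last row is not full. The kernel has the homology of a point
(`exists_sub_mem_constant`), by three matchings that add or remove strips of width one: the first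
reduces to domains that vanish on the last row, its transpose to domains that vanish also on the
last column, and the third, on such planar domains, to the constant domain at the decreasing
generator. Each matching is unitriangular for a suitable rank, so that the part which it covers is
acyclic (`exists_sub_mem_of_matching`). The cycles are then told apart by the counts `rowCount` of
the domains that consist of `m` copies of the last row.

Hence the homology in degree `k` has a basis indexed by the `S` with `|S| ≤ k` and `k - |S|` even.
-/

noncomputable section

namespace GridCDP

/-! ### Elimination of matched pairs -/

/-- **Elimination of a matching.**  A complex over `ℤ/2` with a basis `S`, a subcomplex spanned by
`C ⊆ U ⊆ S`, and a matching of the elements of `U ∖ C` that pairs each low element `a` with a high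
element `φ a`.  If the part of `d` from high to low elements is unitriangular for the rank `ρ`, the
quotient of the span of `U` by the span of `C` is acyclic.  The degree `deg` is carried along. -/
theorem exists_sub_mem_of_matching {S : Type*}
    (d : (S →₀ ZMod 2) →ₗ[ZMod 2] (S →₀ ZMod 2)) (U C low : Set S) (φ ψ : S → S)
    (ρ : S → ℕ) (deg : S → ℚ)
    (hφ : ∀ a ∈ U, a ∉ C → a ∈ low → φ a ∈ U ∧ deg (φ a) = deg a + 1)
    (hψ : ∀ b ∈ U, b ∉ C → b ∉ low → ψ b ∈ U ∧ ψ b ∉ C ∧ ψ b ∈ low ∧ φ (ψ b) = b)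
    (hone : ∀ a ∈ U, a ∉ C → a ∈ low → d (Finsupp.single (φ a) 1) a = 1)
    (hlt : ∀ a ∈ U, a ∉ C → a ∈ low → ∀ t, d (Finsupp.single (φ a) 1) t ≠ 0 → t ≠ a → t ∉ C →
      t ∈ low → ρ t < ρ a)
    (hU : ∀ s ∈ U, ∀ t, d (Finsupp.single s 1) t ≠ 0 → t ∈ U)
    (hC : ∀ s ∈ C, ∀ t, d (Finsupp.single s 1) t ≠ 0 → t ∈ C)
    (hdeg : ∀ s t, d (Finsupp.single s 1) t ≠ 0 → deg t + 1 = deg s)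
    (hdd : ∀ c, d (d c) = 0)
    (k : ℚ) (b : S →₀ ZMod 2) (hb : b ∈ Finsupp.supported (ZMod 2) (ZMod 2) {s | s ∈ U ∧ deg s = k})
    (hdb : d b ∈ Finsupp.supported (ZMod 2) (ZMod 2) C) :
    ∃ γ ∈ Finsupp.supported (ZMod 2) (ZMod 2) {s | s ∈ U ∧ deg s = k + 1},
      b - d γ ∈ Finsupp.supported (ZMod 2) (ZMod 2) {s | s ∈ C ∧ deg s = k} := by
  classical
  have two : ∀ z : ZMod 2, z = 0 ∨ z = 1 := by decide
  have dsum : ∀ (c : S →₀ ZMod 2) (t : S),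
      d c t = ∑ s ∈ c.support, c s * d (Finsupp.single s 1) t := by
    intro c t
    conv_lhs => rw [← Finsupp.sum_single c]
    rw [Finsupp.sum, map_sum, Finsupp.finsetSum_apply]
    refine Finset.sum_congr rfl fun s _ => ?_
    rw [← mul_one (c s), ← smul_eq_mul (c s), ← Finsupp.smul_single, map_smul]
    simp
  have dsupp : ∀ (P Q : S → Prop), (∀ s, P s → ∀ t, d (Finsupp.single s 1) t ≠ 0 → Q t) →
      ∀ c ∈ Finsupp.supported (ZMod 2) (ZMod 2) {s | P s},
        d c ∈ Finsupp.supported (ZMod 2) (ZMod 2) {s | Q s} := by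
    intro P Q h c hc
    rw [Finsupp.mem_supported] at hc ⊢
    intro t ht
    rw [Finset.mem_coe, Finsupp.mem_support_iff, dsum] at ht
    obtain ⟨s, hs, hne⟩ := Finset.exists_ne_zero_of_sum_ne_zero ht
    exact h s (hc hs) t (right_ne_zero_of_mul hne)
  -- a single low element is, up to a boundary, a combination of other elements
  have step : ∀ m : ℕ, ∀ a, ρ a = m → a ∈ U → deg a = k →
      ∃ γ ∈ Finsupp.supported (ZMod 2) (ZMod 2) {s | s ∈ U ∧ deg s = k + 1},
        Finsupp.single a (1 : ZMod 2) - d γ ∈ Finsupp.supported (ZMod 2) (ZMod 2)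
          {s | (s ∈ U ∧ (s ∈ C ∨ s ∉ low)) ∧ deg s = k} := by
    intro m
    induction m using Nat.strong_induction_on with
    | _ m ih =>
      intro a ham haU hak
      by_cases haC : a ∈ C
      · refine ⟨0, Submodule.zero_mem _, ?_⟩
        rw [map_zero, sub_zero]
        exact Finsupp.single_mem_supported _ _ ⟨⟨haU, Or.inl haC⟩, hak⟩
      by_cases hal : a ∈ low
      swap
      · refine ⟨0, Submodule.zero_mem _, ?_⟩
        rw [map_zero, sub_zero]
        exact Finsupp.single_mem_supported _ _ ⟨⟨haU, Or.inr hal⟩, hak⟩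
      obtain ⟨hφU, hφd⟩ := hφ a haU haC hal
      have key : ∀ t, d (Finsupp.single (φ a) 1) t ≠ 0 → t ≠ a →
          ∃ γ ∈ Finsupp.supported (ZMod 2) (ZMod 2) {s | s ∈ U ∧ deg s = k + 1},
            Finsupp.single t (1 : ZMod 2) - d γ ∈ Finsupp.supported (ZMod 2) (ZMod 2)
              {s | (s ∈ U ∧ (s ∈ C ∨ s ∉ low)) ∧ deg s = k} := by
        intro t ht hta
        have htU := hU _ hφU t ht
        have htd : deg t = k := by have := hdeg _ t ht; linarith
        by_cases h : t ∉ C ∧ t ∈ low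
        · exact ih (ρ t) (ham ▸ hlt a haU haC hal t ht hta h.1 h.2) t rfl htU htd
        · refine ⟨0, Submodule.zero_mem _, ?_⟩
          rw [map_zero, sub_zero]
          exact Finsupp.single_mem_supported _ _ ⟨⟨htU, by tauto⟩, htd⟩
      choose! g hg1 hg2 using key
      set R := (d (Finsupp.single (φ a) 1)).support.erase a with hR
      have hR' : ∀ t ∈ R, d (Finsupp.single (φ a) 1) t ≠ 0 ∧ t ≠ a := fun t ht =>
        ⟨Finsupp.mem_support_iff.1 (Finset.mem_of_mem_erase ht), Finset.ne_of_mem_erase ht⟩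
      have hexp : d (Finsupp.single (φ a) 1) =
          Finsupp.single a 1 + ∑ t ∈ R, Finsupp.single t (1 : ZMod 2) := by
        have hmem : a ∈ (d (Finsupp.single (φ a) 1)).support := by
          rw [Finsupp.mem_support_iff, hone a haU haC hal]; exact one_ne_zero
        conv_lhs => rw [← Finsupp.sum_single (d (Finsupp.single (φ a) 1)), Finsupp.sum,
          ← Finset.add_sum_erase _ _ hmem, hone a haU haC hal]
        congr 1
        refine Finset.sum_congr rfl fun t ht => ?_
        rw [(two _).resolve_left (hR' t ht).1]
      refine ⟨Finsupp.single (φ a) 1 - ∑ t ∈ R, g t, ?_, ?_⟩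
      · refine Submodule.sub_mem _ (Finsupp.single_mem_supported _ _ ⟨hφU, by rw [hφd, hak]⟩)
          (Submodule.sum_mem _ fun t ht => hg1 t (hR' t ht).1 (hR' t ht).2)
      · rw [map_sub, hexp, map_sum]
        have : Finsupp.single a (1 : ZMod 2) - (Finsupp.single a 1 + ∑ t ∈ R, Finsupp.single t 1 -
            ∑ t ∈ R, d (g t)) = - ∑ t ∈ R, (Finsupp.single t (1 : ZMod 2) - d (g t)) := by
          rw [Finset.sum_sub_distrib]; abel
        rw [this]
        exact Submodule.neg_mem _ (Submodule.sum_mem _ fun t ht =>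
          hg2 t (hR' t ht).1 (hR' t ht).2)
  have hbU : ∀ s ∈ b.support, s ∈ U ∧ deg s = k := fun s hs => hb hs
  choose! g hg1 hg2 using fun (s : S) (hs : s ∈ b.support) =>
    step (ρ s) s rfl (hbU s hs).1 (hbU s hs).2
  have hbexp : b = ∑ s ∈ b.support, Finsupp.single s (1 : ZMod 2) := by
    conv_lhs => rw [← Finsupp.sum_single b, Finsupp.sum]
    refine Finset.sum_congr rfl fun t ht => ?_
    rw [(two _).resolve_left (Finsupp.mem_support_iff.1 ht)]
  refine ⟨∑ s ∈ b.support, g s, Submodule.sum_mem _ fun s hs => hg1 s hs, ?_⟩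
  set c := b - d (∑ s ∈ b.support, g s) with hc
  have hcm : c ∈ Finsupp.supported (ZMod 2) (ZMod 2)
      {s | (s ∈ U ∧ (s ∈ C ∨ s ∉ low)) ∧ deg s = k} := by
    have : c = ∑ s ∈ b.support, (Finsupp.single s (1 : ZMod 2) - d (g s)) := by
      rw [hc, Finset.sum_sub_distrib, ← hbexp, map_sum]
    rw [this]
    exact Submodule.sum_mem _ fun s hs => hg2 s hs
  have hdc : d c ∈ Finsupp.supported (ZMod 2) (ZMod 2) C := by
    rw [hc, map_sub, hdd, sub_zero]; exact hdb
  -- a high element of the support of `c` with partner of greatest rank shows up in `d c`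
  have hhigh : c.support.filter (fun s => s ∉ C) = ∅ := by
    by_contra hne
    obtain ⟨s, hs, hmax⟩ := Finset.exists_max_image _ (fun s => ρ (ψ s))
      (Finset.nonempty_iff_ne_empty.2 hne)
    rw [Finset.mem_filter] at hs
    obtain ⟨hsc, hsC⟩ := hs
    obtain ⟨⟨hsU, hsB⟩, -⟩ := hcm hsc
    obtain ⟨hψU, hψC, hψl, hψφ⟩ := hψ s hsU hsC (hsB.resolve_left hsC)
    have hval : d c (ψ s) = c s * d (Finsupp.single s 1) (ψ s) := by
      rw [dsum]
      refine Finset.sum_eq_single_of_mem s hsc fun s' hs' hss => ?_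
      rw [mul_eq_zero]; right
      by_contra hne'
      obtain ⟨⟨hsU', hsB'⟩, -⟩ := hcm hs'
      by_cases hs'C : s' ∈ C
      · exact hψC (hC s' hs'C _ hne')
      obtain ⟨hψU', hψC', hψl', hψφ'⟩ := hψ s' hsU' hs'C (hsB'.resolve_left hs'C)
      rw [← hψφ'] at hne'
      have h1 : ψ s ≠ ψ s' := fun h => hss (by rw [← hψφ', ← h, hψφ])
      have h2 := hlt _ hψU' hψC' hψl' _ hne' h1 hψC hψl
      exact absurd (hmax s' (Finset.mem_filter.2 ⟨hs', hs'C⟩)) (not_le.2 h2)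
    have h0 : d c (ψ s) = 0 := by
      by_contra h
      exact hψC (hdc (Finsupp.mem_support_iff.2 h))
    have h1 := hone _ hψU hψC hψl
    rw [hψφ] at h1
    rw [h0, h1, mul_one] at hval
    exact Finsupp.mem_support_iff.1 hsc hval.symm
  intro s hs
  refine ⟨?_, (hcm hs).2⟩
  by_contra hsC
  exact Finset.notMem_empty s (hhigh ▸ Finset.mem_filter.2 ⟨hs, hsC⟩)

/-! ### The complex of ordered partitions -/

/-- The `ℤ/2`-vector space with basis the ordered partitions. -/
abbrev PartChains : Type := OrdPartition →₀ ZMod 2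

/-- Prepending an entry. -/
def consMap (a : ℕ+) : PartChains →ₗ[ZMod 2] PartChains := Finsupp.lmapDomain _ _ (a :: ·)

/-- The sum of the elements of a list of ordered partitions. -/
def listChain (l : List OrdPartition) : PartChains := (l.map fun p => Finsupp.single p 1).sum

/-- Adding `a` to the first entry; the empty partition is fixed. -/
def addHead (a : ℕ+) : OrdPartition → OrdPartition
  | [] => []
  | b :: p => (a + b) :: p

/-- Adding `a` to the first entry, on chains. -/
def addHeadMap (a : ℕ+) : PartChains →ₗ[ZMod 2] PartChains :=
  Finsupp.lmapDomain _ _ (addHead a)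

/-- The sum of the unit enlargements. -/
def enlargeMap : PartChains →ₗ[ZMod 2] PartChains :=
  Finsupp.linearCombination _ fun p => listChain (unitEnlargements p)

/-- The sum of the initial reductions. -/
def dropFirstMap : PartChains →ₗ[ZMod 2] PartChains :=
  Finsupp.linearCombination _ fun p => listChain (initialReductions p)

/-- The sum of the elementary coarsenings and the final reductions. -/
def mergeMap : PartChains →ₗ[ZMod 2] PartChains :=
  Finsupp.linearCombination _ fun p => listChain (elemCoarsenings p) + listChain (finalReductions p)

/-- The differential of the complex of ordered partitions. -/
def partDiff : PartChains →ₗ[ZMod 2] PartChains := mergeMap + dropFirstMap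

@[simp] theorem addHead_nil (a : ℕ+) : addHead a [] = [] := rfl

@[simp] theorem addHead_cons (a b : ℕ+) (p : OrdPartition) : addHead a (b :: p) = (a + b) :: p := rfl

section
variable (a b : ℕ+) (p : OrdPartition) (v : PartChains)

@[simp] theorem consMap_single : consMap a (Finsupp.single p 1) = Finsupp.single (a :: p) 1 := by
  simp [consMap]

@[simp] theorem addHeadMap_single :
    addHeadMap a (Finsupp.single p 1) = Finsupp.single (addHead a p) 1 := by
  simp [addHeadMap]

theorem listChain_map_cons (l : List OrdPartition) :
    listChain (l.map (a :: ·)) = consMap a (listChain l) := by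
  induction l with
  | nil => simp [listChain]
  | cons p l ih =>
    simp only [listChain, List.map_cons, List.sum_cons, map_add, consMap_single] at ih ⊢
    rw [ih]

@[simp] theorem dropFirstMap_nil : dropFirstMap (Finsupp.single [] 1) = 0 := by
  simp [dropFirstMap, listChain, initialReductions]

@[simp] theorem dropFirstMap_cons :
    dropFirstMap (Finsupp.single (a :: p) 1) = Finsupp.single p 1 := by
  simp [dropFirstMap, listChain, initialReductions]

@[simp] theorem enlargeMap_nil :
    enlargeMap (Finsupp.single [] 1) = Finsupp.single [1] 1 := by
  simp [enlargeMap, listChain, unitEnlargements]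

@[simp] theorem enlargeMap_cons :
    enlargeMap (Finsupp.single (a :: p) 1) =
      Finsupp.single (1 :: a :: p) 1 + consMap a (enlargeMap (Finsupp.single p 1)) := by
  simp only [enlargeMap, Finsupp.linearCombination_single, one_smul, ← listChain_map_cons]
  simp only [unitEnlargements, List.length_cons, List.range_succ_eq_map (n := p.length + 1),
    List.map_cons, listChain, List.sum_cons, List.map_map]
  rfl

@[simp] theorem mergeMap_nil : mergeMap (Finsupp.single [] 1) = 0 := by
  simp [mergeMap, listChain, elemCoarsenings, finalReductions]

@[simp] theorem mergeMap_cons :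
    mergeMap (Finsupp.single (a :: p) 1) =
      Finsupp.single (addHead a p) 1 + consMap a (mergeMap (Finsupp.single p 1)) := by
  cases p with
  | nil => simp [mergeMap, listChain, elemCoarsenings, finalReductions, addHead]
  | cons b p =>
    simp only [mergeMap, Finsupp.linearCombination_single, one_smul, map_add,
      ← listChain_map_cons]
    simp [listChain, elemCoarsenings, finalReductions, addHead, add_assoc]

theorem partLin_ext {M : Type*} [AddCommMonoid M] [Module (ZMod 2) M]
    {f g : PartChains →ₗ[ZMod 2] M}
    (h : ∀ p, f (Finsupp.single p 1) = g (Finsupp.single p 1)) : f = g :=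
  Finsupp.lhom_ext' fun p => LinearMap.ext_ring (h p)

theorem mergeMap_consMap : mergeMap (consMap a v) = addHeadMap a v + consMap a (mergeMap v) := by
  suffices h : mergeMap ∘ₗ consMap a = addHeadMap a + consMap a ∘ₗ mergeMap from
    LinearMap.congr_fun h v
  exact partLin_ext fun p => by simp

theorem dropFirstMap_consMap : dropFirstMap (consMap a v) = v := by
  suffices h : dropFirstMap ∘ₗ consMap a = LinearMap.id from LinearMap.congr_fun h v
  exact partLin_ext fun p => by simp

theorem enlargeMap_consMap :
    enlargeMap (consMap a v) = consMap 1 (consMap a v) + consMap a (enlargeMap v) := by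
  suffices h : enlargeMap ∘ₗ consMap a = consMap 1 ∘ₗ consMap a + consMap a ∘ₗ enlargeMap from
    LinearMap.congr_fun h v
  exact partLin_ext fun p => by simp

theorem addHeadMap_consMap : addHeadMap a (consMap b v) = consMap (a + b) v := by
  suffices h : addHeadMap a ∘ₗ consMap b = consMap (a + b) from LinearMap.congr_fun h v
  exact partLin_ext fun p => by simp [addHead]

theorem dropFirstMap_addHead :
    dropFirstMap (Finsupp.single (addHead a p) 1) = dropFirstMap (Finsupp.single p 1) := by
  cases p <;> simp [addHead]

theorem mergeMap_addHead :
    mergeMap (Finsupp.single (addHead a p) 1) + addHeadMap a (mergeMap (Finsupp.single p 1)) = 0 := by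
  cases p with
  | nil => simp [addHead]
  | cons b p =>
    have : addHead a (addHead b p) = addHead (a + b) p := by
      cases p <;> simp [add_assoc]
    simp only [addHead_cons, mergeMap_cons, map_add, addHeadMap_single, addHeadMap_consMap, this]
    rw [ZModModule.add_self]

theorem mergeMap_mergeMap : mergeMap (mergeMap (Finsupp.single p 1)) = 0 := by
  induction p with
  | nil => simp
  | cons a p ih =>
    rw [mergeMap_cons, map_add, mergeMap_consMap, ih, map_zero, add_zero, mergeMap_addHead]

theorem dropFirst_merge_comm :
    dropFirstMap (mergeMap (Finsupp.single p 1)) + mergeMap (dropFirstMap (Finsupp.single p 1)) =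
      dropFirstMap (dropFirstMap (Finsupp.single p 1)) := by
  cases p with
  | nil => simp
  | cons a p =>
    rw [mergeMap_cons, map_add, dropFirstMap_consMap, dropFirstMap_addHead, dropFirstMap_cons,
      add_assoc, ZModModule.add_self, add_zero]

theorem partDiff_comp_partDiff : partDiff ∘ₗ partDiff = 0 := by
  refine partLin_ext fun p => ?_
  have h := dropFirst_merge_comm p
  simp only [partDiff, LinearMap.comp_apply, LinearMap.add_apply, map_add, mergeMap_mergeMap,
    LinearMap.zero_apply, zero_add]
  rw [← h, ← add_assoc, ZModModule.add_self]

theorem enlarge_enlarge (p : OrdPartition) : enlargeMap (enlargeMap (Finsupp.single p 1)) = 0 := by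
  induction p with
  | nil => simp [ZModModule.add_self]
  | cons a p ih =>
    simp only [enlargeMap_cons, map_add, enlargeMap_consMap, ih, map_zero, add_zero, consMap_single]
    generalize consMap 1 (consMap a _) = w
    generalize (Finsupp.single _ _ : PartChains) = u
    rw [add_assoc, add_assoc, ZModModule.add_self, add_zero, ZModModule.add_self]

theorem enlargeMap_comp_enlargeMap : enlargeMap ∘ₗ enlargeMap = 0 :=
  partLin_ext enlarge_enlarge

theorem dropFirst_enlarge_comm :
    dropFirstMap (enlargeMap (Finsupp.single p 1)) + enlargeMap (dropFirstMap (Finsupp.single p 1)) =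
      Finsupp.single p 1 := by
  cases p with
  | nil => simp
  | cons a p =>
    simp only [enlargeMap_cons, map_add, dropFirstMap_cons, dropFirstMap_consMap]
    rw [add_assoc, ZModModule.add_self, add_zero]

theorem enlarge_addHead :
    Finsupp.single ((1 + a) :: p) 1 + Finsupp.single (1 :: addHead a p) 1 +
      addHeadMap a (enlargeMap (Finsupp.single p 1)) +
      enlargeMap (Finsupp.single (addHead a p) 1) = 0 := by
  cases p with
  | nil =>
    simp only [addHead_nil, addHead_cons, enlargeMap_nil, addHeadMap_single, add_comm 1 a]
    generalize (Finsupp.single [a + 1] _ : PartChains) = w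
    generalize (Finsupp.single _ _ : PartChains) = u
    rw [add_right_comm w u w, ZModModule.add_self, zero_add, ZModModule.add_self]
  | cons b p =>
    simp only [addHead_cons, enlargeMap_cons, addHeadMap_single, map_add, addHeadMap_consMap,
      add_comm 1 a]
    generalize (Finsupp.single ((a + 1) :: b :: p) _ : PartChains) = w
    generalize (Finsupp.single _ _ : PartChains) = u
    generalize consMap _ _ = z
    rw [show w + u + (w + z) + (u + z) = (w + w) + (u + u) + (z + z) by abel]
    simp [ZModModule.add_self]

theorem merge_enlarge_comm (p : OrdPartition) :
    mergeMap (enlargeMap (Finsupp.single p 1)) + enlargeMap (mergeMap (Finsupp.single p 1)) =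
      Finsupp.single p 1 := by
  induction p with
  | nil => simp [addHead]
  | cons a p ih =>
    have h := enlarge_addHead a p
    simp only [enlargeMap_cons, mergeMap_cons, map_add, mergeMap_consMap, enlargeMap_consMap,
      consMap_single, addHead_cons]
    have ih' := congrArg (consMap a) ih
    rw [map_add, consMap_single] at ih'
    rw [← ih']
    generalize consMap a (mergeMap (enlargeMap _)) = u at *
    generalize consMap a (enlargeMap (mergeMap _)) = v at *
    generalize consMap 1 (consMap a _) = w at *
    generalize (Finsupp.single ((1 + a) :: p) _ : PartChains) = x at *
    generalize (Finsupp.single (1 :: addHead a p) _ : PartChains) = y at *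
    generalize addHeadMap a _ = s at *
    generalize enlargeMap (Finsupp.single (addHead a p) _) = t at *
    rw [show x + (y + w) + (s + u) + (t + (w + v)) = (x + y + s + t) + (w + w) + (u + v) by abel, h,
      ZModModule.add_self, zero_add, zero_add]

theorem partDiff_enlargeMap_comm : partDiff ∘ₗ enlargeMap = enlargeMap ∘ₗ partDiff := by
  refine partLin_ext fun p => ?_
  have h1 := merge_enlarge_comm p
  have h2 := dropFirst_enlarge_comm p
  simp only [partDiff, LinearMap.comp_apply, LinearMap.add_apply, map_add]
  rw [← sub_eq_zero, ZModModule.sub_eq_add, add_add_add_comm, h1, h2, ZModModule.add_self]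

/-- The homotopy that contracts the complex of ordered partitions onto the span of `∅` and `(1)`: it
sends `(a, …)` to the sum of all `(1, b, …)` with `0 < b < a`. -/
def partHomotopy : PartChains →ₗ[ZMod 2] PartChains :=
  Finsupp.linearCombination _ fun p => match p with
    | [] => 0
    | a :: p => ∑ b ∈ Finset.Iio a, Finsupp.single (1 :: b :: p) 1

/-- The projection of the complex of ordered partitions onto the span of `∅` and `(1)`. -/
def partProj : PartChains →ₗ[ZMod 2] PartChains :=
  Finsupp.linearCombination _ fun p => match p with
    | [] => Finsupp.single [] 1
    | [a] => (a : ZMod 2) • Finsupp.single [1] 1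
    | _ => 0

@[simp] theorem partHomotopy_nil : partHomotopy (Finsupp.single [] 1) = 0 := by
  simp [partHomotopy]

@[simp] theorem partHomotopy_cons : partHomotopy (Finsupp.single (a :: p) 1) =
    ∑ b ∈ Finset.Iio a, Finsupp.single (1 :: b :: p) 1 := by
  simp [partHomotopy]

theorem sum_Iio_add_one {M : Type*} [AddCommMonoid M] (f : ℕ+ → M) (a : ℕ+) :
    ∑ b ∈ Finset.Iio (a + 1), f b = (∑ b ∈ Finset.Iio a, f b) + f a := by
  have : Finset.Iio (a + 1) = insert a (Finset.Iio a) := by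
    ext b; simp only [Finset.mem_Iio, Finset.mem_insert, PNat.lt_add_one_iff]
    exact le_iff_eq_or_lt
  rw [this, Finset.sum_insert (by simp), add_comm]

theorem sum_Iio_telescope (f : ℕ+ → PartChains) (a : ℕ+) :
    ∑ b ∈ Finset.Iio a, (f b + f (1 + b)) = f 1 + f a := by
  induction a using PNat.recOn with
  | one => rw [show Finset.Iio (1 : ℕ+) = ∅ from rfl, Finset.sum_empty]; exact (ZModModule.add_self _).symm
  | succ a ih =>
    rw [sum_Iio_add_one, ih, add_comm 1 a, add_assoc, ← add_assoc (f a), ZModModule.add_self,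
      zero_add]

theorem sum_Iio_add (f : ℕ+ → PartChains) (a c : ℕ+) :
    ∑ b ∈ Finset.Iio (a + c), f b =
      (∑ b ∈ Finset.Iio c, f b) + f c + ∑ b ∈ Finset.Iio a, f (b + c) := by
  induction a using PNat.recOn with
  | one => rw [show Finset.Iio (1 : ℕ+) = ∅ from rfl, Finset.sum_empty, add_zero, add_comm, sum_Iio_add_one]
  | succ a ih => rw [add_right_comm, sum_Iio_add_one, ih, sum_Iio_add_one, add_assoc]

theorem partHomotopy_consMap :
    partHomotopy (consMap a v) = ∑ b ∈ Finset.Iio a, consMap 1 (consMap b v) := by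
  suffices h : partHomotopy ∘ₗ consMap a = ∑ b ∈ Finset.Iio a, consMap 1 ∘ₗ consMap b by
    simpa using LinearMap.congr_fun h v
  exact partLin_ext fun p => by simp

/-- The homotopy identity for one generator `(a, …)`. -/
theorem partDiff_partHomotopy_cons :
    partDiff (partHomotopy (Finsupp.single (a :: p) 1)) +
        partHomotopy (partDiff (Finsupp.single (a :: p) 1)) =
      Finsupp.single (a :: p) 1 + partProj (Finsupp.single (a :: p) 1) := by
  have h1 : partDiff (partHomotopy (Finsupp.single (a :: p) 1)) =
      ∑ b ∈ Finset.Iio a, (Finsupp.single (b :: p) 1 + Finsupp.single ((1 + b) :: p) 1) +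
      (∑ b ∈ Finset.Iio a, Finsupp.single (1 :: addHead b p) 1 +
        ∑ b ∈ Finset.Iio a, consMap 1 (consMap b (mergeMap (Finsupp.single p 1)))) := by
    rw [partHomotopy_cons, map_sum, ← Finset.sum_add_distrib, ← Finset.sum_add_distrib]
    refine Finset.sum_congr rfl fun b _ => ?_
    simp only [partDiff, LinearMap.add_apply, mergeMap_cons, dropFirstMap_cons, map_add,
      addHead_cons, consMap_single]
    abel
  have h2 : partHomotopy (partDiff (Finsupp.single (a :: p) 1)) =
      partHomotopy (Finsupp.single p 1) + partHomotopy (Finsupp.single (addHead a p) 1) +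
      ∑ b ∈ Finset.Iio a, consMap 1 (consMap b (mergeMap (Finsupp.single p 1))) := by
    simp only [partDiff, LinearMap.add_apply, mergeMap_cons, dropFirstMap_cons, map_add,
      partHomotopy_consMap]
    abel
  rw [h1, h2, sum_Iio_telescope fun b => Finsupp.single (b :: p) 1]
  generalize ∑ b ∈ Finset.Iio a, consMap 1 (consMap b (mergeMap (Finsupp.single p 1))) = z
  cases p with
  | nil =>
    simp only [addHead_nil, partHomotopy_nil, add_zero, zero_add, partProj,
      Finsupp.linearCombination_single, one_smul]
    have hc : ∑ b ∈ Finset.Iio a, (Finsupp.single [1] 1 : PartChains) + Finsupp.single [1] 1 =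
        (a : ZMod 2) • (Finsupp.single [1] 1 : PartChains) := by
      clear h1 h2
      induction a using PNat.recOn with
      | one => rw [show Finset.Iio (1 : ℕ+) = ∅ from rfl, Finset.sum_empty]; simp
      | succ a ih => rw [sum_Iio_add_one, ih, PNat.add_coe, Nat.cast_add, add_smul]; simp
    rw [← hc]
    generalize (Finsupp.single [1] 1 : PartChains) = x
    rw [show x + Finsupp.single [a] 1 + (∑ b ∈ Finset.Iio a, x + z) + z =
      Finsupp.single [a] 1 + (∑ b ∈ Finset.Iio a, x + x) + (z + z) by abel, ZModModule.add_self,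
      add_zero]
  | cons c p =>
    simp only [addHead_cons, partHomotopy_cons]
    rw [sum_Iio_add fun b => Finsupp.single (1 :: b :: p) 1]
    have : partProj (Finsupp.single (a :: c :: p) 1) = 0 := by simp [partProj]
    rw [this, add_zero]
    simp only [add_comm _ c]
    generalize ∑ b ∈ Finset.Iio a, (Finsupp.single (1 :: (c + b) :: p) 1 : PartChains) = x
    generalize ∑ b ∈ Finset.Iio c, (Finsupp.single (1 :: b :: p) 1 : PartChains) = y
    generalize (Finsupp.single (1 :: c :: p) 1 : PartChains) = u
    generalize (Finsupp.single (a :: c :: p) 1 : PartChains) = v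
    rw [show u + v + (x + z) + (y + (y + u + x) + z) = v + (x + x) + (y + y) + (z + z) + (u + u) by abel]
    simp [ZModModule.add_self]

theorem partDiff_partHomotopy :
    partDiff ∘ₗ partHomotopy + partHomotopy ∘ₗ partDiff = LinearMap.id + partProj := by
  refine partLin_ext fun p => ?_
  cases p with
  | nil => simp [partDiff, partProj, ZModModule.add_self]
  | cons a p => exact partDiff_partHomotopy_cons a p

end

/-! ### Cyclic arcs and rectangles -/

section Arcs
variable {n : ℕ}

/-- The cyclic successor in `Fin n`. -/
def cycSucc (i : Fin n) : Fin n := finRotate n i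

@[simp] theorem cycPred_cycSucc (i : Fin n) : cycPred (cycSucc i) = i :=
  (finRotate n).symm_apply_apply i

@[simp] theorem cycSucc_cycPred (i : Fin n) : cycSucc (cycPred i) = i :=
  (finRotate n).apply_symm_apply i

theorem cycSucc_val (i : Fin n) :
    (cycSucc i : ℕ) = if (i : ℕ) + 1 = n then 0 else (i : ℕ) + 1 := by
  obtain _ | m := n
  · exact i.elim0
  · rw [cycSucc, coe_finRotate]
    simp only [Fin.ext_iff, Fin.val_last]
    split_ifs <;> omega

theorem cycPred_val (i : Fin n) :
    (cycPred i : ℕ) = if (i : ℕ) = 0 then n - 1 else (i : ℕ) - 1 := by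
  have h := cycSucc_val (cycPred i)
  rw [cycSucc_cycPred] at h
  have := (cycPred i).isLt
  split_ifs at h ⊢ <;> omega

theorem sum_cycPred {M : Type*} [AddCommMonoid M] (f : Fin n → M) :
    ∑ i, f (cycPred i) = ∑ i, f i := Equiv.sum_comp (finRotate n).symm f

theorem fin_sub_val (k a : Fin n) :
    ((k - a : Fin n) : ℕ) = if (a : ℕ) ≤ k then (k : ℕ) - a else n + k - a := by
  have ha := a.isLt
  have hk := k.isLt
  rw [Fin.sub_def]
  simp only
  split_ifs with h
  · rw [show n - (a : ℕ) + k = (k - a) + n by omega, Nat.add_mod_right, Nat.mod_eq_of_lt (by omega)]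
  · rw [Nat.mod_eq_of_lt (by omega)]; omega

theorem inArc_iff (a b k : Fin n) : InArc a b k ↔
    ((a : ℕ) < b ∧ (a : ℕ) ≤ k ∧ (k : ℕ) < b) ∨ ((b : ℕ) < a ∧ ((a : ℕ) ≤ k ∨ (k : ℕ) < b)) := by
  have ha := a.isLt
  have hk := k.isLt
  have hb := b.isLt
  rw [InArc, Fin.lt_def, fin_sub_val, fin_sub_val]
  split_ifs <;> omega

open scoped Classical in
/-- The indicator function of the arc `[a, b)`. -/
def arcInd (a b k : Fin n) : ℤ := if InArc a b k then 1 else 0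

theorem arcInd_eq_zero {a b k : Fin n} : arcInd a b k = 0 ↔ ¬ InArc a b k := by
  simp [arcInd]

theorem arcInd_nonneg (a b k : Fin n) : 0 ≤ arcInd a b k := by
  rw [arcInd]; split_ifs <;> simp

theorem arcInd_add {a b c : Fin n} (h : InArc a c b) (k : Fin n) :
    arcInd a c k = arcInd a b k + arcInd b c k := by
  simp only [arcInd, inArc_iff] at *
  split_ifs <;> omega

theorem arcInd_add_swap {a b : Fin n} (h : a ≠ b) (k : Fin n) :
    arcInd a b k + arcInd b a k = 1 := by
  rw [Ne, Fin.ext_iff] at h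
  simp only [arcInd, inArc_iff]
  split_ifs <;> omega

theorem inArc_left {a b : Fin n} (h : a ≠ b) : InArc a b a := by
  rw [Ne, Fin.ext_iff] at h
  simp only [inArc_iff]; omega

theorem not_inArc_right (a b : Fin n) : ¬ InArc a b b := by
  simp only [inArc_iff]; omega

/-- An arc `[a, b)` that contains only its left end has length one. -/
theorem eq_cycSucc_iff (hn : 2 ≤ n) {a b : Fin n} (h : a ≠ b) :
    b = cycSucc a ↔ ∀ k, k ≠ a → k ≠ b → ¬ InArc a b k := by
  have ha := a.isLt
  have hb := b.isLt
  constructor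
  · rintro rfl k hka hkb
    have hk := k.isLt
    rw [Ne, Fin.ext_iff] at hka hkb
    rw [inArc_iff]
    rw [cycSucc_val] at *
    split_ifs at * <;> omega
  · intro hk
    by_contra hne
    have h2 : cycSucc a ≠ a := by
      rw [Ne, Fin.ext_iff, cycSucc_val]; split_ifs <;> omega
    refine hk (cycSucc a) h2 (Ne.symm hne) ?_
    rw [Ne, Fin.ext_iff] at h
    rw [Fin.ext_iff] at hne
    rw [inArc_iff]
    rw [cycSucc_val] at *
    split_ifs at * <;> omega

theorem cycSucc_ne (hn : 2 ≤ n) (a : Fin n) : cycSucc a ≠ a := by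
  have := a.isLt
  rw [Ne, Fin.ext_iff, cycSucc_val]; split_ifs <;> omega

theorem arcInd_cycSucc (hn : 2 ≤ n) (a k : Fin n) :
    arcInd a (cycSucc a) k = if k = a then 1 else 0 := by
  have h := (eq_cycSucc_iff hn (cycSucc_ne hn a).symm).1 rfl k
  have h1 := inArc_left (cycSucc_ne hn a).symm
  have h2 := not_inArc_right a (cycSucc a)
  rw [arcInd]
  by_cases hka : k = a
  · subst hka; simp [h1]
  · rw [if_neg hka, if_neg]
    by_cases hkb : k = cycSucc a
    · rwa [hkb]
    · exact h hka hkb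

/-- The boundary of the arc `[a, b)`. -/
theorem arcInd_cycPred (a b k : Fin n) :
    arcInd a b (cycPred k) - arcInd a b k = (if b = k then 1 else 0) - (if a = k then 1 else 0) := by
  have ha := a.isLt
  have hb := b.isLt
  have hk := k.isLt
  simp only [arcInd, inArc_iff, Fin.ext_iff, cycPred_val]
  split_ifs <;> omega

theorem rectChain_eq (x : State n) (a b k l : Fin n) :
    rectChain x a b k l = arcInd a b k * arcInd (x a) (x b) l := by
  simp only [rectChain, InRect, arcInd]
  by_cases h1 : InArc a b k <;> by_cases h2 : InArc (x a) (x b) l <;> simp [h1, h2]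

theorem rectChain_nonneg (x : State n) (a b k l : Fin n) : 0 ≤ rectChain x a b k l := by
  rw [rectChain_eq]; exact mul_nonneg (arcInd_nonneg _ _ _) (arcInd_nonneg _ _ _)

theorem rectChain_eq_zero {x : State n} {a b k l : Fin n} :
    rectChain x a b k l = 0 ↔ ¬ InRect x a b k l := by
  simp [rectChain]

theorem isGridDomain_rectChain (x : State n) {a b : Fin n} (h : a ≠ b) :
    IsGridDomain x (x * Equiv.swap a b) (rectChain x a b) := by
  intro i j
  have h1 : cornerCoeff (rectChain x a b) i j =
      -((arcInd a b (cycPred i) - arcInd a b i) *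
        (arcInd (x a) (x b) (cycPred j) - arcInd (x a) (x b) j)) := by
    simp only [cornerCoeff, alphaBoundary, rectChain_eq]; ring
  rw [h1, arcInd_cycPred, arcInd_cycPred]
  simp only [pointCoeff]
  by_cases hia : i = a
  · have hs : (x * Equiv.swap a b) i = x b := by rw [hia, Equiv.Perm.mul_apply, Equiv.swap_apply_left]
    rw [hs]; simp only [hia, if_neg h.symm, if_true]; ring
  · by_cases hib : i = b
    · have hs : (x * Equiv.swap a b) i = x a := by
        rw [hib, Equiv.Perm.mul_apply, Equiv.swap_apply_right]
      rw [hs]; simp only [hib, if_neg h, if_true]; ring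
    · have hs : (x * Equiv.swap a b) i = x i := by
        rw [Equiv.Perm.mul_apply, Equiv.swap_apply_of_ne_of_ne hia hib]
      simp only [hs, if_neg (Ne.symm hia), if_neg (Ne.symm hib)]; ring

end Arcs

/-! ### Compositions of two rectangles -/

section Pairs
variable {n : ℕ}

/-- The row of squares `j`. -/
def rowChain (j : Fin n) : TwoChain n := fun _ l => if l = j then 1 else 0

/-- The column of squares `i`. -/
def colChain (i : Fin n) : TwoChain n := fun k _ => if k = i then 1 else 0

/-- `(a, b)` and `(c, d)` are two composable rectangles, the first of which starts at `x`. -/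
def IsRectPair (x : State n) (a b c d : Fin n) : Prop :=
  IsRect x a b ∧ IsRect (x * Equiv.swap a b) c d

/-- The 2-chain of a composition of two rectangles. -/
def pairChain (x : State n) (a b c d : Fin n) : TwoChain n :=
  rectChain x a b + rectChain (x * Equiv.swap a b) c d

theorem isRect_iff {x : State n} {a b : Fin n} :
    IsRect x a b ↔ a ≠ b ∧ ∀ k, k ≠ a → k ≠ b → rectChain x a b k (x k) = 0 := by
  simp only [IsRect, rectChain_eq_zero]

/-- For three distinct columns, two rectangles on two of them each are composable if no other point
lies in their union and each is disjoint from the third point. -/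
theorem isRectPair_iff_of_three {x : State n} {a b c d p q r u v : Fin n}
    (hab : ∀ k, k ≠ a ∧ k ≠ b ↔ k = u ∨ (k ≠ p ∧ k ≠ q ∧ k ≠ r))
    (hcd : ∀ k, k ≠ c ∧ k ≠ d ↔ k = v ∨ (k ≠ p ∧ k ≠ q ∧ k ≠ r))
    (hp : a ≠ b) (hq : c ≠ d)
    (hx : ∀ k, k ≠ p ∧ k ≠ q ∧ k ≠ r → (x * Equiv.swap a b) k = x k) :
    IsRectPair x a b c d ↔ (¬ InRect x a b u (x u) ∧
      ¬ InRect (x * Equiv.swap a b) c d v ((x * Equiv.swap a b) v)) ∧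
      ∀ k, k ≠ p ∧ k ≠ q ∧ k ≠ r → pairChain x a b c d k (x k) = 0 := by
  rw [IsRectPair, isRect_iff, isRect_iff]
  simp only [← rectChain_eq_zero, pairChain, Pi.add_apply]
  constructor
  · rintro ⟨⟨-, h1⟩, -, h2⟩
    refine ⟨⟨h1 u ((hab u).2 (Or.inl rfl)).1 ((hab u).2 (Or.inl rfl)).2,
      h2 v ((hcd v).2 (Or.inl rfl)).1 ((hcd v).2 (Or.inl rfl)).2⟩, fun k hk => ?_⟩
    rw [h1 k ((hab k).2 (Or.inr hk)).1 ((hab k).2 (Or.inr hk)).2]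
    have := h2 k ((hcd k).2 (Or.inr hk)).1 ((hcd k).2 (Or.inr hk)).2
    rw [hx k hk] at this
    rw [this, add_zero]
  · rintro ⟨⟨h1, h2⟩, h3⟩
    refine ⟨⟨hp, fun k hka hkb => ?_⟩, hq, fun k hkc hkd => ?_⟩
    · rcases (hab k).1 ⟨hka, hkb⟩ with rfl | hk
      · exact h1
      · have := h3 k hk
        have h4 := rectChain_nonneg x a b k (x k)
        have h5 := rectChain_nonneg (x * Equiv.swap a b) c d k (x k)
        omega
    · rcases (hcd k).1 ⟨hkc, hkd⟩ with rfl | hk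
      · exact h2
      · have := h3 k hk
        have h4 := rectChain_nonneg x a b k (x k)
        have h5 := rectChain_nonneg (x * Equiv.swap a b) c d k (x k)
        rw [hx k hk]
        omega

/-- The six arcs between three distinct points are governed by the cyclic order of the points. -/
theorem inArc_three {a b e : Fin n} (hab : a ≠ b) (hbe : b ≠ e) (hae : a ≠ e) :
    (InArc a b e ↔ ¬ InArc a e b) ∧ (InArc b a e ↔ InArc a e b) ∧ (InArc b e a ↔ ¬ InArc a e b) ∧
      (InArc e b a ↔ InArc a e b) ∧ (InArc e a b ↔ ¬ InArc a e b) := by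
  rw [Ne, Fin.ext_iff] at hab hbe hae
  simp only [inArc_iff]; omega

theorem swap_val_left (x : State n) (a b : Fin n) : (x * Equiv.swap a b) a = x b := by
  rw [Equiv.Perm.mul_apply, Equiv.swap_apply_left]

theorem swap_val_right (x : State n) (a b : Fin n) : (x * Equiv.swap a b) b = x a := by
  rw [Equiv.Perm.mul_apply, Equiv.swap_apply_right]

theorem swap_val_of_ne (x : State n) {a b c : Fin n} (ha : c ≠ a) (hb : c ≠ b) :
    (x * Equiv.swap a b) c = x c := by
  rw [Equiv.Perm.mul_apply, Equiv.swap_apply_of_ne_of_ne ha hb]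

theorem swap_mul_swap_left (x : State n) {a b e : Fin n} (hab : a ≠ b) (hbe : b ≠ e) (hae : a ≠ e) :
    x * Equiv.swap a b * Equiv.swap a e = x * Equiv.swap b e * Equiv.swap a b ∧
    x * Equiv.swap a b * Equiv.swap a e = x * Equiv.swap a e * Equiv.swap e b := by
  constructor <;>
  · rw [mul_assoc, mul_assoc]
    congr 1
    ext k
    simp only [Equiv.Perm.mul_apply, Equiv.swap_apply_def]
    split_ifs <;> simp_all

theorem swap_mul_swap_right (x : State n) {a b e : Fin n} (hab : a ≠ b) (hbe : b ≠ e) (hae : a ≠ e) :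
    x * Equiv.swap a b * Equiv.swap e b = x * Equiv.swap e a * Equiv.swap a b ∧
    x * Equiv.swap a b * Equiv.swap e b = x * Equiv.swap e b * Equiv.swap a e := by
  constructor <;>
  · rw [mul_assoc, mul_assoc]
    congr 1
    ext k
    simp only [Equiv.Perm.mul_apply, Equiv.swap_apply_def]
    split_ifs <;> simp_all

set_option linter.unusedSimpArgs false

/-- The two cuts of a hexagon: a wide rectangle on top of a narrow one, left edges aligned. -/
theorem isRectPair_wide_left (x : State n) {a b e : Fin n} (hab : a ≠ b) (hbe : b ≠ e) (hae : a ≠ e) :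
    (IsRectPair x a b a e ∧ InArc a e b ↔ IsRectPair x b e a b ∧ InArc (x a) (x e) (x b)) ∧
      (InArc a e b → InArc (x a) (x e) (x b) → pairChain x a b a e = pairChain x b e a b) := by
  have hxab := x.injective.ne hab
  have hxbe := x.injective.ne hbe
  have hxae := x.injective.ne hae
  have hba := hab.symm
  have heb := hbe.symm
  have hea := hae.symm
  have hch : InArc a e b → InArc (x a) (x e) (x b) → pairChain x a b a e = pairChain x b e a b := by
    intro hb hx
    funext k l
    have h1 := fun k => arcInd_add hb k
    have h2 := fun l => arcInd_add hx l
    simp only [pairChain, Pi.add_apply, rectChain_eq, swap_val_left, swap_val_right,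
      swap_val_of_ne, ne_eq, hab, hbe, hae, hba, heb, hea, not_false_eq_true, h1, h2]
    ring
  refine ⟨?_, hch⟩
  rw [isRectPair_iff_of_three (p := a) (q := b) (r := e) (u := e) (v := b) (by grind) (by grind)
      (by assumption) (by assumption) (by grind [swap_val_of_ne]),
    isRectPair_iff_of_three (p := a) (q := b) (r := e) (u := a) (v := e) (by grind) (by grind)
      (by assumption) (by assumption) (by grind [swap_val_of_ne])]
  obtain ⟨c1, c2, c3, c4, c5⟩ := inArc_three hab hbe hae
  obtain ⟨r1, r2, r3, r4, r5⟩ := inArc_three hxab hxbe hxae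
  simp only [InRect, swap_val_left, swap_val_right, swap_val_of_ne, ne_eq, hab, hbe, hae, hba, heb,
    hea, not_false_eq_true, c1, c2, c3, c4, c5, r1, r2, r3, r4, r5] at hch ⊢
  by_cases hc : InArc a e b <;> by_cases hr : InArc (x a) (x e) (x b) <;> simp [hc, hr] at hch ⊢
  rw [hch]

/-- The two cuts of a hexagon: a narrow rectangle on top of a wide one, left edges aligned. -/
theorem isRectPair_narrow_left (x : State n) {a b e : Fin n} (hab : a ≠ b) (hbe : b ≠ e) (hae : a ≠ e) :
    (IsRectPair x a b a e ∧ InArc a b e ↔ IsRectPair x a e e b ∧ InArc (x a) (x e) (x b)) ∧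
      (InArc a b e → InArc (x a) (x e) (x b) → pairChain x a b a e = pairChain x a e e b) := by
  have hxab := x.injective.ne hab
  have hxbe := x.injective.ne hbe
  have hxae := x.injective.ne hae
  have hba := hab.symm
  have heb := hbe.symm
  have hea := hae.symm
  have hch : InArc a b e → InArc (x a) (x e) (x b) → pairChain x a b a e = pairChain x a e e b := by
    intro hb hx
    funext k l
    have h1 := fun k => arcInd_add hb k
    have h2 := fun l => arcInd_add hx l
    simp only [pairChain, Pi.add_apply, rectChain_eq, swap_val_left, swap_val_right,
      swap_val_of_ne, ne_eq, hab, hbe, hae, hba, heb, hea, not_false_eq_true, h1, h2]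
    ring
  refine ⟨?_, hch⟩
  rw [isRectPair_iff_of_three (p := a) (q := b) (r := e) (u := e) (v := b) (by grind) (by grind)
      (by assumption) (by assumption) (by grind [swap_val_of_ne]),
    isRectPair_iff_of_three (p := a) (q := b) (r := e) (u := b) (v := a) (by grind) (by grind)
      (by assumption) (by assumption) (by grind [swap_val_of_ne])]
  obtain ⟨c1, c2, c3, c4, c5⟩ := inArc_three hab hbe hae
  obtain ⟨r1, r2, r3, r4, r5⟩ := inArc_three hxab hxbe hxae
  simp only [InRect, swap_val_left, swap_val_right, swap_val_of_ne, ne_eq, hab, hbe, hae, hba, heb,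
    hea, not_false_eq_true, c1, c2, c3, c4, c5, r1, r2, r3, r4, r5] at hch ⊢
  by_cases hc : InArc a e b <;> by_cases hr : InArc (x a) (x e) (x b) <;> simp [hc, hr] at hch ⊢
  rw [hch]

/-- The two cuts of a hexagon: a wide rectangle below a narrow one, right edges aligned. -/
theorem isRectPair_wide_right (x : State n) {a b e : Fin n} (hab : a ≠ b) (hbe : b ≠ e) (hae : a ≠ e) :
    (IsRectPair x a b e b ∧ InArc e b a ↔ IsRectPair x e a a b ∧ InArc (x e) (x b) (x a)) ∧
      (InArc e b a → InArc (x e) (x b) (x a) → pairChain x a b e b = pairChain x e a a b) := by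
  have hxab := x.injective.ne hab
  have hxbe := x.injective.ne hbe
  have hxae := x.injective.ne hae
  have hba := hab.symm
  have heb := hbe.symm
  have hea := hae.symm
  have hch : InArc e b a → InArc (x e) (x b) (x a) → pairChain x a b e b = pairChain x e a a b := by
    intro hb hx
    funext k l
    have h1 := fun k => arcInd_add hb k
    have h2 := fun l => arcInd_add hx l
    simp only [pairChain, Pi.add_apply, rectChain_eq, swap_val_left, swap_val_right,
      swap_val_of_ne, ne_eq, hab, hbe, hae, hba, heb, hea, not_false_eq_true, h1, h2]
    ring
  refine ⟨?_, hch⟩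
  rw [isRectPair_iff_of_three (p := a) (q := b) (r := e) (u := e) (v := a) (by grind) (by grind)
      (by assumption) (by assumption) (by grind [swap_val_of_ne]),
    isRectPair_iff_of_three (p := a) (q := b) (r := e) (u := b) (v := e) (by grind) (by grind)
      (by assumption) (by assumption) (by grind [swap_val_of_ne])]
  obtain ⟨c1, c2, c3, c4, c5⟩ := inArc_three hab hbe hae
  obtain ⟨r1, r2, r3, r4, r5⟩ := inArc_three hxab hxbe hxae
  simp only [InRect, swap_val_left, swap_val_right, swap_val_of_ne, ne_eq, hab, hbe, hae, hba, heb,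
    hea, not_false_eq_true, c1, c2, c3, c4, c5, r1, r2, r3, r4, r5] at hch ⊢
  by_cases hc : InArc a e b <;> by_cases hr : InArc (x a) (x e) (x b) <;> simp [hc, hr] at hch ⊢
  rw [hch]

/-- The two cuts of a hexagon: a narrow rectangle below a wide one, right edges aligned. -/
theorem isRectPair_narrow_right (x : State n) {a b e : Fin n} (hab : a ≠ b) (hbe : b ≠ e) (hae : a ≠ e) :
    (IsRectPair x a b e b ∧ InArc a b e ↔ IsRectPair x e b a e ∧ InArc (x e) (x b) (x a)) ∧
      (InArc a b e → InArc (x e) (x b) (x a) → pairChain x a b e b = pairChain x e b a e) := by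
  have hxab := x.injective.ne hab
  have hxbe := x.injective.ne hbe
  have hxae := x.injective.ne hae
  have hba := hab.symm
  have heb := hbe.symm
  have hea := hae.symm
  have hch : InArc a b e → InArc (x e) (x b) (x a) → pairChain x a b e b = pairChain x e b a e := by
    intro hb hx
    funext k l
    have h1 := fun k => arcInd_add hb k
    have h2 := fun l => arcInd_add hx l
    simp only [pairChain, Pi.add_apply, rectChain_eq, swap_val_left, swap_val_right,
      swap_val_of_ne, ne_eq, hab, hbe, hae, hba, heb, hea, not_false_eq_true, h1, h2]
    ring
  refine ⟨?_, hch⟩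
  rw [isRectPair_iff_of_three (p := a) (q := b) (r := e) (u := e) (v := a) (by grind) (by grind)
      (by assumption) (by assumption) (by grind [swap_val_of_ne]),
    isRectPair_iff_of_three (p := a) (q := b) (r := e) (u := a) (v := b) (by grind) (by grind)
      (by assumption) (by assumption) (by grind [swap_val_of_ne])]
  obtain ⟨c1, c2, c3, c4, c5⟩ := inArc_three hab hbe hae
  obtain ⟨r1, r2, r3, r4, r5⟩ := inArc_three hxab hxbe hxae
  simp only [InRect, swap_val_left, swap_val_right, swap_val_of_ne, ne_eq, hab, hbe, hae, hba, heb,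
    hea, not_false_eq_true, c1, c2, c3, c4, c5, r1, r2, r3, r4, r5] at hch ⊢
  by_cases hc : InArc a e b <;> by_cases hr : InArc (x a) (x e) (x b) <;> simp [hc, hr] at hch ⊢
  rw [hch]

theorem inArc_cross_right {a b c d : Fin n} (hbd : b ≠ d) (ha : InArc c d a) (hb : ¬ InArc c d b) :
    InArc a b d := by
  rw [Ne, Fin.ext_iff] at hbd
  simp only [inArc_iff] at *; omega

theorem inArc_cross_left {a b c d : Fin n} (hbc : b ≠ c) (hb : InArc c d b) (ha : ¬ InArc c d a) :
    InArc a b c := by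
  rw [Ne, Fin.ext_iff] at hbc
  simp only [inArc_iff] at *; omega

/-- Two rectangles with four distinct corner columns can be composed in either order. -/
theorem isRectPair_disjoint (x : State n) {a b c d : Fin n} (hac : a ≠ c) (had : a ≠ d)
    (hbc : b ≠ c) (hbd : b ≠ d) (h : IsRectPair x a b c d) : IsRectPair x c d a b := by
  obtain ⟨⟨hab, h1⟩, hcd, h2⟩ := h
  have xac := x.injective.ne hac
  have xad := x.injective.ne had
  have xbc := x.injective.ne hbc
  have xbd := x.injective.ne hbd
  have pc := h1 c hac.symm hbc.symm
  have pd := h1 d had.symm hbd.symm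
  have pa := h2 a hac had
  have pb := h2 b hbc hbd
  simp only [InRect, swap_val_left, swap_val_right, swap_val_of_ne x hac.symm hbc.symm,
    swap_val_of_ne x had.symm hbd.symm] at pc pd pa pb
  refine ⟨⟨hcd, fun k hkc hkd hk => ?_⟩, hab, fun k hka hkb hk => ?_⟩
  · by_cases hka : k = a
    · subst hka
      exact pd ⟨inArc_cross_right hbd hk.1 fun h => pb ⟨h, hk.2⟩,
        inArc_cross_right xbd hk.2 fun h => pa ⟨hk.1, h⟩⟩
    by_cases hkb : k = b
    · subst hkb
      exact pc ⟨inArc_cross_left hbc hk.1 fun h => pa ⟨h, hk.2⟩,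
        inArc_cross_left xbc hk.2 fun h => pb ⟨hk.1, h⟩⟩
    refine h2 k hkc hkd ?_
    simpa only [InRect, swap_val_of_ne x hka hkb, swap_val_of_ne x hac.symm hbc.symm,
      swap_val_of_ne x had.symm hbd.symm] using hk
  · by_cases hkc : k = c
    · subst hkc
      simp only [InRect, swap_val_left, swap_val_of_ne x hac had, swap_val_of_ne x hbc hbd] at hk
      exact pb ⟨inArc_cross_right hbd.symm hk.1 fun h => pd ⟨h, hk.2⟩,
        inArc_cross_left xad.symm hk.2 fun h => pc ⟨hk.1, h⟩⟩
    by_cases hkd : k = d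
    · subst hkd
      simp only [InRect, swap_val_right, swap_val_of_ne x hac had, swap_val_of_ne x hbc hbd] at hk
      exact pa ⟨inArc_cross_left had.symm hk.1 fun h => pc ⟨h, hk.2⟩,
        inArc_cross_right xbd.symm hk.2 fun h => pd ⟨hk.1, h⟩⟩
    refine h1 k hka hkb ?_
    simpa only [InRect, swap_val_of_ne x hkc hkd, swap_val_of_ne x hac had,
      swap_val_of_ne x hbc hbd] using hk

theorem pairChain_disjoint (x : State n) {a b c d : Fin n} (hac : a ≠ c) (had : a ≠ d)
    (hbc : b ≠ c) (hbd : b ≠ d) : pairChain x a b c d = pairChain x c d a b := by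
  funext k l
  simp only [pairChain, Pi.add_apply, rectChain_eq, swap_val_of_ne x hac had,
    swap_val_of_ne x hbc hbd, swap_val_of_ne x hac.symm hbc.symm, swap_val_of_ne x had.symm hbd.symm]
  ring

theorem swap_mul_swap_disjoint (x : State n) {a b c d : Fin n} (hac : a ≠ c) (had : a ≠ d)
    (hbc : b ≠ c) (hbd : b ≠ d) :
    x * Equiv.swap a b * Equiv.swap c d = x * Equiv.swap c d * Equiv.swap a b := by
  rw [mul_assoc, mul_assoc]
  congr 1
  ext k
  simp only [Equiv.Perm.mul_apply, Equiv.swap_apply_def]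
  split_ifs <;> simp_all

/-- Two rectangles that compose to a horizontal annulus. -/
theorem isRectPair_row (hn : 2 ≤ n) (x : State n) {a b : Fin n} (hab : a ≠ b) :
    IsRectPair x a b b a ↔ x b = cycSucc (x a) := by
  have xab := x.injective.ne hab
  rw [eq_cycSucc_iff hn xab]
  constructor
  · rintro ⟨⟨-, h1⟩, -, h2⟩ l hla hlb hl
    obtain ⟨k, rfl⟩ := x.surjective l
    have hka : k ≠ a := fun h => hla (by rw [h])
    have hkb : k ≠ b := fun h => hlb (by rw [h])
    have h3 := h1 k hka hkb
    have h4 := h2 k hkb hka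
    simp only [InRect, swap_val_left, swap_val_right, swap_val_of_ne x hka hkb, hl, and_true] at h3 h4
    have := arcInd_add_swap hab k
    rw [arcInd_eq_zero.2 h3, arcInd_eq_zero.2 h4] at this
    omega
  · intro h
    refine ⟨⟨hab, fun k hka hkb hk => h _ (x.injective.ne hka) (x.injective.ne hkb) hk.2⟩,
      hab.symm, fun k hkb hka hk => ?_⟩
    simp only [InRect, swap_val_left, swap_val_right, swap_val_of_ne x hka hkb] at hk
    exact h _ (x.injective.ne hka) (x.injective.ne hkb) hk.2

theorem pairChain_row (hn : 2 ≤ n) (x : State n) {a b : Fin n} (hab : a ≠ b)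
    (h : x b = cycSucc (x a)) : pairChain x a b b a = rowChain (x a) := by
  funext k l
  simp only [pairChain, Pi.add_apply, rectChain_eq, swap_val_left, swap_val_right]
  rw [← add_mul, arcInd_add_swap hab, one_mul, h, arcInd_cycSucc hn, rowChain]

/-- Two rectangles that compose to a vertical annulus. -/
theorem isRectPair_col (hn : 2 ≤ n) (x : State n) {a b : Fin n} (hab : a ≠ b) :
    IsRectPair x a b a b ↔ b = cycSucc a := by
  have xab := x.injective.ne hab
  rw [eq_cycSucc_iff hn hab]
  constructor
  · rintro ⟨⟨-, h1⟩, -, h2⟩ k hka hkb hk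
    have h3 := h1 k hka hkb
    have h4 := h2 k hka hkb
    simp only [InRect, swap_val_left, swap_val_right, swap_val_of_ne x hka hkb, hk, true_and] at h3 h4
    have := arcInd_add_swap xab (x k)
    rw [arcInd_eq_zero.2 h3, arcInd_eq_zero.2 h4] at this
    omega
  · intro h
    exact ⟨⟨hab, fun k hka hkb hk => h _ hka hkb hk.1⟩,
      hab, fun k hka hkb hk => h _ hka hkb hk.1⟩

theorem pairChain_col (hn : 2 ≤ n) (x : State n) {a b : Fin n} (hab : a ≠ b)
    (h : b = cycSucc a) : pairChain x a b a b = colChain a := by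
  funext k l
  have xab := x.injective.ne hab
  simp only [pairChain, Pi.add_apply, rectChain_eq, swap_val_left, swap_val_right]
  rw [← mul_add, arcInd_add_swap xab, mul_one, h, arcInd_cycSucc hn, colChain]

/-! ### Cancellation in sums over compositions of two rectangles -/

section Sum
variable {M : Type*} [AddCommGroup M] (g : State n → TwoChain n → M)

open scoped Classical in
/-- The contribution of a pair of rectangles to a sum over all composable pairs. -/
def pairTerm (x : State n) (a b c d : Fin n) : M :=
  if IsRectPair x a b c d then g (x * Equiv.swap a b * Equiv.swap c d) (pairChain x a b c d) else 0

theorem pairTerm_eq_zero (x : State n) {a b c d : Fin n} (h : a = b ∨ c = d) :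
    pairTerm g x a b c d = 0 := by
  rw [pairTerm, if_neg]
  rintro ⟨⟨h1, -⟩, h2, -⟩
  tauto

/-- Grouping the pairs `(c, d)` by their intersection with `{a, b}`. -/
theorem sum_sum_split (f : Fin n → Fin n → M) (hf : ∀ c, f c c = 0) {a b : Fin n} (hab : a ≠ b) :
    ∑ c, ∑ d, f c d = f a b + f b a +
      (∑ e, if e ≠ a ∧ e ≠ b then f a e + f e b + f b e + f e a else 0) +
      ∑ c, ∑ d, if (c ≠ a ∧ c ≠ b) ∧ d ≠ a ∧ d ≠ b then f c d else 0 := by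
  have key : ∀ h : Fin n → M, ∑ c, h c = h a + h b + ∑ c, if c ≠ a ∧ c ≠ b then h c else 0 := by
    intro h
    have : ∀ c, h c = (if c = a then h a else 0) + (if c = b then h b else 0) +
        if c ≠ a ∧ c ≠ b then h c else 0 := by
      intro c
      by_cases h1 : c = a
      · subst h1; simp [hab]
      · by_cases h2 : c = b
        · subst h2; simp [h1]
        · simp [h1, h2]
    rw [Finset.sum_congr rfl fun c _ => this c]
    simp [Finset.sum_add_distrib]
  rw [key fun c => ∑ d, f c d, key (f a), key (f b), hf, hf]
  have : ∀ c, (if c ≠ a ∧ c ≠ b then ∑ d, f c d else 0) =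
      (if c ≠ a ∧ c ≠ b then f c a + f c b else 0) +
        ∑ d, if (c ≠ a ∧ c ≠ b) ∧ d ≠ a ∧ d ≠ b then f c d else 0 := by
    intro c
    by_cases hc : c ≠ a ∧ c ≠ b
    · rw [if_pos hc, if_pos hc, key (f c)]
      congr 1
      exact Finset.sum_congr rfl fun d _ => by simp [hc]
    · rw [if_neg hc, if_neg hc]; simp only [hc, false_and, if_false, Finset.sum_const_zero, add_zero]
  rw [Finset.sum_congr rfl fun c _ => this c, Finset.sum_add_distrib]
  have h2 : (∑ e, if e ≠ a ∧ e ≠ b then f a e + f e b + f b e + f e a else 0) =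
      (∑ e, if e ≠ a ∧ e ≠ b then f a e else 0) + (∑ e, if e ≠ a ∧ e ≠ b then f b e else 0) +
      ∑ e, if e ≠ a ∧ e ≠ b then f e a + f e b else 0 := by
    rw [← Finset.sum_add_distrib, ← Finset.sum_add_distrib]
    refine Finset.sum_congr rfl fun e _ => ?_
    split_ifs
    · abel
    · simp
  rw [h2]
  abel

open scoped Classical in
/-- A sum over triples of distinct columns vanishes, as the two cuts of every hexagon agree. -/
theorem sum_triples_eq_zero [Module (ZMod 2) M] (x : State n) :
    ∑ a, ∑ b, ∑ e, (if a ≠ b ∧ b ≠ e ∧ a ≠ e then pairTerm g x a b a e + pairTerm g x a b e b +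
      pairTerm g x a b b e + pairTerm g x a b e a else 0) = 0 := by
  let u : (Fin n → Fin n → Fin n → Prop) → (Fin n → Fin n → Fin n → M) → Fin n → Fin n → Fin n → M :=
    fun P t a b e => if (a ≠ b ∧ b ≠ e ∧ a ≠ e) ∧ P a b e then t a b e else 0
  have split : ∀ P t a b e, (if a ≠ b ∧ b ≠ e ∧ a ≠ e then t a b e else 0) =
      u P t a b e + u (fun a b e => ¬ P a b e) t a b e := by
    intro P t a b e
    simp only [u]
    by_cases h1 : (a ≠ b ∧ b ≠ e ∧ a ≠ e) <;> by_cases h2 : P a b e <;> simp [h1, h2]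
  let C : Fin n → Fin n → Fin n → Prop := fun a b e => InArc a e b
  let R : Fin n → Fin n → Fin n → Prop := fun a b e => InArc (x a) (x e) (x b)
  let T1 : Fin n → Fin n → Fin n → M := fun a b e => pairTerm g x a b a e
  let T2 : Fin n → Fin n → Fin n → M := fun a b e => pairTerm g x a b e b
  let T3 : Fin n → Fin n → Fin n → M := fun a b e => pairTerm g x a b b e
  let T4 : Fin n → Fin n → Fin n → M := fun a b e => pairTerm g x a b e a
  have aux : ∀ {a b c d a' b' c' d' : Fin n} {P Q : Prop},
      ((IsRectPair x a b c d ∧ P ↔ IsRectPair x a' b' c' d' ∧ Q) ∧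
        (P → Q → pairChain x a b c d = pairChain x a' b' c' d')) →
      x * Equiv.swap a b * Equiv.swap c d = x * Equiv.swap a' b' * Equiv.swap c' d' →
      (if P then pairTerm g x a b c d else 0) = if Q then pairTerm g x a' b' c' d' else 0 := by
    intro a b c d a' b' c' d' P Q h hs
    simp only [pairTerm, ← ite_and]
    by_cases hP : IsRectPair x a b c d ∧ P
    · have hQ := h.1.1 hP
      rw [if_pos ⟨hP.2, hP.1⟩, if_pos ⟨hQ.2, hQ.1⟩, hs, h.2 hP.2 hQ.2]
    · rw [if_neg fun h' => hP ⟨h'.2, h'.1⟩, if_neg fun h' => hP (h.1.2 ⟨h'.2, h'.1⟩)]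
  let R' : Fin n → Fin n → Fin n → Prop := fun a b e => ¬ R a b e
  -- each term with aligned left or right edges equals, in one of the two cyclic orders, a term in
  -- which one rectangle starts where the other ends
  have e1 : ∀ a b e, u C T1 a b e = u R T4 b e a := by
    intro a b e
    by_cases hd : a ≠ b ∧ b ≠ e ∧ a ≠ e
    · obtain ⟨h1, h2, h3⟩ := hd
      have hr := inArc_three (x.injective.ne h1) (x.injective.ne h2) (x.injective.ne h3)
      have := aux (isRectPair_wide_left x h1 h2 h3) (swap_mul_swap_left x h1 h2 h3).1
      simp only [u, C, R, T1, T4, h1, h2, h3, h1.symm, h3.symm, ne_eq, not_false_eq_true, true_and,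
        hr.2.1]
      exact this
    · simp only [u]
      rw [if_neg (by tauto), if_neg (by grind)]
  have e2 : ∀ a b e, u (fun a b e => ¬ C a b e) T1 a b e = u R' T3 a e b := by
    intro a b e
    by_cases hd : a ≠ b ∧ b ≠ e ∧ a ≠ e
    · obtain ⟨h1, h2, h3⟩ := hd
      have hc := inArc_three h1 h2 h3
      have hr := inArc_three (x.injective.ne h1) (x.injective.ne h2) (x.injective.ne h3)
      have := aux (isRectPair_narrow_left x h1 h2 h3) (swap_mul_swap_left x h1 h2 h3).2
      simp only [u, C, R, R', T1, T3, h1, h2, h3, h2.symm, ne_eq, not_false_eq_true, true_and,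
        hr.1, not_not]
      simp only [hc.1] at this
      exact this
    · simp only [u]
      rw [if_neg (by tauto), if_neg (by grind)]
  have e3 : ∀ a b e, u C T2 a b e = u R T3 e a b := by
    intro a b e
    by_cases hd : a ≠ b ∧ b ≠ e ∧ a ≠ e
    · obtain ⟨h1, h2, h3⟩ := hd
      have hc := inArc_three h1 h2 h3
      have := aux (isRectPair_wide_right x h1 h2 h3) (swap_mul_swap_right x h1 h2 h3).1
      simp only [u, C, R, T2, T3, h1, h2, h3, h2.symm, h3.symm, ne_eq, not_false_eq_true, true_and]
      simp only [hc.2.2.2.1] at this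
      exact this
    · simp only [u]
      rw [if_neg (by tauto), if_neg (by grind)]
  have e4 : ∀ a b e, u (fun a b e => ¬ C a b e) T2 a b e = u R' T4 e b a := by
    intro a b e
    by_cases hd : a ≠ b ∧ b ≠ e ∧ a ≠ e
    · obtain ⟨h1, h2, h3⟩ := hd
      have hc := inArc_three h1 h2 h3
      have hr := inArc_three (x.injective.ne h1) (x.injective.ne h2) (x.injective.ne h3)
      have := aux (isRectPair_narrow_right x h1 h2 h3) (swap_mul_swap_right x h1 h2 h3).2
      simp only [u, C, R, R', T2, T4, h1.symm, h1, h2, h3, h2.symm, h3.symm, ne_eq, not_false_eq_true,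
        true_and, hr.2.2.2.2, not_not]
      simp only [hc.1, hr.2.2.2.1] at this
      exact this
    · simp only [u]
      rw [if_neg (by tauto), if_neg (by grind)]
  have expand : ∀ a b e, (if a ≠ b ∧ b ≠ e ∧ a ≠ e then pairTerm g x a b a e + pairTerm g x a b e b +
      pairTerm g x a b b e + pairTerm g x a b e a else 0) =
      (u R T4 b e a + u R' T3 a e b) +
      (u R T3 e a b + u R' T4 e b a) +
      (u R T3 a b e + u R' T3 a b e) +
      (u R T4 a b e + u R' T4 a b e) := by
    intro a b e
    rw [← e1, ← e2, ← e3, ← e4, ← split C T1, ← split C T2, ← split R T3, ← split R T4]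
    split_ifs <;> simp [T1, T2, T3, T4]
  simp only [expand, Finset.sum_add_distrib]
  have p1 : ∀ v : Fin n → Fin n → Fin n → M,
      ∑ a, ∑ b, ∑ e, v a e b = ∑ a, ∑ b, ∑ e, v a b e := fun v =>
    Finset.sum_congr rfl fun a _ => Finset.sum_comm
  have p2 : ∀ v : Fin n → Fin n → Fin n → M,
      ∑ a, ∑ b, ∑ e, v b a e = ∑ a, ∑ b, ∑ e, v a b e := fun v => Finset.sum_comm
  have q1 : ∑ a, ∑ b, ∑ e, u R T4 b e a = ∑ a, ∑ b, ∑ e, u R T4 a b e := by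
    rw [p2 fun a b e => u R T4 a e b, p1]
  have q2 : ∑ a, ∑ b, ∑ e, u R T3 e a b = ∑ a, ∑ b, ∑ e, u R T3 a b e := by
    rw [p1 fun a b e => u R T3 b a e, p2]
  have q3 : ∑ a, ∑ b, ∑ e, u R' T4 e b a =
      ∑ a, ∑ b, ∑ e, u R' T4 a b e := by
    rw [p1 fun a b e => u R' T4 b e a, p2 fun a b e => u R' T4 a e b, p1]
  rw [q1, q2, q3, p1 (u R' T3)]
  generalize ∑ a, ∑ b, ∑ e, u R T4 a b e = w1
  generalize ∑ a, ∑ b, ∑ e, u R T3 a b e = w2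
  generalize ∑ a, ∑ b, ∑ e, u R' T4 a b e = w3
  generalize ∑ a, ∑ b, ∑ e, u R' T3 a b e = w4
  rw [show w1 + w4 + (w2 + w3) + (w2 + w4) + (w1 + w3) =
    (w1 + w1) + (w2 + w2) + (w3 + w3) + (w4 + w4) by abel]
  simp [ZModModule.add_self]

theorem sum_symm_eq_zero [Module (ZMod 2) M] {ι : Type*} [Fintype ι] (F : ι → ι → M)
    (hF : ∀ p q, F p q = F q p) (h0 : ∀ p, F p p = 0) : ∑ p, ∑ q, F p q = 0 := by
  rw [← Fintype.sum_prod_type']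
  refine Finset.sum_involution (fun p _ => p.swap) (fun p _ => ?_) (fun p _ hp h => ?_)
    (fun _ _ => Finset.mem_univ _) (fun p _ => Prod.swap_swap p)
  · rw [Prod.fst_swap, Prod.snd_swap, hF p.2, ZModModule.add_self]
  · refine hp ?_
    have : p.1 = p.2 := (congrArg Prod.snd h)
    rw [this, h0]

open scoped Classical in
/-- The sum over pairs of rectangles without a common corner column vanishes, as the two rectangles
can be exchanged. -/
theorem sum_disjoint_eq_zero [Module (ZMod 2) M] (x : State n) :
    ∑ a, ∑ b, ∑ c, ∑ d, (if a ≠ b ∧ (c ≠ a ∧ c ≠ b) ∧ d ≠ a ∧ d ≠ b then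
      pairTerm g x a b c d else 0) = 0 := by
  let F : Fin n × Fin n → Fin n × Fin n → M := fun p q =>
    if p.1 ≠ p.2 ∧ (q.1 ≠ p.1 ∧ q.1 ≠ p.2) ∧ q.2 ≠ p.1 ∧ q.2 ≠ p.2 then
      pairTerm g x p.1 p.2 q.1 q.2 else 0
  have h := sum_symm_eq_zero F (fun p q => ?_) fun p => by simp [F]
  · rw [Fintype.sum_prod_type] at h
    refine Eq.trans ?_ h
    refine Finset.sum_congr rfl fun a _ => Finset.sum_congr rfl fun b _ => ?_
    rw [Fintype.sum_prod_type]
  · have imp : ∀ p q, F p q ≠ 0 → F p q = F q p := by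
      rintro ⟨a, b⟩ ⟨c, d⟩ h
      simp only [F, ne_eq, ite_eq_right_iff, Classical.not_imp] at h ⊢
      obtain ⟨⟨h1, ⟨h2, h3⟩, h4, h5⟩, h6⟩ := h
      have hp : IsRectPair x a b c d := by
        by_contra hp; rw [pairTerm, if_neg hp] at h6; exact h6 rfl
      have hp' := isRectPair_disjoint x (Ne.symm h2) (Ne.symm h4) (Ne.symm h3) (Ne.symm h5) hp
      rw [if_pos (by tauto), if_pos ⟨hp.2.1, by grind⟩, pairTerm, pairTerm, if_pos hp, if_pos hp',
        pairChain_disjoint x (Ne.symm h2) (Ne.symm h4) (Ne.symm h3) (Ne.symm h5),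
        swap_mul_swap_disjoint x (Ne.symm h2) (Ne.symm h4) (Ne.symm h3) (Ne.symm h5)]
    by_cases h1 : F p q = 0
    · by_cases h2 : F q p = 0
      · rw [h1, h2]
      · exact (imp q p h2).symm
    · exact imp p q h1

/-- **Cancellation of compositions of two rectangles.**  Modulo 2, a sum over all compositions of two
rectangles starting at `x`, of terms that depend only on the resulting domain, reduces to the thin
annuli. -/
theorem sum_pairTerm [Module (ZMod 2) M] (hn : 2 ≤ n) (x : State n) :
    ∑ a, ∑ b, ∑ c, ∑ d, pairTerm g x a b c d = ∑ j, (g x (rowChain j) + g x (colChain j)) := by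
  classical
  have h1 : ∀ a b, ∑ c, ∑ d, pairTerm g x a b c d =
      (if a ≠ b then pairTerm g x a b b a else 0) + (if a ≠ b then pairTerm g x a b a b else 0) +
      (∑ e, if a ≠ b ∧ b ≠ e ∧ a ≠ e then pairTerm g x a b a e + pairTerm g x a b e b +
        pairTerm g x a b b e + pairTerm g x a b e a else 0) +
      ∑ c, ∑ d, (if a ≠ b ∧ (c ≠ a ∧ c ≠ b) ∧ d ≠ a ∧ d ≠ b then pairTerm g x a b c d else 0) := by
    intro a b
    by_cases hab : a = b
    · subst hab
      simp [pairTerm_eq_zero g x (Or.inl (rfl : a = a))]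
    · rw [sum_sum_split _ (fun c => pairTerm_eq_zero g x (Or.inr rfl)) hab]
      simp only [ne_eq, hab, not_false_eq_true, true_and, if_true]
      congr 2
      · rw [add_comm]
      · refine Finset.sum_congr rfl fun e _ => ?_
        exact if_congr (by grind) rfl rfl
  simp only [h1, Finset.sum_add_distrib, sum_triples_eq_zero g x, sum_disjoint_eq_zero g x, add_zero]
  -- what remains are the two rectangles in the same two columns, which form a row or a column
  congr 1
  · rw [← Equiv.sum_comp x fun j => g x (rowChain j)]
    refine Finset.sum_congr rfl fun a _ => ?_
    have : ∀ b, (if a ≠ b then pairTerm g x a b b a else 0) =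
        if b = x.symm (cycSucc (x a)) then g x (rowChain (x a)) else 0 := by
      intro b
      simp only [Equiv.eq_symm_apply]
      by_cases hab : a = b
      · subst hab
        rw [if_neg (by simp), if_neg (cycSucc_ne hn _).symm]
      · rw [if_pos hab, pairTerm]
        simp only [isRectPair_row hn x hab]
        by_cases h : x b = cycSucc (x a)
        · rw [if_pos h, if_pos h, pairChain_row hn x hab h, Equiv.swap_comm b a, mul_assoc,
            Equiv.swap_mul_self, mul_one]
        · rw [if_neg h, if_neg h]
    rw [Finset.sum_congr rfl fun b _ => this b, Finset.sum_ite_eq', if_pos (Finset.mem_univ _)]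
  · refine Finset.sum_congr rfl fun a _ => ?_
    have : ∀ b, (if a ≠ b then pairTerm g x a b a b else 0) =
        if b = cycSucc a then g x (colChain a) else 0 := by
      intro b
      by_cases hab : a = b
      · subst hab
        rw [if_neg (by simp), if_neg (cycSucc_ne hn _).symm]
      · rw [if_pos hab, pairTerm]
        simp only [isRectPair_col hn x hab]
        by_cases h : b = cycSucc a
        · rw [if_pos h, if_pos h, pairChain_col hn x hab h, mul_assoc,
            Equiv.swap_mul_self, mul_one]
        · rw [if_neg h, if_neg h]
    rw [Finset.sum_congr rfl fun b _ => this b, Finset.sum_ite_eq', if_pos (Finset.mem_univ _)]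

end Sum
end Pairs

/-! ### The complex of positive domains -/

section Dom
variable {n : ℕ}

/-- A positive domain together with its initial and final generators. -/
@[ext]
structure Dom (n : ℕ) where
  x : State n
  y : State n
  D : TwoChain n
  isPos : IsPosDomain x y D

/-- The `ℤ/2`-vector space with basis the positive domains. -/
abbrev DomChains (n : ℕ) : Type := Dom n →₀ ZMod 2

open scoped Classical in
/-- The basis element of a positive domain `E` from `x` to `y`, and `0` if `E` is not one. -/
def domOrZero (x y : State n) (E : TwoChain n) : DomChains n :=
  if h : IsPosDomain x y E then Finsupp.single ⟨x, y, E, h⟩ 1 else 0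

theorem domOrZero_of_pos {x y : State n} {E : TwoChain n} (h : IsPosDomain x y E) :
    domOrZero x y E = Finsupp.single ⟨x, y, E, h⟩ 1 := dif_pos h

theorem domOrZero_of_not_pos {x y : State n} {E : TwoChain n} (h : ¬ IsPosDomain x y E) :
    domOrZero x y E = 0 := dif_neg h

theorem single_dom (s : Dom n) : Finsupp.single s (1 : ZMod 2) = domOrZero s.x s.y s.D :=
  (domOrZero_of_pos s.isPos).symm

theorem cornerCoeff_add (D E : TwoChain n) (i j : Fin n) :
    cornerCoeff (D + E) i j = cornerCoeff D i j + cornerCoeff E i j := by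
  simp only [cornerCoeff, alphaBoundary, Pi.add_apply]; ring

theorem cornerCoeff_sub (D E : TwoChain n) (i j : Fin n) :
    cornerCoeff (D - E) i j = cornerCoeff D i j - cornerCoeff E i j := by
  simp only [cornerCoeff, alphaBoundary, Pi.sub_apply]; ring

theorem IsGridDomain.add {x y z : State n} {D E : TwoChain n} (hD : IsGridDomain x y D)
    (hE : IsGridDomain y z E) : IsGridDomain x z (D + E) := by
  intro i j; rw [cornerCoeff_add, hD, hE]; ring

theorem IsGridDomain.sub_left {x y z : State n} {D E : TwoChain n} (hD : IsGridDomain x z D)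
    (hE : IsGridDomain x y E) : IsGridDomain y z (D - E) := by
  intro i j; rw [cornerCoeff_sub, hD, hE]; ring

theorem IsGridDomain.sub_right {x y z : State n} {D E : TwoChain n} (hD : IsGridDomain x z D)
    (hE : IsGridDomain y z E) : IsGridDomain x y (D - E) := by
  intro i j; rw [cornerCoeff_sub, hD, hE]; ring

theorem IsPosDomain.add {x y z : State n} {D E : TwoChain n} (hD : IsPosDomain x y D)
    (hE : IsPosDomain y z E) : IsPosDomain x z (D + E) :=
  ⟨hD.1.add hE.1, fun i j => add_nonneg (hD.2 i j) (hE.2 i j)⟩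

theorem IsRect.isPosDomain {x : State n} {a b : Fin n} (h : IsRect x a b) :
    IsPosDomain x (x * Equiv.swap a b) (rectChain x a b) :=
  ⟨isGridDomain_rectChain x h.1, fun k l => rectChain_nonneg x a b k l⟩

theorem swap_mul_self_right (y : State n) (a b : Fin n) :
    y * Equiv.swap a b * Equiv.swap a b = y := by
  rw [mul_assoc, Equiv.swap_mul_self, mul_one]

theorem IsRect.isPosDomain' {y : State n} {a b : Fin n} (h : IsRect (y * Equiv.swap a b) a b) :
    IsPosDomain (y * Equiv.swap a b) y (rectChain (y * Equiv.swap a b) a b) := by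
  have := h.isPosDomain
  rwa [swap_mul_self_right] at this

/-- A nonnegative periodic domain: a combination of annuli. -/
def IsPeriodic (A : TwoChain n) : Prop := (∀ i j, cornerCoeff A i j = 0) ∧ ∀ i j, 0 ≤ A i j

theorem IsPeriodic.isPosDomain {A : TwoChain n} (h : IsPeriodic A) (x : State n) :
    IsPosDomain x x A := ⟨fun i j => by rw [h.1, sub_self], h.2⟩

theorem isPeriodic_rowChain (j : Fin n) : IsPeriodic (rowChain j) :=
  ⟨fun i k => by simp [cornerCoeff, alphaBoundary, rowChain],
    fun i k => by rw [rowChain]; split_ifs <;> simp⟩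

theorem isPeriodic_colChain (j : Fin n) : IsPeriodic (colChain j) :=
  ⟨fun i k => by simp [cornerCoeff, alphaBoundary, colChain],
    fun i k => by rw [colChain]; split_ifs <;> simp⟩

theorem domLin_ext {M : Type*} [AddCommMonoid M] [Module (ZMod 2) M]
    {f g : DomChains n →ₗ[ZMod 2] M}
    (h : ∀ x y E, f (domOrZero x y E) = g (domOrZero x y E)) : f = g :=
  Finsupp.lhom_ext' fun s => LinearMap.ext_ring (by
    simpa only [LinearMap.comp_apply, Finsupp.lsingle_apply, single_dom] using h s.x s.y s.D)

open scoped Classical in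
/-- The sum over all decompositions `D = R * E` of `w(R) E`. -/
def leftMap (w : TwoChain n → ZMod 2) : DomChains n →ₗ[ZMod 2] DomChains n :=
  Finsupp.linearCombination _ fun s => ∑ a, ∑ b, if IsRect s.x a b then
    w (rectChain s.x a b) • domOrZero (s.x * Equiv.swap a b) s.y (s.D - rectChain s.x a b) else 0

open scoped Classical in
/-- The sum over all decompositions `D = E * R` of `E`. -/
def rightMap : DomChains n →ₗ[ZMod 2] DomChains n :=
  Finsupp.linearCombination _ fun s => ∑ a, ∑ b, if IsRect (s.y * Equiv.swap a b) a b then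
    domOrZero s.x (s.y * Equiv.swap a b) (s.D - rectChain (s.y * Equiv.swap a b) a b) else 0

/-- Taking out a 2-chain `A`. -/
def subMap (A : TwoChain n) : DomChains n →ₗ[ZMod 2] DomChains n :=
  Finsupp.linearCombination _ fun s => domOrZero s.x s.y (s.D - A)

theorem domOrZero_sub_eq_zero {x x' y y' : State n} {E R : TwoChain n}
    (h : ¬ IsPosDomain x y E) (hR : IsPosDomain x' y' (E - R) → IsPosDomain x y (E - R + R)) :
    domOrZero x' y' (E - R) = 0 :=
  domOrZero_of_not_pos fun h' => h (by simpa using hR h')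

open scoped Classical in
theorem leftMap_domOrZero (w : TwoChain n → ZMod 2) (x y : State n) (E : TwoChain n) :
    leftMap w (domOrZero x y E) = ∑ a, ∑ b, if IsRect x a b then
      w (rectChain x a b) • domOrZero (x * Equiv.swap a b) y (E - rectChain x a b) else 0 := by
  by_cases h : IsPosDomain x y E
  · rw [domOrZero_of_pos h, leftMap, Finsupp.linearCombination_single, one_smul]
  · rw [domOrZero_of_not_pos h, map_zero]
    refine (Finset.sum_eq_zero fun a _ => Finset.sum_eq_zero fun b _ => ?_).symm
    split_ifs with hR
    · rw [domOrZero_sub_eq_zero h fun h' => ?_, smul_zero]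
      rw [add_comm]; exact hR.isPosDomain.add h'
    · rfl

open scoped Classical in
theorem rightMap_domOrZero (x y : State n) (E : TwoChain n) :
    rightMap (domOrZero x y E) = ∑ a, ∑ b, if IsRect (y * Equiv.swap a b) a b then
      domOrZero x (y * Equiv.swap a b) (E - rectChain (y * Equiv.swap a b) a b) else 0 := by
  by_cases h : IsPosDomain x y E
  · rw [domOrZero_of_pos h, rightMap, Finsupp.linearCombination_single, one_smul]
  · rw [domOrZero_of_not_pos h, map_zero]
    refine (Finset.sum_eq_zero fun a _ => Finset.sum_eq_zero fun b _ => ?_).symm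
    split_ifs with hR
    · exact domOrZero_sub_eq_zero h fun h' => h'.add hR.isPosDomain'
    · rfl

theorem subMap_domOrZero {A : TwoChain n} (hA : IsPeriodic A) (x y : State n) (E : TwoChain n) :
    subMap A (domOrZero x y E) = domOrZero x y (E - A) := by
  by_cases h : IsPosDomain x y E
  · rw [domOrZero_of_pos h, subMap, Finsupp.linearCombination_single, one_smul]
  · rw [domOrZero_of_not_pos h, map_zero]
    exact (domOrZero_sub_eq_zero h fun h' => h'.add (hA.isPosDomain y)).symm

theorem subMap_leftMap_comm {A : TwoChain n} (hA : IsPeriodic A) (w : TwoChain n → ZMod 2) :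
    subMap A ∘ₗ leftMap w = leftMap w ∘ₗ subMap A := by
  classical
  refine domLin_ext fun x y E => ?_
  simp only [LinearMap.comp_apply, subMap_domOrZero hA, leftMap_domOrZero, map_sum]
  refine Finset.sum_congr rfl fun a _ => Finset.sum_congr rfl fun b _ => ?_
  split_ifs
  · rw [map_smul, subMap_domOrZero hA, sub_right_comm]
  · exact map_zero _

theorem subMap_rightMap_comm {A : TwoChain n} (hA : IsPeriodic A) :
    subMap A ∘ₗ rightMap = rightMap ∘ₗ subMap A := by
  classical
  refine domLin_ext fun x y E => ?_
  simp only [LinearMap.comp_apply, subMap_domOrZero hA, rightMap_domOrZero, map_sum]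
  refine Finset.sum_congr rfl fun a _ => Finset.sum_congr rfl fun b _ => ?_
  split_ifs
  · rw [subMap_domOrZero hA, sub_right_comm]
  · exact map_zero _

theorem sum_four_comm {M : Type*} [AddCommMonoid M] (F : Fin n → Fin n → Fin n → Fin n → M) :
    ∑ c, ∑ d, ∑ a, ∑ b, F a b c d = ∑ a, ∑ b, ∑ c, ∑ d, F a b c d :=
  calc ∑ c, ∑ d, ∑ a, ∑ b, F a b c d
      = ∑ c, ∑ a, ∑ b, ∑ d, F a b c d := Finset.sum_congr rfl fun c _ => by
        rw [Finset.sum_comm]; exact Finset.sum_congr rfl fun a _ => Finset.sum_comm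
    _ = ∑ a, ∑ b, ∑ c, ∑ d, F a b c d := by
        rw [Finset.sum_comm]; exact Finset.sum_congr rfl fun a _ => Finset.sum_comm

theorem leftMap_rightMap_comm (w : TwoChain n → ZMod 2) :
    leftMap w ∘ₗ rightMap = rightMap ∘ₗ leftMap w := by
  classical
  refine domLin_ext fun x y E => ?_
  simp only [LinearMap.comp_apply, rightMap_domOrZero, leftMap_domOrZero, map_sum]
  have h1 : ∀ c d, (leftMap w) (if IsRect (y * Equiv.swap c d) c d then
      domOrZero x (y * Equiv.swap c d) (E - rectChain (y * Equiv.swap c d) c d) else 0) =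
      ∑ a, ∑ b, if IsRect x a b ∧ IsRect (y * Equiv.swap c d) c d then w (rectChain x a b) •
        domOrZero (x * Equiv.swap a b) (y * Equiv.swap c d)
          (E - rectChain x a b - rectChain (y * Equiv.swap c d) c d) else 0 := by
    intro c d
    by_cases h : IsRect (y * Equiv.swap c d) c d
    · simp only [h, if_true, and_true, leftMap_domOrZero, sub_right_comm E]
    · simp [h]
  have h2 : ∀ a b, rightMap (if IsRect x a b then w (rectChain x a b) •
      domOrZero (x * Equiv.swap a b) y (E - rectChain x a b) else 0) =
      ∑ c, ∑ d, if IsRect x a b ∧ IsRect (y * Equiv.swap c d) c d then w (rectChain x a b) •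
        domOrZero (x * Equiv.swap a b) (y * Equiv.swap c d)
          (E - rectChain x a b - rectChain (y * Equiv.swap c d) c d) else 0 := by
    intro a b
    by_cases h : IsRect x a b
    · simp only [h, if_true, true_and, map_smul, rightMap_domOrZero, Finset.smul_sum, smul_ite,
        smul_zero]
    · simp [h]
  simp only [h1, h2]
  exact sum_four_comm _

open scoped Classical in
theorem leftMap_leftMap (w v : TwoChain n → ZMod 2) (x y : State n) (E : TwoChain n) :
    leftMap w (leftMap v (domOrZero x y E)) = ∑ a, ∑ b, ∑ c, ∑ d, if IsRectPair x a b c d then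
      (v (rectChain x a b) * w (rectChain (x * Equiv.swap a b) c d)) •
        domOrZero (x * Equiv.swap a b * Equiv.swap c d) y (E - pairChain x a b c d) else 0 := by
  simp only [leftMap_domOrZero, map_sum]
  refine Finset.sum_congr rfl fun a _ => Finset.sum_congr rfl fun b _ => ?_
  by_cases h : IsRect x a b
  · simp only [h, if_true, map_smul, leftMap_domOrZero, Finset.smul_sum, IsRectPair, true_and,
      smul_ite, smul_zero, smul_smul, pairChain, sub_add_eq_sub_sub]
  · simp [h, IsRectPair]

/-- The sum of the operators that take out one annulus. -/
def annuliMap : DomChains n →ₗ[ZMod 2] DomChains n :=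
  ∑ j : Fin n, (subMap (rowChain j) + subMap (colChain j))

theorem annuliMap_domOrZero (x y : State n) (E : TwoChain n) : annuliMap (domOrZero x y E) =
    ∑ j, (domOrZero x y (E - rowChain j) + domOrZero x y (E - colChain j)) := by
  simp only [annuliMap, LinearMap.sum_apply, LinearMap.add_apply,
    subMap_domOrZero (isPeriodic_rowChain _), subMap_domOrZero (isPeriodic_colChain _)]

theorem leftMap_one_sq (hn : 2 ≤ n) :
    leftMap (fun _ : TwoChain n => 1) ∘ₗ leftMap (fun _ => 1) = annuliMap := by
  classical
  refine domLin_ext fun x y E => ?_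
  rw [annuliMap_domOrZero, LinearMap.comp_apply, leftMap_leftMap,
    ← sum_pairTerm (fun z P => domOrZero z y (E - P)) hn x]
  simp only [mul_one, one_smul, pairTerm]

/-- Counting rectangles with an additive weight `w` is a null-homotopy, for the differential that
removes rectangles at the start, of the operator that takes out the annuli with weight `w`. -/
theorem leftMap_weight (hn : 2 ≤ n) (w : TwoChain n → ZMod 2)
    (hw : ∀ P Q, w (P + Q) = w P + w Q) :
    leftMap w ∘ₗ leftMap (fun _ => 1) + leftMap (fun _ => 1) ∘ₗ leftMap w =
      ∑ j : Fin n, (w (rowChain j) • subMap (rowChain j) + w (colChain j) • subMap (colChain j)) := by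
  classical
  refine domLin_ext fun x y E => ?_
  have h := sum_pairTerm (fun z P => w P • domOrZero z y (E - P)) hn x
  simp only [LinearMap.add_apply, LinearMap.comp_apply, leftMap_leftMap, LinearMap.sum_apply,
    LinearMap.smul_apply, subMap_domOrZero (isPeriodic_rowChain _),
    subMap_domOrZero (isPeriodic_colChain _), ← h, ← Finset.sum_add_distrib]
  refine Finset.sum_congr rfl fun a _ => Finset.sum_congr rfl fun b _ =>
    Finset.sum_congr rfl fun c _ => Finset.sum_congr rfl fun d _ => ?_
  rw [pairTerm]
  split_ifs
  · rw [← add_smul, mul_one, one_mul, pairChain, hw, add_comm]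
  · exact add_zero _

/-- The sum over two rectangles at the end is obtained from the sum over two rectangles that start at a
given generator, by summing over all generators and keeping the pairs that end at `y`. -/
theorem rightMap_sq (hn : 2 ≤ n) : (rightMap : DomChains n →ₗ[ZMod 2] _) ∘ₗ rightMap = annuliMap := by
  classical
  refine domLin_ext fun x y E => ?_
  rw [annuliMap_domOrZero, LinearMap.comp_apply]
  let g : State n → State n → TwoChain n → DomChains n :=
    fun z u P => if u = y then domOrZero x z (E - P) else 0
  have h : ∑ z, ∑ a, ∑ b, ∑ c, ∑ d, pairTerm (g z) z a b c d =
      ∑ z, ∑ j, (g z z (rowChain j) + g z z (colChain j)) :=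
    Finset.sum_congr rfl fun z _ => sum_pairTerm (g z) hn z
  have h2 : ∑ z, ∑ j, (g z z (rowChain j) + g z z (colChain j)) =
      ∑ j, (domOrZero x y (E - rowChain j) + domOrZero x y (E - colChain j)) := by
    rw [Finset.sum_eq_single y]
    · simp [g]
    · intro z _ hz; simp [g, hz]
    · simp
  rw [← h2, ← h]
  have h3 : ∀ a b c d, ∑ z, pairTerm (g z) z a b c d =
      if IsRectPair (y * Equiv.swap c d * Equiv.swap a b) a b c d then
        domOrZero x (y * Equiv.swap c d * Equiv.swap a b)
          (E - pairChain (y * Equiv.swap c d * Equiv.swap a b) a b c d) else 0 := by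
    intro a b c d
    rw [Finset.sum_eq_single (y * Equiv.swap c d * Equiv.swap a b)]
    · simp only [pairTerm, g, swap_mul_self_right, if_true]
    · intro z _ hz
      rw [pairTerm]
      split_ifs
      · simp only [g]
        rw [if_neg]
        rintro rfl
        exact hz (by simp only [swap_mul_self_right])
      · rfl
    · simp
  have ex : ∀ F : State n → Fin n → Fin n → Fin n → Fin n → DomChains n,
      ∑ z, ∑ a, ∑ b, ∑ c, ∑ d, F z a b c d = ∑ c, ∑ d, ∑ a, ∑ b, ∑ z, F z a b c d := by
    intro F
    rw [sum_four_comm fun a b c d => ∑ z, F z a b c d, Finset.sum_comm]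
    refine Finset.sum_congr rfl fun a _ => ?_
    rw [Finset.sum_comm]
    refine Finset.sum_congr rfl fun b _ => ?_
    rw [Finset.sum_comm]
    exact Finset.sum_congr rfl fun c _ => Finset.sum_comm
  rw [ex]
  simp only [h3, rightMap_domOrZero, map_sum]
  refine Finset.sum_congr rfl fun c _ => Finset.sum_congr rfl fun d _ => ?_
  by_cases hR : IsRect (y * Equiv.swap c d) c d
  · simp only [hR, if_true, rightMap_domOrZero]
    refine Finset.sum_congr rfl fun a _ => Finset.sum_congr rfl fun b _ => ?_
    simp only [IsRectPair, swap_mul_self_right, hR, and_true, pairChain, sub_add_eq_sub_sub,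
      sub_right_comm E]
  · simp [hR, IsRectPair]

/-- The differential of the complex of positive domains: the sum of all positive domains obtained by
removing a rectangle at the start or at the end. -/
def domDiff : DomChains n →ₗ[ZMod 2] DomChains n := leftMap (fun _ => 1) + rightMap

theorem linearMap_add_self {V W : Type*} [AddCommGroup V] [AddCommGroup W] [Module (ZMod 2) V]
    [Module (ZMod 2) W] (f : V →ₗ[ZMod 2] W) : f + f = 0 :=
  LinearMap.ext fun v => ZModModule.add_self (f v)

theorem domDiff_sq (hn : 2 ≤ n) : (domDiff : DomChains n →ₗ[ZMod 2] _) ∘ₗ domDiff = 0 := by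
  have h1 := leftMap_one_sq hn
  have h2 := rightMap_sq hn
  have h3 := leftMap_rightMap_comm (n := n) fun _ => 1
  rw [domDiff, LinearMap.add_comp, LinearMap.comp_add, LinearMap.comp_add, h1, h2, ← h3]
  rw [add_add_add_comm, add_comm annuliMap, linearMap_add_self]

theorem subMap_domDiff_comm {A : TwoChain n} (hA : IsPeriodic A) :
    subMap A ∘ₗ domDiff = domDiff ∘ₗ subMap A := by
  rw [domDiff, LinearMap.comp_add, LinearMap.add_comp, subMap_leftMap_comm hA,
    subMap_rightMap_comm hA]

/-- Counting the rectangles at the start with their coefficient at a marking. -/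
def capMap (i j : Fin n) : DomChains n →ₗ[ZMod 2] DomChains n :=
  leftMap fun P => ((P i j : ℤ) : ZMod 2)

/-- The null-homotopy of the operator that takes out the two annuli through a marking. -/
theorem domDiff_capMap (hn : 2 ≤ n) (i j : Fin n) :
    domDiff ∘ₗ capMap i j + capMap i j ∘ₗ domDiff = subMap (rowChain j) + subMap (colChain i) := by
  have h1 := leftMap_weight hn (fun P => ((P i j : ℤ) : ZMod 2)) fun P Q => by simp
  have h3 := leftMap_rightMap_comm (n := n) fun P => ((P i j : ℤ) : ZMod 2)
  have h4 : ∑ k : Fin n, (((rowChain k i j : ℤ) : ZMod 2) • subMap (rowChain k) +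
      ((colChain k i j : ℤ) : ZMod 2) • subMap (colChain k)) =
      subMap (rowChain j) + subMap (colChain i) := by
    rw [Finset.sum_add_distrib]
    congr 1 <;> simp [rowChain, colChain]
  rw [← h4, ← h1, domDiff, LinearMap.add_comp, LinearMap.comp_add, capMap, h3, add_add_add_comm,
    linearMap_add_self, add_zero, add_comm]

end Dom

/-! ### The Maslov index -/

section Maslov
variable {n : ℕ}

theorem sum_pointMeasure (x : State n) (D : TwoChain n) :
    ∑ i, pointMeasure D i (x i) = ∑ i, ∑ j, (pointCoeff x i j : ℚ) * pointMeasure D i j := by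
  refine Finset.sum_congr rfl fun i _ => ?_
  simp [pointCoeff]

theorem pointMeasure_add (D E : TwoChain n) (i j : Fin n) :
    pointMeasure (D + E) i j = pointMeasure D i j + pointMeasure E i j := by
  simp only [pointMeasure, Pi.add_apply]; push_cast; ring

/-- The pairing of the corners of `D` with the point measures of `E` is symmetric: the difference of the
two sides telescopes around the torus. -/
theorem sum_corner_pointMeasure (D E : TwoChain n) :
    ∑ i, ∑ j, (cornerCoeff D i j : ℚ) * pointMeasure E i j =
      ∑ i, ∑ j, (cornerCoeff E i j : ℚ) * pointMeasure D i j := by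
  let h : Fin n → Fin n → ℚ := fun i j => D (cycPred i) j * E i j - D i j * E (cycPred i) j
  let v : Fin n → Fin n → ℚ := fun i j => D i (cycPred j) * E i j - D i j * E i (cycPred j)
  have key : ∀ i j, (cornerCoeff D i j : ℚ) * pointMeasure E i j -
      (cornerCoeff E i j : ℚ) * pointMeasure D i j =
      (h i j - h i (cycPred j)) / 2 + (v i j - v (cycPred i) j) / 2 := by
    intro i j
    simp only [cornerCoeff, alphaBoundary, pointMeasure, h, v]
    push_cast
    ring
  rw [← sub_eq_zero, ← Finset.sum_sub_distrib]
  simp only [← Finset.sum_sub_distrib, key, Finset.sum_add_distrib, ← Finset.sum_div]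
  have h1 : ∑ i, ∑ j, (h i j - h i (cycPred j)) = 0 :=
    Finset.sum_eq_zero fun i _ => by
      rw [Finset.sum_sub_distrib, sum_cycPred fun j => h i j, sub_self]
  have h2 : ∑ i, ∑ j, (v i j - v (cycPred i) j) = 0 := by
    rw [Finset.sum_comm]
    refine Finset.sum_eq_zero fun j _ => ?_
    rw [Finset.sum_sub_distrib, sum_cycPred fun i => v i j, sub_self]
  rw [h1, h2]; simp

theorem IsGridDomain.sum_corner {x y : State n} {D : TwoChain n} (hD : IsGridDomain x y D)
    (E : TwoChain n) : ∑ i, ∑ j, (cornerCoeff D i j : ℚ) * pointMeasure E i j =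
      ∑ i, pointMeasure E i (y i) - ∑ i, pointMeasure E i (x i) := by
  rw [sum_pointMeasure, sum_pointMeasure, ← Finset.sum_sub_distrib]
  refine Finset.sum_congr rfl fun i _ => ?_
  rw [← Finset.sum_sub_distrib]
  refine Finset.sum_congr rfl fun j _ => ?_
  rw [hD]; push_cast; ring

/-- The Maslov index is additive under composition. -/
theorem maslov_add {x y z : State n} {D E : TwoChain n} (hD : IsGridDomain x y D)
    (hE : IsGridDomain y z E) : maslov x z (D + E) = maslov x y D + maslov y z E := by
  have h := sum_corner_pointMeasure D E
  rw [hD.sum_corner, hE.sum_corner] at h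
  simp only [maslov, pointMeasure_add, Finset.sum_add_distrib]
  linarith

theorem pointMeasure_rectChain (x : State n) (a b i j : Fin n) :
    pointMeasure (rectChain x a b) i j = (((arcInd a b i + arcInd a b (cycPred i)) *
      (arcInd (x a) (x b) j + arcInd (x a) (x b) (cycPred j)) : ℤ) : ℚ) / 4 := by
  simp only [pointMeasure, rectChain_eq]
  congr 2
  ring

theorem arcInd_add_cycPred {a b : Fin n} (h : a ≠ b) (k : Fin n) :
    arcInd a b k + arcInd a b (cycPred k) =
      if k = a ∨ k = b then 1 else 2 * arcInd a b k := by
  have h1 := arcInd_cycPred a b k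
  by_cases hka : k = a
  · subst hka
    have : arcInd k b k = 1 := if_pos (inArc_left h)
    simp [h.symm] at h1 ⊢
    omega
  · by_cases hkb : k = b
    · subst hkb
      have : arcInd a k k = 0 := if_neg (not_inArc_right a k)
      simp [h] at h1 ⊢
      omega
    · simp only [hka, hkb, Ne.symm hka, Ne.symm hkb, if_false, or_self] at h1 ⊢
      omega

/-- The points of `x` inside a rectangle, which is not required to be empty, contribute two each to its
Maslov index. -/
theorem maslov_rectChain (x : State n) {a b : Fin n} (h : a ≠ b) :
    maslov x (x * Equiv.swap a b) (rectChain x a b) =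
      1 + 2 * ∑ k, if k = a ∨ k = b then 0 else (rectChain x a b k (x k) : ℚ) := by
  have hx := x.injective.ne h
  have key : ∀ k, pointMeasure (rectChain x a b) k (x k) +
      pointMeasure (rectChain x a b) k ((x * Equiv.swap a b) k) =
      (if k = a then 1 / 2 else 0) + (if k = b then 1 / 2 else 0) +
        2 * if k = a ∨ k = b then 0 else (rectChain x a b k (x k) : ℚ) := by
    intro k
    rw [pointMeasure_rectChain, pointMeasure_rectChain, arcInd_add_cycPred h, arcInd_add_cycPred hx,
      arcInd_add_cycPred hx]
    by_cases hka : k = a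
    · subst hka
      rw [swap_val_left]
      simp only [h, true_or, or_true, if_true, if_false]; norm_num
    · by_cases hkb : k = b
      · subst hkb
        rw [swap_val_right]
        simp only [h.symm, true_or, or_true, if_true, if_false]; norm_num
      · rw [swap_val_of_ne x hka hkb]
        simp only [hka, hkb, x.injective.eq_iff, or_self, if_false, rectChain_eq]
        push_cast; ring
  rw [maslov, ← Finset.sum_add_distrib, Finset.sum_congr rfl fun k _ => key k,
    Finset.sum_add_distrib, Finset.sum_add_distrib, ← Finset.mul_sum]
  simp
  norm_num

theorem IsRect.maslov_eq {x : State n} {a b : Fin n} (h : IsRect x a b) :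
    maslov x (x * Equiv.swap a b) (rectChain x a b) = 1 := by
  rw [maslov_rectChain x h.1, Finset.sum_eq_zero, mul_zero, add_zero]
  intro k _
  by_cases hk : k = a ∨ k = b
  · rw [if_pos hk]
  · rw [not_or] at hk
    rw [if_neg (not_or.2 hk), (isRect_iff.1 h).2 k hk.1 hk.2, Int.cast_zero]

theorem maslov_rowChain (x : State n) (j : Fin n) : maslov x x (rowChain j) = 2 := by
  have key : ∀ i k, pointMeasure (rowChain j) i k =
      (if k = j then 1 / 2 else 0) + if cycPred k = j then 1 / 2 else 0 := by
    intro i k; simp only [pointMeasure, rowChain]; split_ifs <;> norm_num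
  have h1 : ∑ i, pointMeasure (rowChain j) i (x i) = 1 := by
    simp only [key]
    rw [Equiv.sum_comp x fun k => (if k = j then (1 / 2 : ℚ) else 0) + if cycPred k = j then 1 / 2 else 0,
      Finset.sum_add_distrib, sum_cycPred fun i : Fin n => if i = j then (1 / 2 : ℚ) else 0]
    simp; norm_num
  rw [maslov, h1]; norm_num

theorem maslov_colChain (x : State n) (j : Fin n) : maslov x x (colChain j) = 2 := by
  have key : ∀ i k, pointMeasure (colChain j) i k =
      (if i = j then 1 / 2 else 0) + if cycPred i = j then 1 / 2 else 0 := by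
    intro i k; simp only [pointMeasure, colChain]; split_ifs <;> norm_num
  have h1 : ∑ i, pointMeasure (colChain j) i (x i) = 1 := by
    simp only [key, Finset.sum_add_distrib, sum_cycPred fun i : Fin n => if i = j then (1 / 2 : ℚ) else 0]
    simp; norm_num
  rw [maslov, h1]; norm_num

/-- The Maslov index is an integer: it is for a periodic domain, where opposite corners of a point
have the same sum of coefficients, and it changes by an odd integer when a rectangle is composed. -/
theorem exists_int_maslov (x : State n) (σ : State n) :
    ∀ D, IsGridDomain x (x * σ) D → ∃ k : ℤ, maslov x (x * σ) D = k := by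
  induction σ using Equiv.Perm.swap_induction_on' with
  | one =>
    intro D hD
    rw [mul_one] at hD ⊢
    refine ⟨∑ i, (D i (x i) + D (cycPred i) (cycPred (x i))), ?_⟩
    rw [maslov, ← Finset.sum_add_distrib]
    push_cast
    refine Finset.sum_congr rfl fun i _ => ?_
    have h := hD i (x i)
    simp only [cornerCoeff, alphaBoundary, sub_self] at h
    have h2 : (D i (x i) + D (cycPred i) (cycPred (x i)) : ℚ) =
      D (cycPred i) (x i) + D i (cycPred (x i)) := by
      exact_mod_cast (by linarith : D i (x i) + D (cycPred i) (cycPred (x i)) =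
        D (cycPred i) (x i) + D i (cycPred (x i)))
    rw [pointMeasure]; push_cast; linarith
  | mul_swap f a b hab ih =>
    intro D hD
    have hR := isGridDomain_rectChain (x * (f * Equiv.swap a b)) hab
    have hm := maslov_rectChain (x * (f * Equiv.swap a b)) hab
    rw [mul_assoc, swap_mul_self_right] at hR hm
    obtain ⟨k, hk⟩ := ih _ (hD.add hR)
    rw [maslov_add hD hR, hm] at hk
    refine ⟨k - (1 + 2 * ∑ k, if k = a ∨ k = b then 0 else
      rectChain (x * (f * Equiv.swap a b)) a b k ((x * (f * Equiv.swap a b)) k)), ?_⟩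
    rw [eq_sub_of_add_eq hk]
    push_cast
    rfl

theorem maslov_nonneg {x y : State n} {D : TwoChain n} (h : ∀ i j, 0 ≤ D i j) :
    0 ≤ maslov x y D := by
  have : ∀ i j, 0 ≤ pointMeasure D i j := by
    intro i j
    refine div_nonneg (Int.cast_nonneg ?_) (by norm_num)
    have h1 := h i j
    have h2 := h (cycPred i) j
    have h3 := h i (cycPred j)
    have h4 := h (cycPred i) (cycPred j)
    omega
  exact add_nonneg (Finset.sum_nonneg fun i _ => this _ _) (Finset.sum_nonneg fun i _ => this _ _)

theorem exists_nat_maslov {x y : State n} {D : TwoChain n} (h : IsPosDomain x y D) :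
    ∃ k : ℕ, maslov x y D = k := by
  obtain ⟨k, hk⟩ := exists_int_maslov x (x⁻¹ * y) D (by rw [mul_inv_cancel_left]; exact h.1)
  rw [mul_inv_cancel_left] at hk
  have h0 : (0 : ℚ) ≤ maslov x y D := maslov_nonneg h.2
  rw [hk] at h0
  obtain ⟨m, rfl⟩ := Int.eq_ofNat_of_zero_le (Int.cast_nonneg_iff.1 h0)
  exact ⟨m, by rw [hk]; simp⟩

/-! ### Homogeneous operators -/

/-- The Maslov index of a positive domain. -/
def Dom.deg (s : Dom n) : ℚ := maslov s.x s.y s.D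

/-- The chains of positive domains of Maslov index `r`. -/
def domGr (n : ℕ) (r : ℚ) : Submodule (ZMod 2) (DomChains n) :=
  Finsupp.supported (ZMod 2) (ZMod 2) {s : Dom n | s.deg = r}

theorem map_mem_of_supported {S V : Type*} [AddCommMonoid V] [Module (ZMod 2) V]
    (f : (S →₀ ZMod 2) →ₗ[ZMod 2] V) (P : Set S) (W : Submodule (ZMod 2) V)
    (h : ∀ s ∈ P, f (Finsupp.single s 1) ∈ W) {c : S →₀ ZMod 2}
    (hc : c ∈ Finsupp.supported (ZMod 2) (ZMod 2) P) : f c ∈ W := by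
  rw [Finsupp.supported_eq_span_single] at hc
  induction hc using Submodule.span_induction with
  | mem c hc => obtain ⟨s, hs, rfl⟩ := hc; exact h s hs
  | zero => rw [map_zero]; exact W.zero_mem
  | add _ _ _ _ h1 h2 => rw [map_add]; exact W.add_mem h1 h2
  | smul a _ _ h1 => rw [map_smul]; exact W.smul_mem a h1

theorem domOrZero_mem {x y : State n} {E : TwoChain n} {P : Set (Dom n)}
    (h : ∀ h : IsPosDomain x y E, (⟨x, y, E, h⟩ : Dom n) ∈ P) :
    domOrZero x y E ∈ Finsupp.supported (ZMod 2) (ZMod 2) P := by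
  by_cases hE : IsPosDomain x y E
  · rw [domOrZero_of_pos hE]; exact Finsupp.single_mem_supported _ _ (h hE)
  · rw [domOrZero_of_not_pos hE]; exact Submodule.zero_mem _

theorem maslov_sub_left {x y : State n} {D : TwoChain n} {a b : Fin n} (hD : IsGridDomain x y D)
    (h : IsRect x a b) :
    maslov (x * Equiv.swap a b) y (D - rectChain x a b) = maslov x y D - 1 := by
  have h1 := maslov_add h.isPosDomain.1 (hD.sub_left h.isPosDomain.1)
  rw [add_sub_cancel, h.maslov_eq] at h1
  linarith

theorem maslov_sub_right {x y : State n} {D : TwoChain n} {a b : Fin n} (hD : IsGridDomain x y D)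
    (h : IsRect (y * Equiv.swap a b) a b) :
    maslov x (y * Equiv.swap a b) (D - rectChain (y * Equiv.swap a b) a b) = maslov x y D - 1 := by
  have h1 := maslov_add (hD.sub_right h.isPosDomain'.1) h.isPosDomain'.1
  have h2 := h.maslov_eq
  rw [swap_mul_self_right] at h2
  rw [sub_add_cancel, h2] at h1
  linarith

theorem leftMap_mem (w : TwoChain n → ZMod 2) {r : ℚ} {c : DomChains n} (hc : c ∈ domGr n r) :
    leftMap w c ∈ domGr n (r - 1) := by
  classical
  refine map_mem_of_supported _ _ _ (fun s hs => ?_) hc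
  rw [single_dom, leftMap_domOrZero]
  refine Submodule.sum_mem _ fun a _ => Submodule.sum_mem _ fun b _ => ?_
  split_ifs with h
  · refine Submodule.smul_mem _ _ (domOrZero_mem fun _ => ?_)
    change maslov _ _ _ = _
    rw [maslov_sub_left s.isPos.1 h]
    exact congrArg (· - 1) hs
  · exact Submodule.zero_mem _

theorem rightMap_mem {r : ℚ} {c : DomChains n} (hc : c ∈ domGr n r) :
    rightMap c ∈ domGr n (r - 1) := by
  classical
  refine map_mem_of_supported _ _ _ (fun s hs => ?_) hc
  rw [single_dom, rightMap_domOrZero]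
  refine Submodule.sum_mem _ fun a _ => Submodule.sum_mem _ fun b _ => ?_
  split_ifs with h
  · refine domOrZero_mem fun _ => ?_
    change maslov _ _ _ = _
    rw [maslov_sub_right s.isPos.1 h]
    exact congrArg (· - 1) hs
  · exact Submodule.zero_mem _

theorem domDiff_mem {r : ℚ} {c : DomChains n} (hc : c ∈ domGr n r) :
    domDiff c ∈ domGr n (r - 1) :=
  Submodule.add_mem _ (leftMap_mem _ hc) (rightMap_mem hc)

theorem subMap_mem {A : TwoChain n} (hA : IsPeriodic A) (hm : ∀ x, maslov x x A = 2) {r : ℚ}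
    {c : DomChains n} (hc : c ∈ domGr n r) : subMap A c ∈ domGr n (r - 2) := by
  refine map_mem_of_supported _ _ _ (fun s hs => ?_) hc
  rw [single_dom, subMap_domOrZero hA]
  refine domOrZero_mem fun _ => ?_
  change maslov _ _ _ = _
  have h1 := maslov_add (hA.isPosDomain s.x).1 (s.isPos.1.sub_left (hA.isPosDomain s.x).1)
  rw [add_sub_cancel, hm, show maslov s.x s.y s.D = r from hs] at h1
  linarith

end Maslov

/-! ### The matching that adds and removes strips of width one -/

section Columns
variable {n : ℕ}

/-- `t` arises from `s` by removing a rectangle at the start. -/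
def LeftTerm (s t : Dom n) : Prop :=
  ∃ a b, IsRect s.x a b ∧ t.x = s.x * Equiv.swap a b ∧ t.y = s.y ∧ s.D = t.D + rectChain s.x a b

/-- `t` arises from `s` by removing a rectangle at the end. -/
def RightTerm (s t : Dom n) : Prop :=
  ∃ a b, IsRect t.y a b ∧ s.y = t.y * Equiv.swap a b ∧ t.x = s.x ∧ s.D = t.D + rectChain t.y a b

open scoped Classical in
theorem domOrZero_apply (x y : State n) (E : TwoChain n) (t : Dom n) :
    domOrZero x y E t = if x = t.x ∧ y = t.y ∧ E = t.D then 1 else 0 := by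
  by_cases h : IsPosDomain x y E
  · rw [domOrZero_of_pos h, Finsupp.single_apply]
    exact if_congr (by rw [Dom.ext_iff]) rfl rfl
  · rw [domOrZero_of_not_pos h, if_neg]
    · rfl
    · rintro ⟨rfl, rfl, rfl⟩; exact h t.isPos

theorem leftTerm_or_rightTerm {s t : Dom n} (h : domDiff (Finsupp.single s 1) t ≠ 0) :
    LeftTerm s t ∨ RightTerm s t := by
  classical
  rw [single_dom, domDiff, LinearMap.add_apply, leftMap_domOrZero, rightMap_domOrZero,
    Finsupp.add_apply] at h
  simp only [Finsupp.finsetSum_apply, one_smul] at h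
  by_cases hl : ∑ a, ∑ b, (if IsRect s.x a b then
      domOrZero (s.x * Equiv.swap a b) s.y (s.D - rectChain s.x a b) else 0) t = 0
  · rw [hl, zero_add] at h
    obtain ⟨a, -, h⟩ := Finset.exists_ne_zero_of_sum_ne_zero h
    obtain ⟨b, -, h⟩ := Finset.exists_ne_zero_of_sum_ne_zero h
    by_cases hR : IsRect (s.y * Equiv.swap a b) a b
    · rw [if_pos hR, domOrZero_apply] at h
      obtain ⟨h1, h2, h3⟩ : s.x = t.x ∧ s.y * Equiv.swap a b = t.y ∧
          s.D - rectChain (s.y * Equiv.swap a b) a b = t.D := by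
        by_contra h'; exact h (if_neg h')
      refine Or.inr ⟨a, b, h2 ▸ hR, ?_, h1.symm, ?_⟩
      · rw [← h2, swap_mul_self_right]
      · rw [← h2, ← h3, sub_add_cancel]
    · rw [if_neg hR] at h; exact absurd rfl h
  · obtain ⟨a, -, h⟩ := Finset.exists_ne_zero_of_sum_ne_zero hl
    obtain ⟨b, -, h⟩ := Finset.exists_ne_zero_of_sum_ne_zero h
    by_cases hR : IsRect s.x a b
    · rw [if_pos hR, domOrZero_apply] at h
      obtain ⟨h1, h2, h3⟩ : s.x * Equiv.swap a b = t.x ∧ s.y = t.y ∧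
          s.D - rectChain s.x a b = t.D := by
        by_contra h'; exact h (if_neg h')
      exact Or.inl ⟨a, b, hR, h1.symm, h2.symm, by rw [← h3, sub_add_cancel]⟩
    · rw [if_neg hR] at h; exact absurd rfl h

theorem LeftTerm.le {s t : Dom n} (h : LeftTerm s t) (i j : Fin n) : t.D i j ≤ s.D i j := by
  obtain ⟨a, b, -, -, -, h⟩ := h
  rw [h]; exact le_add_of_nonneg_right (rectChain_nonneg _ _ _ _ _)

theorem RightTerm.le {s t : Dom n} (h : RightTerm s t) (i j : Fin n) : t.D i j ≤ s.D i j := by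
  obtain ⟨a, b, -, -, -, h⟩ := h
  rw [h]; exact le_add_of_nonneg_right (rectChain_nonneg _ _ _ _ _)

/-- The jump of a domain across a vertical circle, in terms of the jump in the last row `r`. -/
theorem IsGridDomain.column_step {x y : State n} {D : TwoChain n} (hD : IsGridDomain x y D)
    {r : Fin n} (hr : (r : ℕ) + 1 = n) (i j : Fin n) :
    D i j - D (cycPred i) j = D i r - D (cycPred i) r + (if (x i : ℕ) ≤ j then 1 else 0) -
      if (y i : ℕ) ≤ j then 1 else 0 := by
  obtain ⟨m, hm⟩ : ∃ m, (j : ℕ) = m := ⟨_, rfl⟩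
  induction m generalizing j with
  | zero =>
    have h := hD i j
    have hp : cycPred j = r := by rw [Fin.ext_iff, cycPred_val, if_pos hm]; omega
    simp only [cornerCoeff, alphaBoundary, pointCoeff, hp, Fin.ext_iff, hm] at h ⊢
    split_ifs at * <;> omega
  | succ m ih =>
    have h := hD i j
    have hp : (cycPred j : ℕ) = m := by rw [cycPred_val, if_neg (by omega)]; omega
    have h2 := ih (cycPred j) hp
    simp only [cornerCoeff, alphaBoundary, pointCoeff, Fin.ext_iff, hm, hp] at h h2 ⊢
    split_ifs at * <;> omega

theorem isRect_cycSucc (hn : 2 ≤ n) (y : State n) (i : Fin n) : IsRect y i (cycSucc i) :=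
  ⟨(cycSucc_ne hn i).symm, fun k hk hk' h =>
    (eq_cycSucc_iff hn (cycSucc_ne hn i).symm).1 rfl k hk hk' h.1⟩

/-- The strip of width one in column `i` that starts at `y`. -/
theorem rectChain_cycSucc (hn : 2 ≤ n) {y : State n} {i : Fin n}
    (h : (y i : ℕ) < y (cycSucc i)) (k l : Fin n) : rectChain y i (cycSucc i) k l =
      if k = i ∧ (y i : ℕ) ≤ l ∧ (l : ℕ) < y (cycSucc i) then 1 else 0 := by
  rw [rectChain_eq, arcInd_cycSucc hn, arcInd, inArc_iff]
  split_ifs <;> first | rfl | omega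

theorem lt_of_arcInd_eq_zero {a b r : Fin n} (hr : (r : ℕ) + 1 = n) (hab : a ≠ b)
    (h : arcInd a b r = 0) : (a : ℕ) < b := by
  rw [arcInd_eq_zero, inArc_iff] at h
  rw [Ne, Fin.ext_iff] at hab
  omega

theorem lt_of_rectChain_row {z : State n} {r c d : Fin n} (hr : (r : ℕ) + 1 = n) (hcd : c ≠ d)
    (h : ∀ k, rectChain z c d k r = 0) : (z c : ℕ) < z d := by
  have := h c
  rw [rectChain_eq, arcInd, if_pos (inArc_left hcd), one_mul] at this
  exact lt_of_arcInd_eq_zero hr (z.injective.ne hcd) this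

theorem lt_of_rectChain_col {z : State n} {r c d : Fin n} (hr : (r : ℕ) + 1 = n) (hcd : c ≠ d)
    (h : ∀ l, rectChain z c d r l = 0) : (c : ℕ) < d := by
  have := h (z c)
  have h1 : arcInd (z c) (z d) (z c) = 1 := if_pos (inArc_left (z.injective.ne hcd))
  rw [rectChain_eq, h1, mul_one] at this
  exact lt_of_arcInd_eq_zero hr hcd this

/-- The lifting property: the only rectangle, off the last row, that ends at a generator with a descent
at `i` and starts at a generator with an ascent at `i` is the strip of width one. -/
theorem eq_cycSucc_of_isRect (hn : 2 ≤ n) {z : State n} {i c d : Fin n} (h : IsRect z c d)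
    (hcd : (z c : ℕ) < z d) (hlow : (z i : ℕ) < z (cycSucc i))
    (hhigh : ((z * Equiv.swap c d) (cycSucc i) : ℕ) < (z * Equiv.swap c d) i) :
    c = i ∧ d = cycSucc i := by
  have hne := cycSucc_ne hn i
  obtain ⟨hcd', hR⟩ := h
  by_cases h1 : i = c
  · subst h1
    by_cases h2 : cycSucc i = d
    · exact ⟨rfl, h2.symm⟩
    rw [swap_val_left, swap_val_of_ne z hne h2] at hhigh
    refine absurd ⟨?_, ?_⟩ (hR _ hne h2)
    · have := (eq_cycSucc_iff hn hcd').not.1 (Ne.symm h2)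
      push Not at this
      have h3 := i.isLt
      have h4 := d.isLt
      rw [Fin.ext_iff, cycSucc_val] at h2
      rw [Ne, Fin.ext_iff] at hcd'
      rw [inArc_iff, cycSucc_val]
      split_ifs at * <;> omega
    · rw [inArc_iff]; omega
  by_cases h2 : i = d
  · subst h2
    rw [swap_val_right] at hhigh
    by_cases h3 : cycSucc i = c
    · rw [h3, swap_val_left] at hhigh; omega
    · rw [swap_val_of_ne z h3 hne] at hhigh; omega
  rw [swap_val_of_ne z h1 h2] at hhigh
  by_cases h3 : cycSucc i = c
  · rw [h3, swap_val_left] at hhigh; rw [h3] at hlow; omega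
  by_cases h4 : cycSucc i = d
  · subst h4
    rw [swap_val_right] at hhigh
    refine absurd ⟨?_, ?_⟩ (hR i h1 h2)
    · have h3 := i.isLt
      have h4 := c.isLt
      rw [Fin.ext_iff] at h1
      rw [Ne, Fin.ext_iff] at hcd'
      rw [inArc_iff]
      rw [cycSucc_val] at *
      split_ifs at * <;> omega
    · rw [inArc_iff]; omega
  · rw [swap_val_of_ne z h3 h4] at hhigh; omega

/-- A domain occurs exactly once in the differential of its composition with a strip of width one: a
rectangle at the start cannot produce it, and the strip is the only rectangle at the end that does. -/
theorem domDiff_strip_apply (hn : 2 ≤ n) (a : Dom n) {i : Fin n}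
    (hlow : (a.y i : ℕ) < a.y (cycSucc i)) :
    domDiff (domOrZero a.x (a.y * Equiv.swap i (cycSucc i)) (a.D + rectChain a.y i (cycSucc i))) a
      = 1 := by
  classical
  have hne := cycSucc_ne hn i
  have hyne : a.y * Equiv.swap i (cycSucc i) ≠ a.y := fun h => by
    have := congrArg (fun z : State n => z i) h
    simp only [swap_val_left] at this
    exact hne (a.y.injective this)
  have hpos : IsPosDomain a.x (a.y * Equiv.swap i (cycSucc i))
      (a.D + rectChain a.y i (cycSucc i)) := a.isPos.add (isRect_cycSucc hn _ _).isPosDomain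
  have hswap : a.y * Equiv.swap i (cycSucc i) * Equiv.swap i (cycSucc i) = a.y :=
    swap_mul_self_right _ _ _
  have hrect := rectChain_cycSucc hn hlow
  generalize a.y * Equiv.swap i (cycSucc i) = z at hyne hpos hswap ⊢
  have hL : leftMap (fun _ => 1) (domOrZero a.x z (a.D + rectChain a.y i (cycSucc i))) a = 0 := by
    rw [leftMap_domOrZero]
    simp only [Finsupp.finsetSum_apply, one_smul]
    refine Finset.sum_eq_zero fun c _ => Finset.sum_eq_zero fun d _ => ?_
    split_ifs
    · rw [domOrZero_apply, if_neg fun h => hyne h.2.1]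
    · exact Finsupp.zero_apply
  have hterm : ∀ c d, (if IsRect (z * Equiv.swap c d) c d then
      domOrZero a.x (z * Equiv.swap c d) (a.D + rectChain a.y i (cycSucc i) -
        rectChain (z * Equiv.swap c d) c d) else 0) a = if c = i ∧ d = cycSucc i then 1 else 0 := by
    intro c d
    by_cases hcd : c = i ∧ d = cycSucc i
    · obtain ⟨rfl, rfl⟩ := hcd
      rw [hswap, if_pos (isRect_cycSucc hn _ _), add_sub_cancel_right, ← single_dom,
        Finsupp.single_eq_same, if_pos ⟨rfl, rfl⟩]
    · rw [if_neg hcd]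
      by_cases hR : IsRect (z * Equiv.swap c d) c d
      · rw [if_pos hR, domOrZero_apply, if_neg]
        rintro ⟨-, h2, h3⟩
        rw [h2] at h3
        have h5 : Equiv.swap c d = Equiv.swap i (cycSucc i) := mul_left_cancel (h2.trans hswap.symm)
        have hcdi : c = cycSucc i ∧ d = i := by
          have e1 := congrArg (fun z : State n => z i) h5
          simp only [Equiv.swap_apply_left] at e1
          rw [Equiv.swap_apply_def] at e1
          by_cases h6 : i = c
          · rw [if_pos h6] at e1
            exact absurd ⟨h6.symm, e1⟩ hcd
          · rw [if_neg h6] at e1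
            by_cases h7 : i = d
            · rw [if_pos h7] at e1
              exact ⟨e1, h7.symm⟩
            · rw [if_neg h7] at e1
              exact absurd e1.symm hne
        -- the other rectangle with these corner columns misses the column of the strip
        obtain ⟨rfl, rfl⟩ := hcdi
        have h4 := congrFun (congrFun h3 d) (a.y d)
        simp only [Pi.add_apply, Pi.sub_apply] at h4
        rw [hrect, if_pos ⟨rfl, le_rfl, hlow⟩, rectChain_eq,
          arcInd_eq_zero.2 (not_inArc_right _ _)] at h4
        omega
      · rw [if_neg hR, Finsupp.zero_apply]
  rw [domDiff, LinearMap.add_apply, Finsupp.add_apply, hL, zero_add, rightMap_domOrZero]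
  simp only [Finsupp.finsetSum_apply]
  refine (Finset.sum_congr rfl fun c _ => Finset.sum_congr rfl fun d _ => hterm c d).trans ?_
  rw [Finset.sum_eq_single i, Finset.sum_eq_single (cycSucc i)] <;> simp +contextual

/-- **The column matching.**  A positive domain is matched with the one obtained by adding or removing
the strip of width one, off the last row `r`, in the column `idx`.  By `hfib` the column and the rank
`ρ` depend only on the data shared by the two, and by `hpos` there is room to remove the strip.  The
terms of a high element have smaller rank (`hleft`, `hright`) or are removed by a rectangle that leaves
the column unchanged; of the latter only the partner is low, by `eq_cycSucc_of_isRect`. -/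
theorem exists_sub_mem_of_columns (hn : 2 ≤ n) {r : Fin n} (hr : (r : ℕ) + 1 = n)
    (U C : Set (Dom n)) (idx : Dom n → Fin n) (ρ : Dom n → ℕ)
    (hU : ∀ s ∈ U, ∀ t : Dom n, (∀ i j, t.D i j ≤ s.D i j) → t ∈ U)
    (hC : ∀ s ∈ C, ∀ t, LeftTerm s t ∨ RightTerm s t → t ∈ C)
    (hfib : ∀ s ∈ U, s ∉ C → ∀ s' : Dom n, s'.x = s.x →
      (∀ k l, (k ≠ idx s ∨ l = r) → s'.D k l = s.D k l) →
        s' ∈ U ∧ s' ∉ C ∧ idx s' = idx s ∧ ρ s' = ρ s)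
    (hpos : ∀ s ∈ U, s ∉ C → ∀ j : Fin n, (s.y (cycSucc (idx s)) : ℕ) ≤ j →
      (j : ℕ) < s.y (idx s) → 1 ≤ s.D (idx s) j)
    (hleft : ∀ s ∈ U, s ∉ C → ∀ t ∈ U, t ∉ C → LeftTerm s t → ρ t < ρ s ∨ idx t = idx s)
    (hright : ∀ s ∈ U, s ∉ C → ∀ t ∈ U, t ∉ C → RightTerm s t →
      ρ t < ρ s ∨ (idx t = idx s ∧ ∀ k, t.D k r = s.D k r))
    (k : ℚ) (b : DomChains n) (hb : b ∈ Finsupp.supported (ZMod 2) (ZMod 2) {s | s ∈ U ∧ s.deg = k})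
    (hdb : domDiff b = 0) :
    ∃ γ ∈ Finsupp.supported (ZMod 2) (ZMod 2) {s : Dom n | s ∈ U ∧ s.deg = k + 1},
      b - domDiff γ ∈ Finsupp.supported (ZMod 2) (ZMod 2) {s : Dom n | s ∈ C ∧ s.deg = k} := by
  classical
  let φ : Dom n → Dom n := fun s => ⟨s.x, s.y * Equiv.swap (idx s) (cycSucc (idx s)),
    s.D + rectChain s.y (idx s) (cycSucc (idx s)), s.isPos.add (isRect_cycSucc hn _ _).isPosDomain⟩
  let ψ : Dom n → Dom n := fun s =>
    if h : IsPosDomain s.x (s.y * Equiv.swap (idx s) (cycSucc (idx s)))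
      (s.D - rectChain (s.y * Equiv.swap (idx s) (cycSucc (idx s))) (idx s) (cycSucc (idx s)))
    then ⟨_, _, _, h⟩ else s
  -- the strip can be added at an ascent of the final generator, and removed at a descent
  let low : Set (Dom n) := {s | (s.y (idx s) : ℕ) < s.y (cycSucc (idx s))}
  have hφ : ∀ a ∈ U, a ∉ C → a ∈ low → φ a ∈ U ∧ φ a ∉ C ∧ idx (φ a) = idx a ∧ ρ (φ a) = ρ a := by
    intro a haU haC hal
    refine hfib a haU haC (φ a) rfl fun k l hkl => ?_
    simp only [φ, Pi.add_apply]
    rw [rectChain_cycSucc hn hal, if_neg, add_zero]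
    have := (a.y (cycSucc (idx a))).isLt
    rintro ⟨h1, h2, h3⟩
    rcases hkl with h | h
    · exact h h1
    · rw [h] at h3; omega
  refine exists_sub_mem_of_matching domDiff U C low φ ψ ρ Dom.deg ?_ ?_ ?_ ?_ ?_ ?_ ?_ ?_ k b hb
    (by rw [hdb]; exact Submodule.zero_mem _)
  · intro a haU haC hal
    refine ⟨(hφ a haU haC hal).1, ?_⟩
    change maslov _ _ _ = maslov _ _ _ + 1
    rw [maslov_add a.isPos.1 (isRect_cycSucc hn _ _).isPosDomain.1, (isRect_cycSucc hn _ _).maslov_eq]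
  · intro b hbU hbC hbl
    set i := idx b with hi
    set z := b.y * Equiv.swap i (cycSucc i) with hz
    have hz1 : z i = b.y (cycSucc i) := swap_val_left _ _ _
    have hz2 : z (cycSucc i) = b.y i := swap_val_right _ _ _
    have hne := b.y.injective.ne (cycSucc_ne hn i)
    have hlow : (z i : ℕ) < z (cycSucc i) := by
      rw [hz1, hz2]
      rw [Ne, Fin.ext_iff] at hne
      have : ¬ (b.y i : ℕ) < b.y (cycSucc i) := hbl
      omega
    have hRect := rectChain_cycSucc hn hlow
    have hpos' : IsPosDomain b.x z (b.D - rectChain z i (cycSucc i)) := by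
      refine ⟨b.isPos.1.sub_right ?_, fun k l => ?_⟩
      · have := (isRect_cycSucc hn z i).isPosDomain.1
        rwa [hz, swap_mul_self_right, ← hz] at this
      · rw [Pi.sub_apply, Pi.sub_apply, hRect]
        have h0 := b.isPos.2 k l
        split_ifs with h
        · obtain ⟨rfl, h1, h2⟩ := h
          have := hpos b hbU hbC l (by rw [← hi, ← hz1]; exact h1) (by rw [← hi, ← hz2]; exact h2)
          rw [← hi] at this; omega
        · omega
    have hψb : ψ b = ⟨b.x, z, b.D - rectChain z i (cycSucc i), hpos'⟩ := dif_pos hpos'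
    obtain ⟨h1, h2, h3, -⟩ := hfib b hbU hbC (ψ b) (by rw [hψb]) fun k l hkl => by
      rw [hψb]
      simp only [Pi.sub_apply]
      rw [hRect, if_neg, sub_zero]
      have := (z (cycSucc i)).isLt
      rintro ⟨h1, h2, h3⟩
      rcases hkl with h | h
      · exact h h1
      · rw [h] at h3; omega
    refine ⟨h1, h2, ?_, ?_⟩
    · change ((ψ b).y (idx (ψ b)) : ℕ) < (ψ b).y (cycSucc (idx (ψ b)))
      rw [h3, ← hi, hψb]; exact hlow
    · have : φ (ψ b) = ⟨(ψ b).x, (ψ b).y * Equiv.swap i (cycSucc i),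
          (ψ b).D + rectChain (ψ b).y i (cycSucc i),
          (ψ b).isPos.add (isRect_cycSucc hn _ _).isPosDomain⟩ := by
        simp only [φ]; congr 1 <;> rw [h3]
      rw [this, Dom.ext_iff]
      simp only [hψb, sub_add_cancel, true_and, and_true]
      rw [hz, swap_mul_self_right]
  · intro a haU haC hal
    refine Eq.trans ?_ (domDiff_strip_apply hn a hal)
    rw [single_dom]
  · intro a haU haC hal t ht hta htC htl
    obtain ⟨h1, h2, h3, h4⟩ := hφ a haU haC hal
    have hne := cycSucc_ne hn (idx a)
    rcases leftTerm_or_rightTerm ht with hL | hR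
    · have htU := hU _ h1 t hL.le
      rcases hleft _ h1 h2 t htU htC hL with h | h
      · rwa [h4] at h
      · exfalso
        -- a rectangle at the start does not change the final generator, so that `t` is high
        obtain ⟨-, -, -, -, hy, -⟩ := hL
        have : (t.y (idx t) : ℕ) < t.y (cycSucc (idx t)) := htl
        rw [h, h3, hy] at this
        change (((a.y * Equiv.swap (idx a) (cycSucc (idx a))) (idx a) : Fin n) : ℕ) <
          ((a.y * Equiv.swap (idx a) (cycSucc (idx a))) (cycSucc (idx a)) : Fin n) at this
        rw [swap_val_left, swap_val_right] at this
        exact absurd hal (not_lt.2 this.le)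
    · have htU := hU _ h1 t hR.le
      rcases hright _ h1 h2 t htU htC hR with h | ⟨h, hrow⟩
      · rwa [h4] at h
      · exfalso
        obtain ⟨c, d, hRect, hy, hx, hD⟩ := hR
        have htl' : (t.y (idx t) : ℕ) < t.y (cycSucc (idx t)) := htl
        rw [h, h3] at htl'
        have hoff : ∀ k, rectChain t.y c d k r = 0 := by
          intro k
          have e1 := hrow k
          have e2 := congrFun (congrFun hD k) r
          rw [Pi.add_apply, Pi.add_apply] at e2
          omega
        have hhigh : ((t.y * Equiv.swap c d) (cycSucc (idx a)) : ℕ) <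
            (t.y * Equiv.swap c d) (idx a) := by
          rw [← hy]
          change (((a.y * Equiv.swap (idx a) (cycSucc (idx a))) (cycSucc (idx a)) : Fin n) : ℕ) <
            ((a.y * Equiv.swap (idx a) (cycSucc (idx a))) (idx a) : Fin n)
          rw [swap_val_left, swap_val_right]; exact hal
        obtain ⟨rfl, rfl⟩ := eq_cycSucc_of_isRect hn hRect
          (lt_of_rectChain_row hr hRect.1 hoff) htl' hhigh
        have hy' : a.y = t.y := mul_right_cancel hy
        refine hta (Dom.ext hx hy'.symm ?_)
        have hD' : a.D + rectChain a.y (idx a) (cycSucc (idx a)) =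
          t.D + rectChain t.y (idx a) (cycSucc (idx a)) := hD
        rw [hy'] at hD'
        exact (add_right_cancel hD').symm
  · intro s hs t ht
    rcases leftTerm_or_rightTerm ht with h | h
    · exact hU s hs t h.le
    · exact hU s hs t h.le
  · intro s hs t ht
    exact hC s hs t (leftTerm_or_rightTerm ht)
  · intro s t ht
    have h := domDiff_mem (r := s.deg) (Finsupp.single_mem_supported (ZMod 2) (1 : ZMod 2)
      (show s ∈ {s' : Dom n | s'.deg = s.deg} from rfl))
    have : t.deg = s.deg - 1 := h (Finsupp.mem_support_iff.2 ht)
    rw [this]; ring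
  · intro c
    exact LinearMap.congr_fun (domDiff_sq hn) c

/-- Removing a positive domain lowers the sum over the row `r`, unless the row is left unchanged. -/
theorem row_sum_lt_or_eq {s t : Dom n} {r : Fin n} (h : ∀ i j, t.D i j ≤ s.D i j) :
    (∑ k, t.D k r).toNat < (∑ k, s.D k r).toNat ∨ ∀ k, t.D k r = s.D k r := by
  by_cases h' : ∀ k, t.D k r = s.D k r
  · exact Or.inr h'
  · left
    push Not at h'
    obtain ⟨k, hk⟩ := h'
    have h1 : ∑ k, t.D k r < ∑ k, s.D k r :=
      Finset.sum_lt_sum (fun i _ => h i r) ⟨k, Finset.mem_univ _, lt_of_le_of_ne (h k r) hk⟩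
    have h2 : 0 ≤ ∑ k, t.D k r := Finset.sum_nonneg fun i _ => t.isPos.2 i r
    omega

/-- A function on a cycle that is zero somewhere but not everywhere increases somewhere. -/
theorem exists_cycPred_lt {w : Fin n → ℤ} {i₀ : Fin n} (hz : w i₀ = 0)
    (hne : ¬ ∀ i, w i = 0) : ∃ i, w (cycPred i) < w i := by
  by_contra hno
  push Not at hno
  have hle : ∀ i ∈ Finset.univ, w i ≤ w (cycPred i) := fun i _ => hno i
  have heq := (Finset.sum_eq_sum_iff_of_le hle).1 (sum_cycPred w).symm
  have hconst : ∀ m : ℕ, ∀ i : Fin n, (i : ℕ) = m → w i = w ⟨0, by have := i₀.isLt; omega⟩ := by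
    intro m
    induction m with
    | zero => intro i hi; congr 1; exact Fin.ext hi
    | succ m ih =>
      intro i hi
      rw [heq i (Finset.mem_univ _)]
      exact ih _ (by rw [cycPred_val, if_neg (by omega)]; omega)
  exact hne fun i => by rw [hconst i i rfl, ← hconst i₀ i₀ rfl, hz]

/-- Domains that are not full on the last row `r` can be pushed to domains that vanish there.  The
column of the strip is one in which the last row increases: there every square that the strip would
cover has a positive coefficient.  The rank is the sum over the last row. -/
theorem exists_sub_mem_row (hn : 2 ≤ n) {r : Fin n} (hr : (r : ℕ) + 1 = n) (U : Set (Dom n))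
    (hU : ∀ s ∈ U, ∀ t : Dom n, (∀ i j, t.D i j ≤ s.D i j) → t ∈ U)
    (hzero : ∀ s ∈ U, ∃ i, s.D i r = 0)
    (hcol : ∀ s ∈ U, ∀ i, 0 < s.D i r → ∀ t : Dom n,
      (∀ k l, (k ≠ i ∨ l = r) → t.D k l = s.D k l) → t ∈ U)
    (k : ℚ) (b : DomChains n) (hb : b ∈ Finsupp.supported (ZMod 2) (ZMod 2) {s | s ∈ U ∧ s.deg = k})
    (hdb : domDiff b = 0) :
    ∃ γ ∈ Finsupp.supported (ZMod 2) (ZMod 2) {s : Dom n | s ∈ U ∧ s.deg = k + 1},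
      b - domDiff γ ∈ Finsupp.supported (ZMod 2) (ZMod 2)
        {s : Dom n | s ∈ {s | s ∈ U ∧ ∀ i, s.D i r = 0} ∧ s.deg = k} := by
  classical
  let pick : (Fin n → ℤ) → Fin n := fun w =>
    if h : ∃ i, w (cycPred i) < w i then h.choose else r
  have hpick : ∀ s ∈ U, s ∉ {s | s ∈ U ∧ ∀ i, s.D i r = 0} →
      s.D (cycPred (pick fun i => s.D i r)) r < s.D (pick fun i => s.D i r) r := by
    intro s hs hsC
    obtain ⟨i₀, hi₀⟩ := hzero s hs
    have h := exists_cycPred_lt (w := fun i => s.D i r) hi₀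
      fun h => hsC ⟨hs, h⟩
    have := h.choose_spec
    simp only [pick]
    rw [dif_pos h]
    exact this
  refine exists_sub_mem_of_columns hn hr U _ (fun s => pick fun i => s.D i r)
    (fun s => (∑ k, s.D k r).toNat) hU ?_ ?_ ?_ ?_ ?_ k b hb hdb
  · intro s hs t ht
    have hle : ∀ i j, t.D i j ≤ s.D i j := by
      rcases ht with h | h
      · exact h.le
      · exact h.le
    exact ⟨hU s hs.1 t hle, fun i => le_antisymm (hs.2 i ▸ hle i r) (t.isPos.2 i r)⟩
  · intro s hs hsC s' _ hD
    have hrow : ∀ i, s'.D i r = s.D i r := fun i => hD i r (Or.inr rfl)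
    have h1 := hpick s hs hsC
    have h2 := s.isPos.2 (cycPred (pick fun i => s.D i r)) r
    refine ⟨hcol s hs _ (by omega) s' hD, fun h => hsC ⟨hs, fun i => hrow i ▸ h.2 i⟩, ?_, ?_⟩
    · simp only [hrow]
    · simp only [hrow]
  · intro s hs hsC j _ hj
    have h1 := hpick s hs hsC
    have h2 := s.isPos.1.column_step hr (pick fun i => s.D i r) j
    have h3 := s.isPos.2 (cycPred (pick fun i => s.D i r)) j
    rw [if_neg (not_le.2 hj)] at h2
    split_ifs at h2 <;> omega
  · intro s _ _ t _ _ h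
    rcases row_sum_lt_or_eq (r := r) h.le with h' | h'
    · exact Or.inl h'
    · right; simp only [h']
  · intro s _ _ t _ _ h
    rcases row_sum_lt_or_eq (r := r) h.le with h' | h'
    · exact Or.inl h'
    · right; refine ⟨?_, h'⟩; simp only [h']

/-- A permutation without an ascent reverses the order. -/
theorem exists_ascent_of_ne_rev {x : State n} (hx : x ≠ Fin.revPerm) :
    ∃ i : Fin n, (i : ℕ) + 1 < n ∧ (x i : ℕ) < x (cycSucc i) := by
  by_contra hno
  push Not at hno
  refine hx (Equiv.ext fun i => Fin.ext ?_)
  have step : ∀ i : Fin n, (i : ℕ) + 1 < n → (x (cycSucc i) : ℕ) + 1 ≤ x i := by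
    intro i hi
    have h1 := hno i hi
    have h2 : (x (cycSucc i) : ℕ) ≠ x i := by
      rw [Ne, ← Fin.ext_iff, x.injective.eq_iff, Fin.ext_iff, cycSucc_val]
      split_ifs <;> omega
    omega
  have up : ∀ m : ℕ, ∀ i : Fin n, (i : ℕ) = m → (x i : ℕ) + m + 1 ≤ n := by
    intro m
    induction m with
    | zero => intro i _; have := (x i).isLt; omega
    | succ m ih =>
      intro i hi
      have hp : (cycPred i : ℕ) = m := by rw [cycPred_val, if_neg (by omega)]; omega
      have h1 := ih _ hp
      have h2 := step (cycPred i) (by have := i.isLt; omega)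
      rw [cycSucc_cycPred] at h2
      omega
  have down : ∀ m : ℕ, ∀ i : Fin n, (i : ℕ) + 1 + m = n → m ≤ (x i : ℕ) := by
    intro m
    induction m with
    | zero => intro i _; omega
    | succ m ih =>
      intro i hi
      have hs : (cycSucc i : ℕ) = i + 1 := by rw [cycSucc_val, if_neg (by omega)]
      have h1 := ih (cycSucc i) (by omega)
      have h2 := step i (by omega)
      omega
  have h1 := up i i rfl
  have h2 := down (n - 1 - i) i (by have := i.isLt; omega)
  rw [Fin.revPerm_apply, Fin.val_rev]
  omega

/-- The only planar positive domain that starts at the order-reversing generator is the trivial one. -/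
theorem eq_rev_of_planar {s : Dom n} {r : Fin n} (hr : (r : ℕ) + 1 = n) (hx : s.x = Fin.revPerm)
    (hrow : ∀ i, s.D i r = 0) (hcol : ∀ j, s.D r j = 0) : s.y = Fin.revPerm ∧ s.D = 0 := by
  have hxv : ∀ i : Fin n, (s.x i : ℕ) = n - 1 - i := fun i => by
    rw [hx, Fin.revPerm_apply, Fin.val_rev]; omega
  -- column by column: the next value of `y` cannot be smaller than that of `x`, and the greater
  -- values are taken already
  have key : ∀ m : ℕ, ∀ i : Fin n, (i : ℕ) = m → (∀ j, s.D i j = 0) ∧ s.y i = s.x i := by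
    intro m
    induction m using Nat.strong_induction_on with
    | _ m ih =>
      intro i hi
      have hprev : ∀ j, s.D (cycPred i) j = 0 := by
        intro j
        by_cases h0 : m = 0
        · have : cycPred i = r := by rw [Fin.ext_iff, cycPred_val, if_pos (by omega)]; omega
          rw [this]; exact hcol j
        · exact (ih (m - 1) (by omega) _ (by rw [cycPred_val, if_neg (by omega)]; omega)).1 j
      have hst := s.isPos.1.column_step hr i
      simp only [hprev, hrow, sub_zero, zero_add] at hst
      have hle : (s.x i : ℕ) ≤ s.y i := by
        have h1 := hst (s.y i)
        have h2 := s.isPos.2 i (s.y i)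
        by_contra hlt
        rw [if_neg hlt, if_pos le_rfl] at h1
        omega
      have heq : s.y i = s.x i := by
        by_contra hne
        have hlt : (s.x i : ℕ) < s.y i := lt_of_le_of_ne hle fun h => hne (Fin.ext h.symm)
        have hyl := (s.y i).isLt
        rw [hxv] at hlt
        have h3 := (ih (n - 1 - s.y i) (by omega) ⟨n - 1 - s.y i, by omega⟩ rfl).2
        have h4 : s.x ⟨n - 1 - s.y i, by omega⟩ = s.y i := by
          rw [Fin.ext_iff, hxv]; simp only; omega
        rw [h4] at h3
        have h5 := congrArg Fin.val (s.y.injective h3)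
        simp only at h5
        omega
      refine ⟨fun j => ?_, heq⟩
      rw [hst j, heq, sub_self]
  refine ⟨?_, ?_⟩
  · rw [← hx]; exact Equiv.ext fun i => (key i i rfl).2
  · funext i j; exact (key i i rfl).1 j

/-- Planar domains can be pushed to domains that start at the order-reversing generator.  The column of
the strip is an ascent of the initial generator `x`, and the rank is `∑ k, k * x k`, which decreases
when a rectangle is removed at the start. -/
theorem exists_sub_mem_planar (hn : 2 ≤ n) {r : Fin n} (hr : (r : ℕ) + 1 = n)
    (k : ℚ) (b : DomChains n) (hb : b ∈ Finsupp.supported (ZMod 2) (ZMod 2)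
      {s : Dom n | s ∈ {s | (∀ i, s.D i r = 0) ∧ ∀ j, s.D r j = 0} ∧ s.deg = k})
    (hdb : domDiff b = 0) :
    ∃ γ ∈ Finsupp.supported (ZMod 2) (ZMod 2)
      {s : Dom n | s ∈ {s | (∀ i, s.D i r = 0) ∧ ∀ j, s.D r j = 0} ∧ s.deg = k + 1},
      b - domDiff γ ∈ Finsupp.supported (ZMod 2) (ZMod 2)
        {s : Dom n | s ∈ {s | ((∀ i, s.D i r = 0) ∧ ∀ j, s.D r j = 0) ∧ s.x = Fin.revPerm} ∧
          s.deg = k} := by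
  classical
  let pick : State n → Fin n := fun x =>
    if h : ∃ i : Fin n, (i : ℕ) + 1 < n ∧ (x i : ℕ) < x (cycSucc i) then h.choose else r
  have hpick : ∀ x : State n, x ≠ Fin.revPerm →
      (pick x : ℕ) + 1 < n ∧ (x (pick x) : ℕ) < x (cycSucc (pick x)) := by
    intro x hx
    have h := exists_ascent_of_ne_rev hx
    simp only [pick]
    rw [dif_pos h]
    exact h.choose_spec
  have hoff : ∀ s : Dom n, ((∀ i, s.D i r = 0) ∧ ∀ j, s.D r j = 0) → ∀ t : Dom n,
      ∀ z a b, s.D = t.D + rectChain z a b →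
        (∀ k, rectChain z a b k r = 0) ∧ ∀ l, rectChain z a b r l = 0 := by
    intro s hs t z a b hD
    have hz : ∀ i j, s.D i j = 0 → rectChain z a b i j = 0 := by
      intro i j h
      have h1 := congrFun (congrFun hD i) j
      have h2 := t.isPos.2 i j
      have h3 := rectChain_nonneg z a b i j
      rw [Pi.add_apply, Pi.add_apply] at h1
      omega
    exact ⟨fun k => hz _ _ (hs.1 k), fun l => hz _ _ (hs.2 l)⟩
  refine exists_sub_mem_of_columns hn hr _ _ (fun s => pick s.x)
    (fun s => ∑ k : Fin n, (k : ℕ) * (s.x k : ℕ)) ?_ ?_ ?_ ?_ ?_ ?_ k b hb hdb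
  · intro s hs t hle
    exact ⟨fun i => le_antisymm (hs.1 i ▸ hle i r) (t.isPos.2 i r),
      fun j => le_antisymm (hs.2 j ▸ hle r j) (t.isPos.2 r j)⟩
  · rintro s ⟨hs, hsx⟩ t ht
    have hle : ∀ i j, t.D i j ≤ s.D i j := by
      rcases ht with h | h
      · exact h.le
      · exact h.le
    refine ⟨⟨fun i => le_antisymm (hs.1 i ▸ hle i r) (t.isPos.2 i r),
      fun j => le_antisymm (hs.2 j ▸ hle r j) (t.isPos.2 r j)⟩, ?_⟩
    rcases ht with ⟨a, b, hR, -, -, hD⟩ | ⟨a, b, -, -, hx, -⟩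
    · exfalso
      obtain ⟨h1, h2⟩ := hoff s hs t _ _ _ hD
      have h3 := lt_of_rectChain_row hr hR.1 h1
      have h4 := lt_of_rectChain_col hr hR.1 h2
      rw [hsx, Fin.revPerm_apply, Fin.revPerm_apply, Fin.val_rev, Fin.val_rev] at h3
      omega
    · rw [hx, hsx]
  · intro s hs hsC s' hx hD
    have hsx : s.x ≠ Fin.revPerm := fun h => hsC ⟨hs, h⟩
    have hp := (hpick s.x hsx).1
    refine ⟨⟨fun i => by rw [hD i r (Or.inr rfl), hs.1], fun j => ?_⟩,
      fun h => hsx (hx ▸ h.2), by simp only [hx], by simp only [hx]⟩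
    rw [hD r j (Or.inl fun h => ?_), hs.2]
    rw [← h] at hp; omega
  · intro s hs hsC j hj1 hj2
    have hsx : s.x ≠ Fin.revPerm := fun h => hsC ⟨hs, h⟩
    have hp := (hpick s.x hsx).2
    have h1 := s.isPos.1.column_step hr (pick s.x) j
    have h2 := s.isPos.1.column_step hr (cycSucc (pick s.x)) j
    have h3 := s.isPos.2 (cycPred (pick s.x)) j
    have h4 := s.isPos.2 (cycSucc (pick s.x)) j
    simp only [hs.1, cycPred_cycSucc, sub_self, zero_add] at h1 h2
    rw [if_neg (not_le.2 hj2)] at h1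
    rw [if_pos hj1] at h2
    split_ifs at h1 h2 <;> omega
  · rintro s hs hsC t ht htC ⟨a, b, hR, hx, -, hD⟩
    left
    obtain ⟨h1, h2⟩ := hoff s hs t _ _ _ hD
    have h3 := lt_of_rectChain_row hr hR.1 h1
    have h4 := lt_of_rectChain_col hr hR.1 h2
    have hsplit : ∀ f : Fin n → ℕ, ∑ k, f k =
        f a + f b + ∑ k ∈ (Finset.univ.erase a).erase b, f k := by
      intro f
      rw [add_assoc, Finset.add_sum_erase _ _ (Finset.mem_erase.2 ⟨hR.1.symm, Finset.mem_univ _⟩),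
        Finset.add_sum_erase _ _ (Finset.mem_univ _)]
    rw [hsplit, hsplit fun k => (k : ℕ) * (s.x k : ℕ), hx, swap_val_left, swap_val_right]
    have hrest : ∑ k ∈ (Finset.univ.erase a).erase b,
        (k : ℕ) * ((s.x * Equiv.swap a b) k : ℕ) =
        ∑ k ∈ (Finset.univ.erase a).erase b, (k : ℕ) * (s.x k : ℕ) := by
      refine Finset.sum_congr rfl fun k hk => ?_
      rw [Finset.mem_erase, Finset.mem_erase] at hk
      rw [swap_val_of_ne _ hk.2.1 hk.1]
    rw [hrest]
    have := mul_pos (Nat.sub_pos_of_lt h3) (Nat.sub_pos_of_lt h4)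
    -- the rank drops by the area of the rectangle
    zify [h3.le, h4.le] at this ⊢
    nlinarith
  · rintro s hs hsC t ht htC ⟨a, b, hR, -, hx, hD⟩
    right
    exact ⟨by simp only [hx], fun k => by rw [hs.1, ht.1]⟩

end Columns

/-! ### Transposition -/

section Transpose
variable {n : ℕ}

theorem cornerCoeff_transpose (D : TwoChain n) (i j : Fin n) :
    cornerCoeff (fun i j => D j i) i j = cornerCoeff D j i := by
  simp only [cornerCoeff, alphaBoundary]; ring

theorem IsPosDomain.transpose {x y : State n} {D : TwoChain n} (h : IsPosDomain x y D) :
    IsPosDomain x⁻¹ y⁻¹ fun i j => D j i := by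
  have hp : ∀ (z : State n) (i j : Fin n), pointCoeff z⁻¹ i j = pointCoeff z j i := fun z i j => by
    simp only [pointCoeff, Equiv.Perm.inv_eq_iff_eq]
    exact if_congr eq_comm rfl rfl
  exact ⟨fun i j => by rw [cornerCoeff_transpose, h.1, hp, hp], fun i j => h.2 j i⟩

/-- The reflection of a positive domain in the diagonal. -/
def Dom.transpose (s : Dom n) : Dom n := ⟨s.x⁻¹, s.y⁻¹, fun i j => s.D j i, s.isPos.transpose⟩

theorem Dom.deg_transpose (s : Dom n) : s.transpose.deg = s.deg := by
  have h : ∀ z : State n, ∑ i, pointMeasure (fun i j => s.D j i) i (z⁻¹ i) =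
      ∑ i, pointMeasure s.D i (z i) := by
    intro z
    rw [← Equiv.sum_comp z]
    refine Finset.sum_congr rfl fun i _ => ?_
    rw [show z⁻¹ (z i) = i from z.symm_apply_apply i, pointMeasure, pointMeasure]
    push_cast; ring
  simp only [Dom.deg, maslov, Dom.transpose, h]

/-- The linear extension of the reflection in the diagonal. -/
def transposeMap : DomChains n →ₗ[ZMod 2] DomChains n :=
  Finsupp.lmapDomain (ZMod 2) (ZMod 2) Dom.transpose

theorem transposeMap_domOrZero (x y : State n) (E : TwoChain n) :
    transposeMap (domOrZero x y E) = domOrZero x⁻¹ y⁻¹ fun i j => E j i := by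
  by_cases h : IsPosDomain x y E
  · rw [domOrZero_of_pos h, domOrZero_of_pos h.transpose, transposeMap, Finsupp.lmapDomain_apply,
      Finsupp.mapDomain_single]
    rfl
  · rw [domOrZero_of_not_pos h, domOrZero_of_not_pos, map_zero]
    intro h'
    have := h'.transpose
    rw [inv_inv, inv_inv] at this
    exact h this

theorem transposeMap_transposeMap (c : DomChains n) : transposeMap (transposeMap c) = c := by
  suffices h : transposeMap ∘ₗ transposeMap = (LinearMap.id : DomChains n →ₗ[ZMod 2] _) from
    LinearMap.congr_fun h c
  refine domLin_ext fun x y E => ?_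
  simp only [LinearMap.comp_apply, transposeMap_domOrZero, inv_inv, LinearMap.id_apply]

theorem mem_supported_of_subset {S : Type*} {P Q : Set S} {c : S →₀ ZMod 2}
    (hc : c ∈ Finsupp.supported (ZMod 2) (ZMod 2) P) (h : ∀ s ∈ P, s ∈ Q) :
    c ∈ Finsupp.supported (ZMod 2) (ZMod 2) Q := Finsupp.supported_mono h hc

theorem transposeMap_mem {P Q : Set (Dom n)} {c : DomChains n}
    (hc : c ∈ Finsupp.supported (ZMod 2) (ZMod 2) P) (h : ∀ s ∈ P, s.transpose ∈ Q) :
    transposeMap c ∈ Finsupp.supported (ZMod 2) (ZMod 2) Q := by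
  refine map_mem_of_supported _ _ _ (fun s hs => ?_) hc
  rw [transposeMap, Finsupp.lmapDomain_apply, Finsupp.mapDomain_single]
  exact Finsupp.single_mem_supported _ _ (h s hs)

theorem rectChain_transpose (x : State n) (a b : Fin n) :
    rectChain x⁻¹ (x a) (x b) = fun i j => rectChain x a b j i := by
  funext i j
  simp only [rectChain_eq, Equiv.Perm.inv_def]
  rw [Equiv.symm_apply_apply, Equiv.symm_apply_apply, mul_comm]

theorem isRect_transpose (x : State n) (a b : Fin n) :
    IsRect x⁻¹ (x a) (x b) ↔ IsRect x a b := by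
  rw [isRect_iff, isRect_iff, rectChain_transpose, x.injective.ne_iff]
  refine and_congr_right fun _ => ?_
  constructor
  · intro h k hka hkb
    have := h (x k) (x.injective.ne hka) (x.injective.ne hkb)
    rwa [show x⁻¹ (x k) = k from x.symm_apply_apply k] at this
  · intro h k hka hkb
    have h1 := h (x⁻¹ k) (fun h => hka (Equiv.Perm.inv_eq_iff_eq.1 h))
      fun h => hkb (Equiv.Perm.inv_eq_iff_eq.1 h)
    rwa [show x (x⁻¹ k) = k from x.apply_symm_apply k] at h1

theorem inv_mul_swap (x : State n) (a b : Fin n) :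
    x⁻¹ * Equiv.swap (x a) (x b) = (x * Equiv.swap a b)⁻¹ := by
  rw [mul_inv_rev, Equiv.swap_inv, Equiv.swap_mul_eq_mul_swap, inv_inv]

/-- The reflection in the diagonal takes the rectangle with sides in the columns `a`, `b` to the one with
sides in the columns `x a`, `x b`. -/
theorem transposeMap_domDiff_comm :
    transposeMap ∘ₗ domDiff = (domDiff : DomChains n →ₗ[ZMod 2] _) ∘ₗ transposeMap := by
  classical
  refine domLin_ext fun x y E => ?_
  simp only [LinearMap.comp_apply, transposeMap_domOrZero, domDiff, LinearMap.add_apply,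
    map_add, leftMap_domOrZero, rightMap_domOrZero, map_sum, one_smul]
  congr 1
  · refine Eq.trans ?_ (Equiv.sum_comp x _)
    refine Finset.sum_congr rfl fun a _ => ?_
    refine Eq.trans ?_ (Equiv.sum_comp x _)
    refine Finset.sum_congr rfl fun b _ => ?_
    rw [apply_ite transposeMap, transposeMap_domOrZero, map_zero, inv_mul_swap, rectChain_transpose]
    exact if_congr (isRect_transpose x a b).symm rfl rfl
  · rw [Finset.sum_comm]
    refine Eq.trans ?_ (Equiv.sum_comp y _)
    refine Finset.sum_congr rfl fun b _ => ?_
    refine Eq.trans ?_ (Equiv.sum_comp y _)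
    refine Finset.sum_congr rfl fun a _ => ?_
    -- the corners of a rectangle that ends at `y` lie on the other diagonal
    have h1 : y⁻¹ * Equiv.swap (y b) (y a) = (y * Equiv.swap a b)⁻¹ := by
      rw [inv_mul_swap, Equiv.swap_comm]
    have h2 := isRect_transpose (y * Equiv.swap a b) a b
    have h3 := rectChain_transpose (y * Equiv.swap a b) a b
    rw [swap_val_left, swap_val_right] at h2 h3
    rw [apply_ite transposeMap, transposeMap_domOrZero, map_zero, h1, h3]
    exact if_congr h2.symm rfl rfl

end Transpose

/-! ### The homology of the complex of positive domains -/

section DomHomology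
variable {n : ℕ}

/-- The part of the complex of positive domains on which a fixed row is not full has the homology of a
point: its cycles are homologous to multiples of a constant domain. -/
theorem exists_sub_mem_constant (hn : 2 ≤ n) {r : Fin n} (hr : (r : ℕ) + 1 = n) (k : ℚ)
    (b : DomChains n)
    (hb : b ∈ Finsupp.supported (ZMod 2) (ZMod 2) {s : Dom n | (∃ i, s.D i r = 0) ∧ s.deg = k})
    (hdb : domDiff b = 0) :
    ∃ γ ∈ Finsupp.supported (ZMod 2) (ZMod 2)
        {s : Dom n | (∃ i, s.D i r = 0) ∧ s.deg = k + 1},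
      b - domDiff γ ∈ Finsupp.supported (ZMod 2) (ZMod 2)
        {s : Dom n | (s.x = Fin.revPerm ∧ s.y = Fin.revPerm ∧ s.D = 0) ∧ s.deg = k} := by
  have hdd : ∀ c : DomChains n, domDiff (domDiff c) = 0 := LinearMap.congr_fun (domDiff_sq hn)
  have htd : ∀ c : DomChains n, transposeMap (domDiff c) = domDiff (transposeMap c) :=
    LinearMap.congr_fun transposeMap_domDiff_comm
  obtain ⟨γ₁, h1, h1'⟩ := exists_sub_mem_row hn hr {s | ∃ i, s.D i r = 0}
    (fun s ⟨i, hi⟩ t hle => ⟨i, le_antisymm (hi ▸ hle i r) (t.isPos.2 i r)⟩) (fun s hs => hs)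
    (fun s ⟨i, hi⟩ _ _ t ht => ⟨i, by rw [ht i r (Or.inr rfl), hi]⟩) k b hb hdb
  have hd1 : domDiff (b - domDiff γ₁) = 0 := by rw [map_sub, hdb, hdd, sub_zero]
  obtain ⟨γ₂, h2, h2'⟩ := exists_sub_mem_row hn hr {s | ∀ j, s.D r j = 0}
    (fun s hs t hle j => le_antisymm (hs j ▸ hle r j) (t.isPos.2 r j)) (fun s hs => ⟨r, hs r⟩)
    (fun s hs i hi t ht j => by
      rw [ht r j (Or.inl fun h => ?_)]
      · exact hs j
      · rw [← h, hs r] at hi; exact lt_irrefl _ hi) k (transposeMap (b - domDiff γ₁))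
    (transposeMap_mem h1' fun s hs => ⟨fun j => hs.1.2 j, s.deg_transpose.trans hs.2⟩)
    (by rw [← htd, hd1, map_zero])
  have hd2 : domDiff (transposeMap (b - domDiff γ₁) - domDiff γ₂) = 0 := by
    rw [map_sub, ← htd, hd1, hdd, map_zero, sub_zero]
  obtain ⟨γ₃, h3, h3'⟩ := exists_sub_mem_planar hn hr k (transposeMap (b - domDiff γ₁) - domDiff γ₂)
    (mem_supported_of_subset h2' fun s hs => ⟨⟨hs.1.2, hs.1.1⟩, hs.2⟩) hd2
  refine ⟨γ₁ + transposeMap (γ₂ + γ₃), Submodule.add_mem _ h1 (transposeMap_mem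
    (Submodule.add_mem _ h2 (mem_supported_of_subset h3 fun s hs => ⟨hs.1.2, hs.2⟩))
      fun s hs => ?_), ?_⟩
  · exact ⟨⟨r, hs.1 r⟩, s.deg_transpose.trans hs.2⟩
  · have : b - domDiff (γ₁ + transposeMap (γ₂ + γ₃)) =
        transposeMap (transposeMap (b - domDiff γ₁) - domDiff γ₂ - domDiff γ₃) := by
      rw [map_sub, map_sub, transposeMap_transposeMap, htd, htd, map_add, map_add, map_add]
      abel
    rw [this]
    refine transposeMap_mem h3' fun s hs => ?_
    obtain ⟨⟨⟨hrow, hcol⟩, hx⟩, hdeg⟩ := hs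
    obtain ⟨hy, hD⟩ := eq_rev_of_planar hr hx hrow hcol
    have hrev : (Fin.revPerm : State n)⁻¹ = Fin.revPerm := by
      ext i; simp [Equiv.Perm.inv_def]
    refine ⟨⟨?_, ?_, ?_⟩, s.deg_transpose.trans hdeg⟩
    · change s.x⁻¹ = _; rw [hx, hrev]
    · change s.y⁻¹ = _; rw [hy, hrev]
    · change (fun i j => s.D j i) = 0; rw [hD]; rfl

/-- The sum of the coefficients of the constant domains. -/
def constCount : DomChains n →ₗ[ZMod 2] ZMod 2 :=
  Finsupp.linearCombination _ fun s => by
    classical exact if s.x = s.y ∧ s.D = 0 then 1 else 0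

open scoped Classical in
theorem constCount_domOrZero (x y : State n) (E : TwoChain n) :
    constCount (domOrZero x y E) = if x = y ∧ E = 0 then 1 else 0 := by
  by_cases h : IsPosDomain x y E
  · rw [domOrZero_of_pos h, constCount, Finsupp.linearCombination_single, one_smul]
  · rw [domOrZero_of_not_pos h, map_zero, if_neg]
    rintro ⟨rfl, rfl⟩
    exact h ⟨fun i j => by simp [cornerCoeff, alphaBoundary], fun i j => le_rfl⟩

/-- A domain that becomes constant when a rectangle is removed at the start is this rectangle, and also
becomes constant when it is removed at the end. -/
theorem constCount_domDiff (c : DomChains n) : constCount (domDiff c) = 0 := by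
  classical
  suffices h : constCount ∘ₗ domDiff = (0 : DomChains n →ₗ[ZMod 2] _) from LinearMap.congr_fun h c
  refine domLin_ext fun x y E => ?_
  rw [LinearMap.comp_apply, domDiff, LinearMap.add_apply, map_add, LinearMap.zero_apply,
    leftMap_domOrZero, rightMap_domOrZero]
  refine Eq.trans ?_ (ZModModule.add_self (constCount (∑ a, ∑ b, if IsRect x a b then
    (1 : ZMod 2) • domOrZero (x * Equiv.swap a b) y (E - rectChain x a b) else 0)))
  congr 1
  simp only [map_sum]
  refine Finset.sum_congr rfl fun a _ => Finset.sum_congr rfl fun b _ => ?_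
  rw [apply_ite constCount, apply_ite constCount, one_smul, constCount_domOrZero,
    constCount_domOrZero, map_zero]
  by_cases h : x * Equiv.swap a b = y
  · have h' : y * Equiv.swap a b = x := by rw [← h, swap_mul_self_right]
    simp only [h, h']
  · have h' : x ≠ y * Equiv.swap a b := fun h' => h (by rw [h', swap_mul_self_right])
    simp only [h, h', false_and, if_false, ite_self]

theorem deg_eq_zero {s : Dom n} (hD : s.D = 0) : s.deg = 0 := by
  rw [Dom.deg, hD]; simp [maslov, pointMeasure]

theorem constCount_eq_zero {k : ℚ} (hk : k ≠ 0) {c : DomChains n} (hc : c ∈ domGr n k) :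
    constCount c = 0 := by
  classical
  refine map_mem_of_supported constCount _ ⊥ (fun s hs => ?_) hc
  rw [Submodule.mem_bot, single_dom, constCount_domOrZero, if_neg]
  rintro ⟨-, hD⟩
  exact hk ((show s.deg = k from hs).symm.trans (deg_eq_zero hD))

theorem domGr_eq_bot {k : ℚ} (hk : k < 0) : domGr n k = ⊥ := by
  rw [domGr, Set.eq_empty_of_forall_notMem (s := {s : Dom n | s.deg = k}), Finsupp.supported_empty]
  intro s hs
  have : (0 : ℚ) ≤ s.deg := maslov_nonneg s.isPos.2
  rw [show s.deg = k from hs] at this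
  linarith

/-- Adding a 2-chain `A`. -/
def addMap (A : TwoChain n) : DomChains n →ₗ[ZMod 2] DomChains n :=
  Finsupp.linearCombination _ fun s => domOrZero s.x s.y (s.D + A)

theorem subMap_addMap {A : TwoChain n} (hA : IsPeriodic A) (c : DomChains n) :
    subMap A (addMap A c) = c := by
  suffices h : subMap A ∘ₗ addMap A = LinearMap.id from LinearMap.congr_fun h c
  refine Finsupp.lhom_ext' fun s => LinearMap.ext_ring ?_
  simp only [LinearMap.comp_apply, Finsupp.lsingle_apply, addMap,
    Finsupp.linearCombination_single, one_smul, LinearMap.id_apply, subMap_domOrZero hA,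
    add_sub_cancel_right]
  exact (single_dom s).symm

theorem addMap_mem {A : TwoChain n} (hA : IsPeriodic A) (hm : ∀ x, maslov x x A = 2) {r : ℚ}
    {c : DomChains n} (hc : c ∈ domGr n r) : addMap A c ∈ domGr n (r + 2) := by
  refine map_mem_of_supported _ _ _ (fun s hs => ?_) hc
  rw [addMap, Finsupp.linearCombination_single, one_smul]
  refine domOrZero_mem fun _ => ?_
  change maslov _ _ _ = _
  rw [maslov_add s.isPos.1 (hA.isPosDomain s.y).1, hm, show maslov s.x s.y s.D = r from hs]

theorem subMap_apply {A : TwoChain n} (hA : IsPeriodic A) (c : DomChains n) (t u : Dom n)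
    (hx : u.x = t.x) (hy : u.y = t.y) (hD : u.D = t.D + A) : subMap A c t = c u := by
  classical
  suffices h : Finsupp.lapply t ∘ₗ subMap A = Finsupp.lapply (R := ZMod 2) (M := ZMod 2) u from
    LinearMap.congr_fun h c
  refine domLin_ext fun x y E => ?_
  simp only [LinearMap.comp_apply, subMap_domOrZero hA, Finsupp.lapply_apply, domOrZero_apply, hx,
    hy, hD, sub_eq_iff_eq_add]

/-- The kernel of the operator that takes out the row `r` is spanned by the domains on which this row
is not full. -/
theorem mem_of_subMap_rowChain_eq_zero {r : Fin n} {c : DomChains n}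
    (h : subMap (rowChain r) c = 0) :
    c ∈ Finsupp.supported (ZMod 2) (ZMod 2) {s : Dom n | ∃ i, s.D i r = 0} := by
  rw [Finsupp.mem_supported']
  intro s hs
  have hfull : ∀ i, 1 ≤ s.D i r := fun i => by
    have h1 := s.isPos.2 i r
    have h2 : s.D i r ≠ 0 := fun h => hs ⟨i, h⟩
    omega
  have hH := isPeriodic_rowChain (n := n) r
  have hpos : IsPosDomain s.x s.y (s.D - rowChain r) := by
    refine ⟨s.isPos.1.sub_right (hH.isPosDomain s.y).1, fun i j => ?_⟩
    rw [Pi.sub_apply, Pi.sub_apply, rowChain]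
    split_ifs with hj
    · have := hfull i; rw [hj]; omega
    · rw [sub_zero]; exact s.isPos.2 i j
  rw [← subMap_apply hH c ⟨s.x, s.y, _, hpos⟩ s rfl rfl (sub_add_cancel _ _).symm, h,
    Finsupp.zero_apply]

theorem subMap_rowChain_eq_zero {r : Fin n} {c : DomChains n}
    (hc : c ∈ Finsupp.supported (ZMod 2) (ZMod 2) {s : Dom n | ∃ i, s.D i r = 0}) :
    subMap (rowChain r) c = 0 := by
  refine map_mem_of_supported (subMap (rowChain r)) _ ⊥ (fun s hs => ?_) hc
  obtain ⟨i, hi⟩ := hs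
  rw [Submodule.mem_bot, single_dom, subMap_domOrZero (isPeriodic_rowChain r), domOrZero_of_not_pos]
  intro h
  have := h.2 i r
  rw [Pi.sub_apply, Pi.sub_apply, hi, rowChain, if_pos rfl] at this
  omega

theorem mem_inter_domGr {P : Set (Dom n)} {k : ℚ} {c : DomChains n}
    (h1 : c ∈ Finsupp.supported (ZMod 2) (ZMod 2) P) (h2 : c ∈ domGr n k) :
    c ∈ Finsupp.supported (ZMod 2) (ZMod 2) {s | s ∈ P ∧ s.deg = k} :=
  fun _ hs => ⟨h1 hs, h2 hs⟩

/-- The sum of the coefficients of the domains that consist of `m` copies of the row `r`. -/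
def rowCount (r : Fin n) (m : ℕ) : DomChains n →ₗ[ZMod 2] ZMod 2 :=
  constCount ∘ₗ (subMap (rowChain r) ^ m : Module.End (ZMod 2) (DomChains n))

theorem rowCount_zero (r : Fin n) (c : DomChains n) : rowCount r 0 c = constCount c := rfl

theorem rowCount_succ (r : Fin n) (m : ℕ) (c : DomChains n) :
    rowCount r (m + 1) c = rowCount r m (subMap (rowChain r) c) := by
  rw [rowCount, rowCount, pow_succ]; rfl

theorem subMap_rowChain_domDiff (r : Fin n) (c : DomChains n) :
    subMap (rowChain r) (domDiff c) = domDiff (subMap (rowChain r) c) :=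
  LinearMap.congr_fun (subMap_domDiff_comm (isPeriodic_rowChain r)) c

theorem rowCount_domDiff (r : Fin n) (m : ℕ) : ∀ c : DomChains n, rowCount r m (domDiff c) = 0 := by
  induction m with
  | zero => exact constCount_domDiff
  | succ m ih => intro c; rw [rowCount_succ, subMap_rowChain_domDiff, ih]

theorem rowCount_eq_zero (r : Fin n) (m : ℕ) : ∀ {k : ℚ} {c : DomChains n},
    k ≠ 2 * m → c ∈ domGr n k → rowCount r m c = 0 := by
  induction m with
  | zero => intro k c hk hc; exact constCount_eq_zero (by simpa using hk) hc
  | succ m ih =>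
    intro k c hk hc
    rw [rowCount_succ]
    refine ih (k := k - 2) (fun h => hk ?_)
      (subMap_mem (isPeriodic_rowChain r) (maslov_rowChain · r) hc)
    push_cast; linarith

/-- The counts `rowCount r m` detect the boundaries among the cycles.  By induction on the degree, a
boundary makes the cycle vanish when the row `r` is taken out; what remains lies in the kernel of this
operator, where `exists_sub_mem_constant` applies. -/
theorem exists_domDiff_eq (hn : 2 ≤ n) {r : Fin n} (hr : (r : ℕ) + 1 = n) (k : ℕ) :
    ∀ c ∈ domGr n k, domDiff c = 0 → (∀ m, rowCount r m c = 0) →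
      ∃ e ∈ domGr n (k + 1), domDiff e = c := by
  have hH := isPeriodic_rowChain (n := n) r
  have hdd : ∀ c : DomChains n, domDiff (domDiff c) = 0 := LinearMap.congr_fun (domDiff_sq hn)
  induction k using Nat.strong_induction_on with
  | _ k ih =>
    intro c hc hdc hχ
    obtain ⟨e₁, he₁, hA⟩ : ∃ e ∈ domGr n ((k : ℚ) + 1),
        subMap (rowChain r) (c - domDiff e) = 0 := by
      have hm := subMap_mem hH (maslov_rowChain · r) hc
      rcases lt_or_ge k 2 with h2 | h2
      · refine ⟨0, Submodule.zero_mem _, ?_⟩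
        have h2' : (k : ℚ) < 2 := by exact_mod_cast h2
        rw [domGr_eq_bot (by linarith)] at hm
        rw [map_zero, sub_zero]
        exact hm
      · obtain ⟨l, rfl⟩ := Nat.exists_eq_add_of_le' h2
        obtain ⟨e, he, hde⟩ := ih l (by omega) (subMap (rowChain r) c)
          (by convert hm using 2; push_cast; ring)
          (by rw [← subMap_rowChain_domDiff, hdc, map_zero])
          (fun m => by rw [← rowCount_succ]; exact hχ _)
        refine ⟨addMap (rowChain r) e, ?_, ?_⟩
        · convert addMap_mem hH (maslov_rowChain · r) he using 2
          push_cast; ring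
        · rw [map_sub, subMap_rowChain_domDiff, subMap_addMap hH, hde, sub_self]
    have hd1 : domDiff (c - domDiff e₁) = 0 := by rw [map_sub, hdc, hdd, sub_zero]
    have hg1 : c - domDiff e₁ ∈ domGr n (k : ℚ) := by
      refine Submodule.sub_mem _ hc ?_
      have := domDiff_mem he₁
      rwa [add_sub_cancel_right] at this
    obtain ⟨γ, hγ, hγ'⟩ := exists_sub_mem_constant hn hr k _
      (mem_inter_domGr (mem_of_subMap_rowChain_eq_zero hA) hg1) hd1
    refine ⟨e₁ + γ, Submodule.add_mem _ he₁ (mem_supported_of_subset hγ (fun s hs => hs.2)), ?_⟩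
    -- what is left is a multiple of a constant domain, and `constCount` detects the multiple
    let s₀ : Dom n := ⟨Fin.revPerm, Fin.revPerm, 0,
      fun i j => by simp [cornerCoeff, alphaBoundary], fun i j => le_rfl⟩
    have hsingle : c - domDiff e₁ - domDiff γ ∈
        Finsupp.supported (ZMod 2) (ZMod 2) ({s₀} : Set (Dom n)) :=
      mem_supported_of_subset hγ' (fun s hs => Dom.ext hs.1.1 hs.1.2.1 hs.1.2.2)
    rw [Finsupp.supported_eq_span_single, Set.image_singleton,
      Submodule.mem_span_singleton] at hsingle
    obtain ⟨a, ha⟩ := hsingle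
    have h0 : constCount (a • Finsupp.single s₀ (1 : ZMod 2)) = 0 := by
      rw [ha, map_sub, map_sub, constCount_domDiff, constCount_domDiff, ← rowCount_zero r, hχ]
      simp
    rw [map_smul, single_dom, constCount_domOrZero, if_pos ⟨rfl, rfl⟩, smul_eq_mul, mul_one] at h0
    rw [h0, zero_smul] at ha
    rw [map_add, ← sub_eq_zero, ← neg_eq_zero, ha]
    abel

/-- A cycle in degree `2 m` on which exactly the count `rowCount r m` is nonzero.  The next cycle is found
by adding the row `r` and correcting by a domain on which this row is not full. -/
theorem exists_cycle (hn : 2 ≤ n) {r : Fin n} (hr : (r : ℕ) + 1 = n) (m : ℕ) :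
    ∃ z ∈ domGr n (2 * m : ℕ), domDiff z = 0 ∧
      ∀ m', rowCount r m' z = if m' = m then 1 else 0 := by
  have hH := isPeriodic_rowChain (n := n) r
  have hdd : ∀ c : DomChains n, domDiff (domDiff c) = 0 := LinearMap.congr_fun (domDiff_sq hn)
  induction m with
  | zero =>
    let s₀ : Dom n := ⟨Fin.revPerm, Fin.revPerm, 0,
      fun i j => by simp [cornerCoeff, alphaBoundary], fun i j => le_rfl⟩
    have hs : Finsupp.single s₀ (1 : ZMod 2) ∈ domGr n ((2 * 0 : ℕ) : ℚ) :=
      Finsupp.single_mem_supported _ _ (by simpa using deg_eq_zero (s := s₀) rfl)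
    refine ⟨Finsupp.single s₀ 1, hs, ?_, fun m' => ?_⟩
    · have := domDiff_mem hs
      rwa [domGr_eq_bot (by norm_num)] at this
    · split_ifs with h
      · rw [h, rowCount_zero, single_dom, constCount_domOrZero, if_pos ⟨rfl, rfl⟩]
      · refine rowCount_eq_zero r m' (fun h' => h ?_) hs
        have : (2 * 0 : ℕ) = 2 * m' := by exact_mod_cast h'
        omega
  | succ m ih =>
    obtain ⟨z, hz, hdz, hχ⟩ := ih
    have hw := addMap_mem hH (maslov_rowChain · r) hz
    have hdw := domDiff_mem hw
    have hA : subMap (rowChain r) (domDiff (addMap (rowChain r) z)) = 0 := by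
      rw [subMap_rowChain_domDiff, subMap_addMap hH, hdz]
    obtain ⟨γ, hγ, hγ'⟩ := exists_sub_mem_constant hn hr _ _
      (mem_inter_domGr (mem_of_subMap_rowChain_eq_zero hA) hdw) (hdd _)
    -- the constant domains have degree zero, so that nothing is left in odd degrees
    have h0 : domDiff (addMap (rowChain r) z) - domDiff γ = 0 := by
      rw [Set.eq_empty_of_forall_notMem (s := {s : Dom n | _}), Finsupp.supported_empty] at hγ'
      · exact hγ'
      · rintro s ⟨⟨-, -, hD⟩, hdeg⟩
        rw [deg_eq_zero hD] at hdeg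
        have : (0 : ℚ) ≤ (2 * m : ℕ) := Nat.cast_nonneg _
        linarith
    have hmem : addMap (rowChain r) z - γ ∈ domGr n ((2 * (m + 1) : ℕ) : ℚ) := by
      have e : (((2 * (m + 1) : ℕ)) : ℚ) = (2 * m : ℕ) + 2 := by push_cast; ring
      rw [e]
      refine Submodule.sub_mem _ hw (mem_supported_of_subset hγ (fun s hs => ?_))
      exact hs.2.trans (by ring)
    refine ⟨addMap (rowChain r) z - γ, hmem, by rw [map_sub, h0], fun m' => ?_⟩
    obtain _ | m' := m'
    · rw [if_neg (by omega)]
      refine rowCount_eq_zero r 0 (fun h => ?_) hmem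
      have : 2 * (m + 1) = 2 * 0 := by exact_mod_cast h
      omega
    · rw [rowCount_succ, map_sub, subMap_addMap hH,
        subMap_rowChain_eq_zero (mem_supported_of_subset hγ (fun s hs => hs.1)), sub_zero, hχ]
      exact if_congr (by omega) rfl rfl

end DomHomology

/-! ### Operators that act on one component of a basis -/

section Slot
variable {S A B : Type*}

/-- A component, with values in `A`, of the elements of `S`: it can be read and overwritten.  The span of
`S` is then a tensor product with a factor spanned by `A`, and operators on this factor extend to it. -/
structure Slot (S A : Type*) where
  get : S → A
  set : A → S → S
  get_set : ∀ a s, get (set a s) = a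
  set_get : ∀ s, set (get s) s = s
  set_set : ∀ a b s, set a (set b s) = set a s

theorem single_lin_ext {V : Type*} [AddCommMonoid V] [Module (ZMod 2) V]
    {f g : (S →₀ ZMod 2) →ₗ[ZMod 2] V}
    (h : ∀ s, f (Finsupp.single s 1) = g (Finsupp.single s 1)) : f = g :=
  Finsupp.lhom_ext' fun s => LinearMap.ext_ring (h s)

namespace Slot

/-- The elements that agree with `s` off the slot, as the span of the values in the slot. -/
def fill (L : Slot S A) (s : S) : (A →₀ ZMod 2) →ₗ[ZMod 2] (S →₀ ZMod 2) :=
  Finsupp.lmapDomain (ZMod 2) (ZMod 2) fun a => L.set a s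

theorem fill_single (L : Slot S A) (s : S) (a : A) :
    L.fill s (Finsupp.single a 1) = Finsupp.single (L.set a s) 1 := by
  rw [fill, Finsupp.lmapDomain_apply, Finsupp.mapDomain_single]

theorem fill_get (L : Slot S A) (s : S) :
    L.fill s (Finsupp.single (L.get s) 1) = Finsupp.single s 1 := by
  rw [fill_single, L.set_get]

theorem fill_set (L : Slot S A) (s : S) (a : A) : L.fill (L.set a s) = L.fill s := by
  simp only [fill, L.set_set]

/-- The action of an operator in a slot. -/
def opLin (L : Slot S A) (f : Module.End (ZMod 2) (A →₀ ZMod 2)) :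
    Module.End (ZMod 2) (S →₀ ZMod 2) :=
  Finsupp.linearCombination _ fun s => L.fill s (f (Finsupp.single (L.get s) 1))

theorem opLin_single (L : Slot S A) (f : Module.End (ZMod 2) (A →₀ ZMod 2)) (s : S) :
    L.opLin f (Finsupp.single s 1) = L.fill s (f (Finsupp.single (L.get s) 1)) := by
  rw [opLin, Finsupp.linearCombination_single, one_smul]

theorem opLin_fill (L : Slot S A) (f : Module.End (ZMod 2) (A →₀ ZMod 2)) (s : S)
    (u : A →₀ ZMod 2) : L.opLin f (L.fill s u) = L.fill s (f u) := by
  suffices h : L.opLin f ∘ₗ L.fill s = L.fill s ∘ₗ f from LinearMap.congr_fun h u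
  refine single_lin_ext fun a => ?_
  rw [LinearMap.comp_apply, LinearMap.comp_apply, fill_single, opLin_single, L.get_set, L.fill_set]

/-- The action of the operators in a slot, as a ring homomorphism. -/
def op (L : Slot S A) :
    Module.End (ZMod 2) (A →₀ ZMod 2) →+* Module.End (ZMod 2) (S →₀ ZMod 2) where
  toFun := L.opLin
  map_one' := single_lin_ext fun s => by
    rw [opLin_single, Module.End.one_apply, fill_get, Module.End.one_apply]
  map_mul' f g := single_lin_ext fun s => by
    rw [opLin_single, Module.End.mul_apply, Module.End.mul_apply, opLin_single, opLin_fill]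
  map_zero' := single_lin_ext fun s => by
    rw [opLin_single, LinearMap.zero_apply, map_zero, LinearMap.zero_apply]
  map_add' f g := single_lin_ext fun s => by
    rw [opLin_single, LinearMap.add_apply, map_add, LinearMap.add_apply, opLin_single, opLin_single]

theorem op_single (L : Slot S A) (f : Module.End (ZMod 2) (A →₀ ZMod 2)) (s : S) :
    L.op f (Finsupp.single s 1) = L.fill s (f (Finsupp.single (L.get s) 1)) := L.opLin_single f s

/-- Overwriting one of the slots commutes with overwriting the other. -/
def Indep (L : Slot S A) (M : Slot S B) : Prop :=
  ∀ a b s, L.set a (M.set b s) = M.set b (L.set a s)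

variable {L : Slot S A} {M : Slot S B}

theorem Indep.symm (h : L.Indep M) : M.Indep L := fun b a s => (h a b s).symm

theorem Indep.get_set (h : L.Indep M) (b : B) (s : S) : L.get (M.set b s) = L.get s := by
  conv_lhs => rw [← L.set_get s, ← h, L.get_set]

/-- Operators in independent slots commute. -/
theorem Indep.commute (h : L.Indep M) (f : Module.End (ZMod 2) (A →₀ ZMod 2))
    (g : Module.End (ZMod 2) (B →₀ ZMod 2)) : Commute (L.op f) (M.op g) := by
  -- both composites are the image of `u ⊗ v` under the map that overwrites both slots
  have key : ∀ (s : S) (u : A →₀ ZMod 2) (v : B →₀ ZMod 2),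
      Finsupp.linearCombination (ZMod 2) (fun b => L.fill (M.set b s) u) v =
        Finsupp.linearCombination (ZMod 2) (fun a => M.fill (L.set a s) v) u := by
    intro s u v
    induction u using Finsupp.induction_linear with
    | zero => simp [Finsupp.linearCombination_apply]
    | add u₁ u₂ h1 h2 =>
      rw [map_add, ← h1, ← h2]
      simp only [map_add]
      simp [Finsupp.linearCombination_apply, Finsupp.sum_add, smul_add]
    | single a x =>
      rw [Finsupp.linearCombination_single]
      induction v using Finsupp.induction_linear with
      | zero => simp
      | add v₁ v₂ h1 h2 => rw [map_add, h1, h2, map_add, smul_add]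
      | single b y =>
        simp only [Finsupp.linearCombination_single, fill, Finsupp.lmapDomain_apply,
          Finsupp.mapDomain_single, Finsupp.smul_single, smul_eq_mul, h a b s, mul_comm]
  refine single_lin_ext fun s => ?_
  have h1 : ∀ v, L.op f (M.fill s v) = Finsupp.linearCombination (ZMod 2)
      (fun b => L.fill (M.set b s) (f (Finsupp.single (L.get s) 1))) v := by
    intro v
    suffices e : L.op f ∘ₗ M.fill s = Finsupp.linearCombination (ZMod 2)
        (fun b => L.fill (M.set b s) (f (Finsupp.single (L.get s) 1))) from LinearMap.congr_fun e v
    refine single_lin_ext fun b => ?_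
    rw [LinearMap.comp_apply, fill_single, op_single, h.get_set, Finsupp.linearCombination_single,
      one_smul]
  have h2 : ∀ u, M.op g (L.fill s u) = Finsupp.linearCombination (ZMod 2)
      (fun a => M.fill (L.set a s) (g (Finsupp.single (M.get s) 1))) u := by
    intro u
    suffices e : M.op g ∘ₗ L.fill s = Finsupp.linearCombination (ZMod 2)
        (fun a => M.fill (L.set a s) (g (Finsupp.single (M.get s) 1))) from LinearMap.congr_fun e u
    refine single_lin_ext fun a => ?_
    rw [LinearMap.comp_apply, fill_single, op_single, h.symm.get_set,
      Finsupp.linearCombination_single, one_smul]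
  rw [Module.End.mul_apply, Module.End.mul_apply, op_single, op_single, h1, h2, key]

end Slot

/-- `X` shifts the degree by `r`. -/
def Shifts (deg : S → ℚ) (r : ℚ) (X : Module.End (ZMod 2) (S →₀ ZMod 2)) : Prop :=
  ∀ s, X (Finsupp.single s 1) ∈ Finsupp.supported (ZMod 2) (ZMod 2) {t | deg t = deg s + r}

namespace Shifts
variable {deg : S → ℚ} {r q : ℚ} {X Y : Module.End (ZMod 2) (S →₀ ZMod 2)}

theorem apply_mem (h : Shifts deg r X) {k : ℚ} {c : S →₀ ZMod 2}
    (hc : c ∈ Finsupp.supported (ZMod 2) (ZMod 2) {s | deg s = k}) :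
    X c ∈ Finsupp.supported (ZMod 2) (ZMod 2) {s | deg s = k + r} := by
  refine map_mem_of_supported X _ _ (fun s hs => ?_) hc
  have := h s
  rwa [show deg s = k from hs] at this

theorem mul (h : Shifts deg r X) (h' : Shifts deg q Y) : Shifts deg (q + r) (X * Y) := fun s => by
  have := h.apply_mem (h' s)
  rwa [add_assoc] at this

theorem add (h : Shifts deg r X) (h' : Shifts deg r Y) : Shifts deg r (X + Y) := fun s =>
  Submodule.add_mem _ (h s) (h' s)

theorem zero : Shifts deg r 0 := fun _ => Submodule.zero_mem _

theorem one : Shifts deg 0 1 := fun s =>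
  Finsupp.single_mem_supported _ _ (add_zero (deg s)).symm

theorem sum {ι : Type*} {s : Finset ι} {X : ι → Module.End (ZMod 2) (S →₀ ZMod 2)}
    (h : ∀ i ∈ s, Shifts deg r (X i)) : Shifts deg r (∑ i ∈ s, X i) := by
  classical
  induction s using Finset.induction_on with
  | empty => exact zero
  | insert i s hi ih =>
    rw [Finset.sum_insert hi]
    exact (h i (Finset.mem_insert_self _ _)).add (ih fun j hj => h j (Finset.mem_insert_of_mem hj))

theorem slot_op (L : Slot S A) {degA : A → ℚ}
    (hdeg : ∀ a s, deg (L.set a s) = deg s - degA (L.get s) + degA a)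
    {f : Module.End (ZMod 2) (A →₀ ZMod 2)} (h : Shifts degA r f) : Shifts deg r (L.op f) := by
  intro s
  rw [L.op_single]
  refine map_mem_of_supported _ _ _ (fun a ha => ?_) (h (L.get s))
  rw [L.fill_single]
  refine Finsupp.single_mem_supported _ _ ?_
  change deg _ = _
  rw [hdeg, show degA a = degA (L.get s) + r from ha]
  ring

end Shifts

end Slot

/-! ### Gauge transformations in a ring of characteristic two -/

section Gauge
variable {R : Type*} [Ring R]

theorem gauge_sq (h2 : ∀ x : R, x + x = 0) {e h : R} (he : e * e = 0) (heh : Commute e h) :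
    (1 + e * h) * (1 + e * h) = 1 := by
  have h1 : e * h * (e * h) = 0 := by
    rw [mul_assoc, ← mul_assoc h, ← heh.eq, mul_assoc e, ← mul_assoc e e, he, zero_mul]
  rw [add_mul, one_mul, mul_add, mul_one, h1, add_zero, add_assoc, h2, add_zero]

/-- If `h` is a homotopy for `d` between `A` and `0`, then `1 + e h` conjugates `d` into `d + e A`. -/
theorem gauge_mul (h2 : ∀ x : R, x + x = 0) {d e h A : R} (he : e * e = 0)
    (hed : Commute e d) (heA : Commute e A) (hA : d * h + h * d = A) :
    (1 + e * h) * d = (d + e * A) * (1 + e * h) := by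
  have h1 : e * A * (e * h) = 0 := by
    rw [mul_assoc, ← mul_assoc A, ← heA.eq, mul_assoc e, ← mul_assoc e e, he, zero_mul]
  have h3 : d * (e * h) = e * (d * h) := by rw [← mul_assoc, ← hed.eq, mul_assoc]
  rw [add_mul, one_mul, mul_add, mul_one, add_mul d, h1, add_zero, h3, ← hA, mul_add, add_assoc,
    mul_assoc]
  congr 1
  rw [add_assoc, add_comm _ (e * (d * h)), add_left_comm, ← add_assoc, h2, zero_add]

theorem sum_sq_eq_zero {ι : Type*} (h2 : ∀ x : R, x + x = 0) (s : Finset ι) (p : ι → R)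
    (hp : ∀ i, p i * p i = 0) (hc : ∀ i j, Commute (p i) (p j)) :
    (∑ i ∈ s, p i) * ∑ i ∈ s, p i = 0 := by
  classical
  induction s using Finset.induction_on with
  | empty => simp
  | insert i s hi ih =>
    have h : (∑ j ∈ s, p j) * p i = p i * ∑ j ∈ s, p j :=
      (Commute.sum_left s p (p i) fun j _ => hc j i).eq
    rw [Finset.sum_insert hi, add_mul, mul_add, mul_add, hp, ih, h, zero_add, add_zero, h2]

end Gauge

/-! ### Degrees of the operators on partitions -/

section PartDegrees

/-- The length of an ordered partition as a degree. -/
def lenDeg (p : OrdPartition) : ℚ := p.length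

theorem listChain_mem {l : List OrdPartition} {P : Set OrdPartition} (h : ∀ p ∈ l, p ∈ P) :
    listChain l ∈ Finsupp.supported (ZMod 2) (ZMod 2) P := by
  refine list_sum_mem fun x hx => ?_
  obtain ⟨p, hp, rfl⟩ := List.mem_map.1 hx
  exact Finsupp.single_mem_supported _ _ (h p hp)

theorem length_elemCoarsenings : ∀ {p q : OrdPartition}, q ∈ elemCoarsenings p →
    q.length + 1 = p.length
  | [], _, h => by simp [elemCoarsenings] at h
  | [_], _, h => by simp [elemCoarsenings] at h
  | a :: b :: p, q, h => by
    rw [elemCoarsenings, List.mem_cons, List.mem_map] at h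
    obtain rfl | ⟨t, ht, rfl⟩ := h
    · rfl
    · rw [List.length_cons, length_elemCoarsenings ht, List.length_cons (as := b :: p)]

theorem shifts_partDiff : Shifts lenDeg (-1) partDiff := by
  have key : ∀ p q : OrdPartition, q.length + 1 = p.length →
      q ∈ {t | lenDeg t = lenDeg p + -1} := fun p q h => by
    change (q.length : ℚ) = p.length + -1
    rw [← h]; push_cast; ring
  intro p
  simp only [partDiff, mergeMap, dropFirstMap, LinearMap.add_apply,
    Finsupp.linearCombination_single, one_smul]
  refine Submodule.add_mem _ (Submodule.add_mem _ (listChain_mem fun q hq => ?_)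
    (listChain_mem fun q hq => ?_)) (listChain_mem fun q hq => ?_)
  · exact key p q (length_elemCoarsenings hq)
  · refine key p q ?_
    cases p with
    | nil => simp [finalReductions] at hq
    | cons a p => simp only [finalReductions, List.mem_singleton] at hq; simp [hq]
  · refine key p q ?_
    cases p with
    | nil => simp [initialReductions] at hq
    | cons a p => simp only [initialReductions, List.mem_singleton] at hq; simp [hq]

theorem shifts_enlargeMap : Shifts lenDeg 1 enlargeMap := by
  intro p
  rw [enlargeMap, Finsupp.linearCombination_single, one_smul]
  refine listChain_mem fun q hq => ?_
  simp only [unitEnlargements, List.mem_map, List.mem_range] at hq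
  obtain ⟨k, hk, rfl⟩ := hq
  have : (p.take k ++ 1 :: p.drop k).length = p.length + 1 := by
    simp only [List.length_append, List.length_take, List.length_cons, List.length_drop]; omega
  change (((p.take k ++ 1 :: p.drop k).length : ℕ) : ℚ) = p.length + 1
  rw [this]; push_cast; ring

theorem shifts_partHomotopy : Shifts lenDeg 1 partHomotopy := by
  rintro (_ | ⟨a, p⟩)
  · rw [partHomotopy_nil]; exact Submodule.zero_mem _
  · rw [partHomotopy_cons]
    refine Submodule.sum_mem _ fun b _ => Finsupp.single_mem_supported _ _ ?_
    change (((1 :: b :: p : OrdPartition).length : ℕ) : ℚ) = ((a :: p : OrdPartition).length : ℕ) + 1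
    simp

theorem partProj_mem (p : OrdPartition) : partProj (Finsupp.single p 1) ∈
    Finsupp.supported (ZMod 2) (ZMod 2) ({[], [1]} : Set OrdPartition) := by
  rw [partProj, Finsupp.linearCombination_single, one_smul]
  split
  · exact Finsupp.single_mem_supported _ _ (Or.inl rfl)
  · exact Submodule.smul_mem _ _ (Finsupp.single_mem_supported _ _ (Or.inr rfl))
  · exact Submodule.zero_mem _

theorem partProj_single {p : OrdPartition} (hp : p ∈ ({[], [1]} : Set OrdPartition)) :
    partProj (Finsupp.single p 1) = Finsupp.single p 1 := by
  obtain rfl | rfl := hp <;> simp [partProj]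

theorem partDiff_single {p : OrdPartition} (hp : p ∈ ({[], [1]} : Set OrdPartition)) :
    partDiff (Finsupp.single p 1) = 0 := by
  obtain rfl | rfl := hp
  · simp [partDiff]
  · simp [partDiff, ZModModule.add_self]

end PartDegrees

/-! ### The complex as a tensor product -/

section Tensor
variable {n : ℕ}

/-- The domain of a triple. -/
def domSlot : Slot (Triple n) (Dom n) where
  get T := ⟨T.x, T.y, T.D, T.isPos⟩
  set s T := ⟨s.x, s.y, s.D, s.isPos, T.part⟩
  get_set _ _ := rfl
  set_get _ := rfl
  set_set _ _ _ := rfl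

/-- The `j`-th partition of a triple. -/
def partSlot (j : Fin n) : Slot (Triple n) OrdPartition where
  get T := T.part j
  set p T := T.setPart j p
  get_set p T := Function.update_self _ _ _
  set_get T := by simp [Triple.setPart]
  set_set p q T := by simp [Triple.setPart]

theorem indep_domSlot (j : Fin n) : domSlot.Indep (partSlot j) := fun _ _ _ => rfl

theorem indep_partSlot {i j : Fin n} (h : i ≠ j) : (partSlot i).Indep (partSlot j) :=
  fun p q T => by
    simp only [partSlot, Triple.setPart]
    rw [Function.update_comm h]

/-- The ring of linear endomorphisms of `Chains n`. -/
abbrev Ops (n : ℕ) : Type := Module.End (ZMod 2) (Chains n)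

theorem add_self_ops (X : Ops n) : X + X = 0 := linearMap_add_self X

theorem commute_dom_part (f : Module.End (ZMod 2) (DomChains n)) (j : Fin n)
    (g : Module.End (ZMod 2) PartChains) : Commute (domSlot.op f) ((partSlot j).op g) :=
  (indep_domSlot j).commute f g

theorem commute_part_part {i j : Fin n} (f g : Module.End (ZMod 2) PartChains)
    (h : i = j → Commute f g) : Commute ((partSlot i).op f) ((partSlot j).op g) := by
  by_cases hij : i = j
  · subst hij
    exact (h rfl).map (partSlot i).op
  · exact (indep_partSlot hij).commute f g

theorem grading_domSlot (s : Dom n) (T : Triple n) :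
    (domSlot.set s T).grading = T.grading - (domSlot.get T).deg + s.deg := by
  simp only [domSlot, Triple.grading, Triple.totalLength, Dom.deg]; ring

theorem grading_partSlot (j : Fin n) (p : OrdPartition) (T : Triple n) :
    ((partSlot j).set p T).grading = T.grading - lenDeg ((partSlot j).get T) + lenDeg p := by
  have h : ((T.setPart j p).totalLength : ℚ) = T.totalLength - (T.part j).length + p.length := by
    simp only [Triple.totalLength, Triple.setPart]
    rw [← Finset.add_sum_erase _ _ (Finset.mem_univ j),
      ← Finset.add_sum_erase _ (fun i => (T.part i).length) (Finset.mem_univ j),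
      Function.update_self, Finset.sum_congr rfl fun i hi => by
        rw [Function.update_of_ne (Finset.ne_of_mem_erase hi)]]
    push_cast; ring
  simp only [partSlot, Triple.grading, lenDeg]
  rw [h]
  simp only [Triple.setPart]
  ring

theorem shifts_domSlot {f : Module.End (ZMod 2) (DomChains n)} {r : ℚ}
    (h : Shifts Dom.deg r f) : Shifts Triple.grading r (domSlot.op f) :=
  Shifts.slot_op _ grading_domSlot h

theorem shifts_partSlot (j : Fin n) {f : Module.End (ZMod 2) PartChains} {r : ℚ}
    (h : Shifts lenDeg r f) : Shifts Triple.grading r ((partSlot j).op f) :=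
  Shifts.slot_op _ (grading_partSlot j) h

theorem single_mem_domGr (s : Dom n) : Finsupp.single s (1 : ZMod 2) ∈ domGr n s.deg :=
  Finsupp.single_mem_supported _ _ rfl

theorem shifts_domDiff : Shifts (Dom.deg (n := n)) (-1) domDiff := fun s => by
  have := domDiff_mem (single_mem_domGr s)
  rwa [sub_eq_add_neg] at this

theorem shifts_capMap (i j : Fin n) : Shifts (Dom.deg (n := n)) (-1) (capMap i j) := fun s => by
  have := leftMap_mem (fun P => ((P i j : ℤ) : ZMod 2)) (single_mem_domGr s)
  rwa [sub_eq_add_neg] at this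

/-- The operator that takes out the annuli through the marking `O_j`. -/
def annulusMap (G : GridDiagram n) (j : Fin n) : Module.End (ZMod 2) (DomChains n) :=
  subMap (rowChain (G.oRow j)) + subMap (colChain (G.oCol j))

theorem shifts_annulusMap (G : GridDiagram n) (j : Fin n) :
    Shifts (Dom.deg (n := n)) (-2) (annulusMap G j) := fun s => by
  have h1 := subMap_mem (isPeriodic_rowChain (G.oRow j)) (maslov_rowChain · _) (single_mem_domGr s)
  have h2 := subMap_mem (isPeriodic_colChain (G.oCol j)) (maslov_colChain · _) (single_mem_domGr s)
  rw [sub_eq_add_neg] at h1 h2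
  exact Submodule.add_mem _ h1 h2

/-- The tensor product differential, without the interaction of domains and partitions. -/
def freeDiff (n : ℕ) : Ops n := domSlot.op domDiff + ∑ j, (partSlot j).op partDiff

theorem shifts_freeDiff : Shifts (Triple.grading (n := n)) (-1) (freeDiff n) :=
  (shifts_domSlot shifts_domDiff).add (Shifts.sum fun j _ => shifts_partSlot j shifts_partDiff)

theorem freeDiff_sq (hn : 2 ≤ n) : freeDiff n * freeDiff n = 0 := by
  have hd : domSlot.op domDiff * domSlot.op (domDiff (n := n)) = 0 := by
    rw [← map_mul, show domDiff (n := n) * domDiff = 0 from domDiff_sq hn, map_zero]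
  have hp : (∑ j : Fin n, (partSlot j).op partDiff) * ∑ j : Fin n, (partSlot j).op partDiff = 0 :=
    sum_sq_eq_zero add_self_ops _ _
      (fun j => by
        rw [← map_mul, show partDiff * partDiff = 0 from partDiff_comp_partDiff, map_zero])
      fun i j => commute_part_part _ _ fun _ => Commute.refl _
  have hc : (∑ j : Fin n, (partSlot j).op partDiff) * domSlot.op domDiff =
      domSlot.op domDiff * ∑ j : Fin n, (partSlot j).op partDiff :=
    (Commute.sum_right _ _ _ fun j _ => commute_dom_part domDiff j partDiff).eq.symm
  rw [freeDiff, add_mul, mul_add, mul_add, hd, hp, hc, zero_add, add_zero, add_self_ops]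

/-- A chain of domains, provided with the tuple of partitions `p`. -/
def withPart (p : Fin n → OrdPartition) : DomChains n →ₗ[ZMod 2] Chains n :=
  Finsupp.lmapDomain (ZMod 2) (ZMod 2) fun s => ⟨s.x, s.y, s.D, s.isPos, p⟩

theorem withPart_single (p : Fin n → OrdPartition) (s : Dom n) :
    withPart p (Finsupp.single s 1) = Finsupp.single ⟨s.x, s.y, s.D, s.isPos, p⟩ 1 := by
  rw [withPart, Finsupp.lmapDomain_apply, Finsupp.mapDomain_single]

theorem withPart_domOrZero (p : Fin n → OrdPartition) (x y : State n) (E : TwoChain n) :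
    withPart p (domOrZero x y E) = basisOrZero x y E p := by
  by_cases h : IsPosDomain x y E
  · rw [domOrZero_of_pos h, withPart_single, basisOrZero, dif_pos h]
  · rw [domOrZero_of_not_pos h, map_zero, basisOrZero, dif_neg h]

theorem domSlot_withPart (f : Module.End (ZMod 2) (DomChains n)) (p : Fin n → OrdPartition)
    (c : DomChains n) : domSlot.op f (withPart p c) = withPart p (f c) := by
  suffices h : domSlot.op f ∘ₗ withPart p = withPart p ∘ₗ f from LinearMap.congr_fun h c
  refine single_lin_ext fun s => ?_
  rw [LinearMap.comp_apply, LinearMap.comp_apply, withPart_single, Slot.op_single]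
  rfl

theorem single_triple (T : Triple n) :
    (Finsupp.single T 1 : Chains n) = withPart T.part (domOrZero T.x T.y T.D) := by
  rw [domOrZero_of_pos T.isPos, withPart_single]

theorem partSlot_withPart (j : Fin n) {f : Module.End (ZMod 2) PartChains}
    {p : Fin n → OrdPartition} {l : List OrdPartition}
    (h : f (Finsupp.single (p j) 1) = listChain l) (c : DomChains n) :
    (partSlot j).op f (withPart p c) = (l.map fun q => withPart (Function.update p j q) c).sum := by
  induction c using Finsupp.induction_linear with
  | zero => simp
  | add c₁ c₂ h1 h2 =>
    simp only [map_add, h1, h2, List.sum_map_add]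
  | single s a =>
    have hs : (Finsupp.single s a : DomChains n) = a • Finsupp.single s 1 := by simp
    have hl : ∀ l : List OrdPartition, (partSlot j).fill ⟨s.x, s.y, s.D, s.isPos, p⟩ (listChain l) =
        (l.map fun q => withPart (Function.update p j q) (Finsupp.single s 1)).sum := by
      intro l
      induction l with
      | nil => simp [listChain]
      | cons q l ih =>
        simp only [listChain, List.map_cons, List.sum_cons, map_add] at ih ⊢
        rw [ih, Slot.fill_single, withPart_single]
        rfl
    rw [hs]
    simp only [map_smul]
    rw [withPart_single, Slot.op_single, show (partSlot j).get _ = p j from rfl, h, hl,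
      List.smul_sum, List.map_map]
    rfl

/-- The differential in terms of operators on the factors of the tensor product. -/
theorem diff_eq (G : GridDiagram n) : diff G = freeDiff n +
    ∑ j, (partSlot j).op enlargeMap * domSlot.op (annulusMap G j) := by
  classical
  refine single_lin_ext fun T => ?_
  rw [diff, Finsupp.linearCombination_single, one_smul, freeDiff, LinearMap.add_apply,
    LinearMap.add_apply, LinearMap.sum_apply, LinearMap.sum_apply]
  have h1 : domSlot.op domDiff (Finsupp.single T 1 : Chains n) = diffI T := by
    rw [single_triple, domSlot_withPart, domDiff, LinearMap.add_apply, leftMap_domOrZero,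
      rightMap_domOrZero, map_add, diffI]
    simp only [map_sum, apply_ite (withPart T.part), map_zero, one_smul, withPart_domOrZero]
  have h2 : ∑ j, ((partSlot j).op enlargeMap * domSlot.op (annulusMap G j))
      (Finsupp.single T 1 : Chains n) = diffII G T := by
    refine Finset.sum_congr rfl fun j _ => ?_
    rw [single_triple, Module.End.mul_apply, domSlot_withPart, annulusMap, LinearMap.add_apply,
      subMap_domOrZero (isPeriodic_rowChain _), subMap_domOrZero (isPeriodic_colChain _),
      partSlot_withPart j (l := unitEnlargements (T.part j))
        (by rw [enlargeMap, Finsupp.linearCombination_single, one_smul])]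
    simp only [map_add, withPart_domOrZero]
    rfl
  have h3 : ∑ j, (partSlot j).op partDiff (Finsupp.single T 1 : Chains n) =
      diffIII T + diffIV T := by
    have e : ∀ j, (partSlot j).op partDiff (Finsupp.single T 1 : Chains n) =
        ((elemCoarsenings (T.part j)).map fun p =>
          (Finsupp.single (T.setPart j p) 1 : Chains n)).sum +
        (((initialReductions (T.part j)).map fun p =>
          (Finsupp.single (T.setPart j p) 1 : Chains n)).sum +
        ((finalReductions (T.part j)).map fun p =>
          (Finsupp.single (T.setPart j p) 1 : Chains n)).sum) := by
      intro j
      rw [single_triple, partSlot_withPart j (l := elemCoarsenings (T.part j) ++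
        (initialReductions (T.part j) ++ finalReductions (T.part j)))]
      · simp only [List.map_append, List.sum_append, domOrZero_of_pos T.isPos, withPart_single]
        rfl
      · simp only [partDiff, mergeMap, dropFirstMap, LinearMap.add_apply,
          Finsupp.linearCombination_single, one_smul, listChain, List.map_append, List.sum_append]
        abel
    simp only [e, Finset.sum_add_distrib, diffIII, diffIV]
  rw [h1, h2, h3]
  abel

end Tensor

/-! ### Removing the interaction and contracting the partitions -/

section Reduction
variable {n : ℕ}

/-- The operator that exchanges a rectangle through `O_j` at the start for an entry `1`. -/
def exchange (G : GridDiagram n) (j : Fin n) : Ops n :=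
  (partSlot j).op enlargeMap * domSlot.op (capMap (G.oCol j) (G.oRow j))

theorem enlarge_sq (j : Fin n) :
    (partSlot j).op enlargeMap * (partSlot j).op enlargeMap = (0 : Ops n) := by
  rw [← map_mul, show enlargeMap * enlargeMap = 0 from enlargeMap_comp_enlargeMap, map_zero]

theorem commute_enlarge_freeDiff (j : Fin n) : Commute ((partSlot j).op enlargeMap) (freeDiff n) :=
  (commute_dom_part _ _ _).symm.add_right (Commute.sum_right _ _ _ fun _ _ =>
    commute_part_part _ _ fun _ => (show Commute partDiff enlargeMap from
      partDiff_enlargeMap_comm).symm)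

/-- The interaction through `O_j` is null-homotopic on the factor of the domains. -/
theorem freeDiff_capMap (hn : 2 ≤ n) (G : GridDiagram n) (j : Fin n) :
    freeDiff n * domSlot.op (capMap (G.oCol j) (G.oRow j)) +
      domSlot.op (capMap (G.oCol j) (G.oRow j)) * freeDiff n = domSlot.op (annulusMap G j) := by
  have h : (∑ i : Fin n, (partSlot i).op partDiff) * domSlot.op (capMap (G.oCol j) (G.oRow j)) =
      domSlot.op (capMap (G.oCol j) (G.oRow j)) * ∑ i : Fin n, (partSlot i).op partDiff :=
    (Commute.sum_right _ _ _ fun i _ => commute_dom_part _ i partDiff).eq.symm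
  have h2 : domDiff * capMap (G.oCol j) (G.oRow j) + capMap (G.oCol j) (G.oRow j) * domDiff =
      annulusMap G j := domDiff_capMap hn _ _
  rw [freeDiff, add_mul, mul_add, h, add_add_add_comm, add_self_ops, add_zero, ← map_mul, ← map_mul,
    ← map_add, h2]

theorem commute_annulus_cap (G : GridDiagram n) (i j : Fin n) :
    Commute (annulusMap G i) (capMap (G.oCol j) (G.oRow j)) :=
  Commute.add_left
    (show Commute _ _ from subMap_leftMap_comm (isPeriodic_rowChain _) _)
    (show Commute _ _ from subMap_leftMap_comm (isPeriodic_colChain _) _)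

theorem commute_interaction_exchange (G : GridDiagram n) (i j : Fin n) :
    Commute ((partSlot i).op enlargeMap * domSlot.op (annulusMap G i)) (exchange G j) :=
  Commute.mul_left
    (Commute.mul_right (commute_part_part _ _ fun _ => Commute.refl _)
      (commute_dom_part _ _ _).symm)
    (Commute.mul_right (commute_dom_part _ _ _) ((commute_annulus_cap G i j).map domSlot.op))

theorem shifts_exchange (G : GridDiagram n) (j : Fin n) :
    Shifts Triple.grading 0 (exchange G j) := by
  have := (shifts_partSlot j shifts_enlargeMap).mul (shifts_domSlot (shifts_capMap (G.oCol j) (G.oRow j)))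
  rwa [neg_add_cancel] at this

/-- An invertible operator of degree zero that conjugates the tensor product differential into one
with the interactions through the markings in `s`. -/
theorem exists_gauge (hn : 2 ≤ n) (G : GridDiagram n) (s : Finset (Fin n)) :
    ∃ Φ Ψ : Ops n, Φ * Ψ = 1 ∧ Ψ * Φ = 1 ∧ Shifts Triple.grading 0 Φ ∧ Shifts Triple.grading 0 Ψ ∧
      Φ * freeDiff n = (freeDiff n +
        ∑ j ∈ s, (partSlot j).op enlargeMap * domSlot.op (annulusMap G j)) * Φ := by
  induction s using Finset.induction_on with
  | empty => exact ⟨1, 1, one_mul 1, one_mul 1, Shifts.one, Shifts.one, by simp⟩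
  | insert j s hj ih =>
    obtain ⟨Φ, Ψ, h1, h2, h3, h4, h5⟩ := ih
    have hsq : (1 + exchange G j) * (1 + exchange G j) = 1 :=
      gauge_sq add_self_ops (enlarge_sq j) (commute_dom_part _ _ _).symm
    have hu : Shifts Triple.grading 0 (1 + exchange G j) := Shifts.one.add (shifts_exchange G j)
    have hg : (1 + exchange G j) * freeDiff n = (freeDiff n +
        (partSlot j).op enlargeMap * domSlot.op (annulusMap G j)) * (1 + exchange G j) :=
      gauge_mul add_self_ops (enlarge_sq j) (commute_enlarge_freeDiff j)
        (commute_dom_part _ _ _).symm (freeDiff_capMap hn G j)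
    have hc : (1 + exchange G j) *
        ∑ i ∈ s, (partSlot i).op enlargeMap * domSlot.op (annulusMap G i) =
        (∑ i ∈ s, (partSlot i).op enlargeMap * domSlot.op (annulusMap G i)) * (1 + exchange G j) :=
      ((Commute.one_left _).add_left (Commute.sum_right _ _ _ fun i _ =>
        (commute_interaction_exchange G i j).symm)).eq
    refine ⟨(1 + exchange G j) * Φ, Ψ * (1 + exchange G j), ?_, ?_, ?_, ?_, ?_⟩
    · rw [mul_assoc, ← mul_assoc Φ, h1, one_mul, hsq]
    · rw [mul_assoc, ← mul_assoc _ _ Φ, hsq, one_mul, h2]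
    · simpa using hu.mul h3
    · simpa using h4.mul hu
    · rw [mul_assoc, h5, ← mul_assoc, mul_add, hg, hc, ← add_mul, mul_assoc,
        Finset.sum_insert hj, add_assoc]

/-- The chains all of whose partitions are `∅` or `(1)` in the positions in `s`. -/
def reduced (s : Finset (Fin n)) : Submodule (ZMod 2) (Chains n) :=
  Finsupp.supported (ZMod 2) (ZMod 2) {T : Triple n | ∀ j ∈ s, T.part j ∈ ({[], [1]} : Set _)}

/-- A chain map `P` into the reduced chains, a homotopy `K` from the identity to it, and the chains that
`P` fixes: the product of the projections in the slots in `s`. -/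
theorem exists_contraction (hn : 2 ≤ n) (s : Finset (Fin n)) :
    ∃ P K : Ops n, P = 1 + (freeDiff n * K + K * freeDiff n) ∧ Shifts Triple.grading 0 P ∧
      Shifts Triple.grading 1 K ∧ (∀ c, P c ∈ reduced s) ∧
      ∀ p : Fin n → OrdPartition, (∀ j, p j ∈ ({[], [1]} : Set _)) → ∀ c : DomChains n,
        P (withPart p c) = withPart p c := by
  have hdd := freeDiff_sq hn
  induction s using Finset.induction_on with
  | empty =>
    refine ⟨1, 0, by simp, Shifts.one, Shifts.zero, fun c => ?_, fun p _ c => rfl⟩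
    rw [reduced, Finsupp.mem_supported]
    exact fun T _ j hj => absurd hj (Finset.notMem_empty j)
  | insert j s hj ih =>
    obtain ⟨P, K, h1, h2, h3, h4, h5⟩ := ih
    -- the differentials in the other slots commute with the homotopy in the slot `j`
    have hproj : (partSlot j).op partProj = 1 + (freeDiff n * (partSlot j).op partHomotopy +
        (partSlot j).op partHomotopy * freeDiff n) := by
      have e : (partSlot j).op partDiff * (partSlot j).op partHomotopy +
          (partSlot j).op partHomotopy * (partSlot j).op partDiff =
          (1 : Ops n) + (partSlot j).op partProj := by
        rw [← map_mul, ← map_mul, ← map_add, show partDiff * partHomotopy + partHomotopy * partDiff =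
          1 + partProj from partDiff_partHomotopy, map_add, map_one]
      have hc : Commute (domSlot.op domDiff + ∑ i ∈ Finset.univ.erase j, (partSlot i).op partDiff)
          ((partSlot j).op partHomotopy : Ops n) :=
        (commute_dom_part _ _ _).add_left (Commute.sum_left _ _ _ fun i hi =>
          commute_part_part _ _ fun h => absurd h (Finset.ne_of_mem_erase hi))
      have hd : freeDiff n = (partSlot j).op partDiff +
          (domSlot.op domDiff + ∑ i ∈ Finset.univ.erase j, (partSlot i).op partDiff) := by
        rw [freeDiff, ← Finset.add_sum_erase _ _ (Finset.mem_univ j)]; abel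
      rw [hd, add_mul, mul_add, hc.eq, add_add_add_comm, add_self_ops, add_zero, e, ← add_assoc,
        add_self_ops, zero_add]
    have hcomm : P * freeDiff n = freeDiff n * P := by
      rw [h1, add_mul, mul_add, add_mul, mul_add, one_mul, mul_one, mul_assoc K, hdd, mul_zero,
        add_zero, ← mul_assoc _ _ K, hdd, zero_mul, zero_add, mul_assoc]
    refine ⟨(partSlot j).op partProj * P, K + (partSlot j).op partHomotopy * P, ?_, ?_, ?_, ?_, ?_⟩
    · calc (partSlot j).op partProj * P
          = P + (freeDiff n * ((partSlot j).op partHomotopy * P) +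
              (partSlot j).op partHomotopy * (P * freeDiff n)) := by
            rw [hproj, add_mul, one_mul, add_mul (freeDiff n * _), mul_assoc, mul_assoc, hcomm]
        _ = 1 + (freeDiff n * K + K * freeDiff n) +
              (freeDiff n * ((partSlot j).op partHomotopy * P) +
              (partSlot j).op partHomotopy * (P * freeDiff n)) := congrArg (· + _) h1
        _ = _ := by
            rw [mul_add (freeDiff n), add_mul K, mul_assoc _ P]; abel
    · have hp : Shifts (Triple.grading (n := n)) 0 ((partSlot j).op partProj) := by
        have hη := shifts_partSlot (n := n) j shifts_partHomotopy
        have ha := shifts_freeDiff.mul hη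
        have hb := hη.mul shifts_freeDiff
        rw [add_neg_cancel] at ha
        rw [neg_add_cancel] at hb
        rw [hproj]
        exact Shifts.one.add (ha.add hb)
      simpa using hp.mul h2
    · have := (shifts_partSlot (n := n) j shifts_partHomotopy).mul h2
      rw [zero_add] at this
      exact h3.add this
    · intro c
      refine map_mem_of_supported ((partSlot j).op partProj) _ _ (fun T hT => ?_) (h4 c)
      rw [Slot.op_single]
      refine map_mem_of_supported _ _ _ (fun p hp => ?_) (partProj_mem _)
      rw [Slot.fill_single]
      refine Finsupp.single_mem_supported _ _ fun i hi => ?_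
      change Function.update T.part j p i ∈ _
      rcases eq_or_ne i j with rfl | hij
      · rwa [Function.update_self]
      · rw [Function.update_of_ne hij]
        exact hT i (Finset.mem_of_mem_insert_of_ne hi hij)
    · intro p hp c
      rw [Module.End.mul_apply, h5 p hp c, partSlot_withPart j (l := [p j])
        (by rw [partProj_single (hp j)]; simp [listChain])]
      simp

end Reduction

/-! ### The homology -/

section Homology
variable {n : ℕ}

/-- The coefficient of the tuple of partitions `p` in a chain. -/
def partCoeff (p : Fin n → OrdPartition) : Chains n →ₗ[ZMod 2] DomChains n :=
  Finsupp.linearCombination _ fun T => by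
    classical exact if T.part = p then Finsupp.single (domSlot.get T) 1 else 0

open scoped Classical in
theorem partCoeff_withPart (p q : Fin n → OrdPartition) (c : DomChains n) :
    partCoeff p (withPart q c) = if q = p then c else 0 := by
  suffices h : partCoeff p ∘ₗ withPart q = if q = p then LinearMap.id else 0 by
    have := LinearMap.congr_fun h c
    rw [LinearMap.comp_apply] at this
    rw [this]; split_ifs <;> rfl
  refine single_lin_ext fun s => ?_
  rw [LinearMap.comp_apply, withPart_single, partCoeff, Finsupp.linearCombination_single, one_smul]
  split_ifs <;> rfl

/-- The tuple of partitions with `(1)` in the positions in `S` and `∅` elsewhere. -/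
def unitPart (S : Finset (Fin n)) (j : Fin n) : OrdPartition := if j ∈ S then [1] else []

theorem unitPart_mem (S : Finset (Fin n)) (j : Fin n) :
    unitPart S j ∈ ({[], [1]} : Set OrdPartition) := by
  rw [unitPart]; split_ifs <;> simp

theorem unitPart_injective : Function.Injective (unitPart (n := n)) := fun S S' h => by
  ext j
  have := congrFun h j
  simp only [unitPart] at this
  split_ifs at this <;> simp_all

theorem sum_length_unitPart (S : Finset (Fin n)) : ∑ j, (unitPart S j).length = S.card := by
  simp only [unitPart, apply_ite List.length, List.length_singleton, List.length_nil]
  simp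

theorem grading_unitPart (S : Finset (Fin n)) (s : Dom n) :
    (⟨s.x, s.y, s.D, s.isPos, unitPart S⟩ : Triple n).grading = s.deg + S.card := by
  rw [← sum_length_unitPart]; rfl

theorem withPart_mem (S : Finset (Fin n)) {r : ℚ} {c : DomChains n} (hc : c ∈ domGr n r) :
    withPart (unitPart S) c ∈
      Finsupp.supported (ZMod 2) (ZMod 2) {T : Triple n | T.grading = r + S.card} := by
  refine map_mem_of_supported _ _ _ (fun s hs => ?_) hc
  rw [withPart_single]
  refine Finsupp.single_mem_supported _ _ ?_
  change Triple.grading _ = _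
  rw [grading_unitPart, show s.deg = r from hs]

theorem partCoeff_mem (S : Finset (Fin n)) {k : ℚ} {c : Chains n}
    (hc : c ∈ Finsupp.supported (ZMod 2) (ZMod 2) {T : Triple n | T.grading = k}) :
    partCoeff (unitPart S) c ∈ domGr n (k - S.card) := by
  classical
  refine map_mem_of_supported _ _ _ (fun T hT => ?_) hc
  rw [partCoeff, Finsupp.linearCombination_single, one_smul]
  split_ifs with h
  · refine Finsupp.single_mem_supported _ _ ?_
    have h1 := grading_unitPart S (domSlot.get T)
    rw [← h] at h1
    have h2 : T.grading = k := hT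
    change (domSlot.get T).deg = _
    rw [← h2, eq_sub_iff_add_eq, ← h1]
    rfl
  · exact Submodule.zero_mem _

/-- A reduced chain is the sum of its components. -/
theorem sum_withPart_partCoeff {c : Chains n} (hc : c ∈ reduced Finset.univ) :
    ∑ S, withPart (unitPart S) (partCoeff (unitPart S) c) = c := by
  classical
  have h := map_mem_of_supported (∑ S, withPart (unitPart S) ∘ₗ partCoeff (unitPart S) -
    (LinearMap.id : Chains n →ₗ[ZMod 2] Chains n)) _ ⊥ (fun T hT => ?_) hc
  · rw [Submodule.mem_bot, LinearMap.sub_apply, sub_eq_zero, LinearMap.sum_apply] at h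
    exact h
  · obtain ⟨S, hS⟩ : ∃ S, T.part = unitPart S := by
      refine ⟨Finset.univ.filter fun j => T.part j = [1], funext fun j => ?_⟩
      have := hT j (Finset.mem_univ j)
      simp only [unitPart, Finset.mem_filter, Finset.mem_univ, true_and]
      split_ifs with h
      · exact h
      · exact this.resolve_right h
    have hT' : (Finsupp.single T 1 : Chains n) =
        withPart (unitPart S) (Finsupp.single (domSlot.get T) 1) := by
      rw [withPart_single, ← hS]; rfl
    rw [Submodule.mem_bot, LinearMap.sub_apply, sub_eq_zero, LinearMap.sum_apply, hT']
    simp only [LinearMap.comp_apply, partCoeff_withPart]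
    rw [Finset.sum_eq_single S]
    · rw [if_pos rfl]; rfl
    · intro S' _ h
      rw [if_neg fun e => h (unitPart_injective e).symm, map_zero]
    · exact fun h => absurd (Finset.mem_univ S) h

theorem freeDiff_withPart (S : Finset (Fin n)) (c : DomChains n) :
    freeDiff n (withPart (unitPart S) c) = withPart (unitPart S) (domDiff c) := by
  rw [freeDiff, LinearMap.add_apply, LinearMap.sum_apply, domSlot_withPart, Finset.sum_eq_zero,
    add_zero]
  intro j _
  rw [partSlot_withPart j (l := []) (by rw [partDiff_single (unitPart_mem S j)]; rfl)]
  rfl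

theorem partCoeff_freeDiff {c : Chains n} (hc : c ∈ reduced Finset.univ) (S : Finset (Fin n)) :
    partCoeff (unitPart S) (freeDiff n c) = domDiff (partCoeff (unitPart S) c) := by
  classical
  conv_lhs => rw [← sum_withPart_partCoeff hc]
  simp only [map_sum, freeDiff_withPart, partCoeff_withPart]
  rw [Finset.sum_eq_single S]
  · rw [if_pos rfl]
  · intro S' _ h
    rw [if_neg fun e => h (unitPart_injective e)]
  · exact fun h => absurd (Finset.mem_univ S) h

/-- The sets of markings that index the homology in degree `k`: the partitions `(1)` in the positions
in `S` contribute `|S|`, and full rows of the torus contribute the rest.  The condition says that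
`|S| ≤ k` and that `k - |S|` is even; for `|S| > k` it fails as the truncated difference is zero. -/
abbrev HomologyIndex (n k : ℕ) : Type :=
  {S : Finset (Fin n) // S.card + 2 * ((k - S.card) / 2) = k}

/-- The homology is computed by a linear map that vanishes on boundaries, detects the boundaries among
the cycles, and takes all values on cycles. -/
theorem nonempty_homology_equiv (hn : 2 ≤ n) (G : GridDiagram n) (k : ℕ) :
    Nonempty (Homology G k ≃ₗ[ZMod 2] (HomologyIndex n k → ZMod 2)) := by
  classical
  obtain ⟨Φ, Ψ, hΦΨ, hΨΦ, hΦ, hΨ, hgauge⟩ := exists_gauge hn G Finset.univ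
  rw [← diff_eq] at hgauge
  obtain ⟨P, K, hP, hP0, hK, hred, hfix⟩ := exists_contraction hn (Finset.univ : Finset (Fin n))
  have hdd := freeDiff_sq hn
  have hcomm : P * freeDiff n = freeDiff n * P := by
    rw [hP, add_mul, mul_add, add_mul, mul_add, one_mul, mul_one, mul_assoc K, hdd, mul_zero,
      add_zero, ← mul_assoc _ _ K, hdd, zero_mul, zero_add, mul_assoc]
  have hgauge' : freeDiff n * Ψ = Ψ * diff G := by
    calc freeDiff n * Ψ = Ψ * Φ * freeDiff n * Ψ := by rw [hΨΦ, one_mul]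
      _ = Ψ * (diff G * Φ) * Ψ := by rw [mul_assoc Ψ, hgauge]
      _ = Ψ * diff G * (Φ * Ψ) := by simp only [mul_assoc]
      _ = Ψ * diff G := by rw [hΦΨ, mul_one]
  obtain ⟨r, hr⟩ : ∃ r : Fin n, (r : ℕ) + 1 = n := ⟨⟨n - 1, by omega⟩, by
    change n - 1 + 1 = n; omega⟩
  -- remove the interaction, project to the reduced chains, and count rows in each component
  let τ : Chains n →ₗ[ZMod 2] (HomologyIndex n k → ZMod 2) := LinearMap.pi fun S =>
    rowCount r ((k - S.1.card) / 2) ∘ₗ partCoeff (unitPart S.1) ∘ₗ (P * Ψ : Ops n)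
  have hτ : ∀ c S, τ c S = rowCount r ((k - S.1.card) / 2) (partCoeff (unitPart S.1) (P (Ψ c))) :=
    fun _ _ => rfl
  have hτd : ∀ c, τ (diff G c) = 0 := by
    intro c
    funext S
    have h1 : Ψ (diff G c) = freeDiff n (Ψ c) := (LinearMap.congr_fun hgauge' c).symm
    have h2 : P (freeDiff n (Ψ c)) = freeDiff n (P (Ψ c)) := LinearMap.congr_fun hcomm _
    rw [hτ, h1, h2, partCoeff_freeDiff (hred _), rowCount_domDiff]
    rfl
  have hgr : ∀ {X : Ops n} {c : Chains n} {q : ℚ}, Shifts Triple.grading 0 X →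
      c ∈ Finsupp.supported (ZMod 2) (ZMod 2) {T : Triple n | T.grading = q} →
      X c ∈ Finsupp.supported (ZMod 2) (ZMod 2) {T : Triple n | T.grading = q} := by
    intro X c q hX hc
    have := hX.apply_mem hc
    rwa [add_zero] at this
  have hker : ∀ c ∈ cycles G k, τ c = 0 → c ∈ boundaries G k := by
    intro c ⟨hc, hdc⟩ hτc
    have hc0 := hgr hΨ hc
    have hdc0 : freeDiff n (Ψ c) = 0 := by
      have h1 : freeDiff n (Ψ c) = Ψ (diff G c) := LinearMap.congr_fun hgauge' c
      rw [h1, LinearMap.mem_ker.1 hdc, map_zero]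
    have hcomp : ∀ S : Finset (Fin n), ∃ e ∈ domGr n ((k : ℚ) - S.card + 1),
        domDiff e = partCoeff (unitPart S) (P (Ψ c)) := by
      intro S
      have hmem := partCoeff_mem S (hgr hP0 hc0)
      rcases lt_or_ge k S.card with hlt | hle
      · have hlt' : (k : ℚ) < S.card := by exact_mod_cast hlt
        rw [domGr_eq_bot (sub_neg.2 hlt'), Submodule.mem_bot] at hmem
        exact ⟨0, Submodule.zero_mem _, by rw [hmem, map_zero]⟩
      · rw [← Nat.cast_sub hle] at hmem ⊢
        refine exists_domDiff_eq hn hr (k - S.card) _ hmem ?_ fun m => ?_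
        · have h2 : P (freeDiff n (Ψ c)) = freeDiff n (P (Ψ c)) := LinearMap.congr_fun hcomm _
          rw [← partCoeff_freeDiff (hred _), ← h2, hdc0, map_zero, map_zero]
        -- the other counts vanish for degree reasons
        · by_cases hm : k - S.card = 2 * m
          · have hS : S.card + 2 * ((k - S.card) / 2) = k := by omega
            have := congrFun hτc ⟨S, hS⟩
            rw [hτ] at this
            rwa [show m = (k - S.card) / 2 by omega]
          · exact rowCount_eq_zero r m (fun h => hm (by exact_mod_cast h)) hmem
    choose e he hde using hcomp
    -- the homotopy supplies the part of the primitive off the reduced chains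
    have hsum : freeDiff n (∑ S, withPart (unitPart S) (e S)) = P (Ψ c) := by
      simp only [map_sum, freeDiff_withPart, hde]
      exact sum_withPart_partCoeff (hred _)
    have hc1 : freeDiff n (∑ S, withPart (unitPart S) (e S) - K (Ψ c)) = Ψ c := by
      have h1 : P (Ψ c) = Ψ c + (freeDiff n (K (Ψ c)) + K (freeDiff n (Ψ c))) := by
        conv_lhs => rw [hP]
        rfl
      rw [map_sub, hsum, h1, hdc0, map_zero, add_zero, add_sub_cancel_right]
    refine ⟨Φ (∑ S, withPart (unitPart S) (e S) - K (Ψ c)), hgr hΦ ?_, ?_⟩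
    · push_cast
      refine Submodule.sub_mem _ (Submodule.sum_mem _ fun S _ => ?_) (hK.apply_mem hc0)
      have := withPart_mem S (he S)
      rwa [show (k : ℚ) - S.card + 1 + S.card = k + 1 by ring] at this
    · have h1 : Φ (freeDiff n (∑ S, withPart (unitPart S) (e S) - K (Ψ c))) =
          diff G (Φ (∑ S, withPart (unitPart S) (e S) - K (Ψ c))) := LinearMap.congr_fun hgauge _
      rw [← h1, hc1]
      exact LinearMap.congr_fun hΦΨ c
  have hsurj : ∀ t, ∃ c ∈ cycles G k, τ c = t := by
    intro t
    choose z hz hdz hzχ using exists_cycle hn hr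
    let c₀ : Chains n := ∑ S : HomologyIndex n k,
      t S • withPart (unitPart S.1) (z ((k - S.1.card) / 2))
    have hPc : P c₀ = c₀ := by
      simp only [c₀, map_sum, map_smul, hfix _ (unitPart_mem _)]
    have hdc : freeDiff n c₀ = 0 := by
      simp only [c₀, map_sum, map_smul, freeDiff_withPart, hdz, map_zero, smul_zero,
        Finset.sum_const_zero]
    have hc : c₀ ∈ Finsupp.supported (ZMod 2) (ZMod 2) {T : Triple n | T.grading = (k : ℚ)} := by
      refine Submodule.sum_mem _ fun S _ => Submodule.smul_mem _ _ ?_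
      have := withPart_mem S.1 (hz ((k - S.1.card) / 2))
      rwa [← Nat.cast_add, add_comm, S.2] at this
    refine ⟨Φ c₀, ⟨hgr hΦ hc, ?_⟩, ?_⟩
    · have h1 : Φ (freeDiff n c₀) = diff G (Φ c₀) := LinearMap.congr_fun hgauge _
      exact LinearMap.mem_ker.2 (by rw [← h1, hdc, map_zero])
    · funext S
      have h1 : Ψ (Φ c₀) = c₀ := LinearMap.congr_fun hΨΦ c₀
      rw [hτ, h1, hPc]
      simp only [c₀, map_sum, map_smul, partCoeff_withPart]
      rw [Finset.sum_eq_single S]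
      · rw [if_pos rfl, hzχ, if_pos rfl, smul_eq_mul, mul_one]
      · intro S' _ h
        rw [if_neg fun e => h (Subtype.ext (unitPart_injective e)), map_zero, smul_zero]
      · exact fun h => absurd (Finset.mem_univ S) h
  have hkerEq : (boundaries G k).submoduleOf (cycles G k) =
      LinearMap.ker (τ ∘ₗ (cycles G k).subtype) := by
    ext c
    rw [LinearMap.mem_ker]
    change c.1 ∈ boundaries G k ↔ _
    constructor
    · rintro ⟨b, -, hb⟩
      rw [LinearMap.comp_apply, Submodule.subtype_apply, ← hb, hτd]
    · exact hker c.1 c.2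
  exact ⟨(Submodule.quotEquivOfEq _ _ hkerEq).trans
    (LinearMap.quotKerEquivOfSurjective _ fun t => by
      obtain ⟨c, hc, hct⟩ := hsurj t
      exact ⟨⟨c, hc⟩, hct⟩)⟩

theorem nonempty_homology_equiv_fin (hn : 2 ≤ n) (G : GridDiagram n) (k m : ℕ)
    (hm : Fintype.card (HomologyIndex n k) = m) :
    Nonempty (Homology G k ≃ₗ[ZMod 2] (Fin m → ZMod 2)) := by
  obtain ⟨f⟩ := nonempty_homology_equiv hn G k
  exact ⟨f.trans (LinearEquiv.funCongrLeft _ _ (Fintype.equivFinOfCardEq hm).symm)⟩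

theorem card_homologyIndex (n k : ℕ) : Fintype.card (HomologyIndex n k) =
    ∑ l ∈ Finset.range (k + 1), if l + 2 * ((k - l) / 2) = k then n.choose l else 0 := by
  rw [Fintype.card_subtype, Finset.card_eq_sum_card_fiberwise (f := Finset.card)
    (t := Finset.range (k + 1))]
  · refine Finset.sum_congr rfl fun l hl => ?_
    split_ifs with h
    · rw [← Finset.card_fin n, ← Finset.card_powersetCard, Finset.card_fin]
      congr 1
      ext S
      simp only [Finset.mem_filter, Finset.mem_univ, true_and, Finset.mem_powersetCard,
        Finset.subset_univ]
      constructor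
      · exact fun h => h.2
      · rintro rfl; exact ⟨h, rfl⟩
    · rw [Finset.card_eq_zero, Finset.filter_eq_empty_iff]
      intro S hS hl
      rw [Finset.mem_filter] at hS
      rw [hl] at hS
      exact h hS.2
  · intro S hS
    rw [Finset.mem_coe, Finset.mem_filter] at hS
    rw [Finset.coe_range, Set.mem_Iio]
    omega

/-- `∂` lowers the grading by one. -/
theorem shifts_diff (G : GridDiagram n) : Shifts Triple.grading (-1) (diff G) := by
  rw [diff_eq]
  refine shifts_freeDiff.add (Shifts.sum fun j _ => ?_)
  have := (shifts_partSlot j shifts_enlargeMap).mul (shifts_domSlot (shifts_annulusMap G j))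
  rwa [show (-2 : ℚ) + 1 = -1 by norm_num] at this

theorem diff_sq (hn : 2 ≤ n) (G : GridDiagram n) : diff G * diff G = 0 := by
  obtain ⟨Φ, Ψ, hΦΨ, -, -, -, hgauge⟩ := exists_gauge hn G Finset.univ
  rw [← diff_eq] at hgauge
  calc diff G * diff G = diff G * (diff G * Φ) * Ψ := by
        rw [mul_assoc, mul_assoc (diff G) Φ, hΦΨ, mul_one]
    _ = diff G * Φ * freeDiff n * Ψ := by rw [mul_assoc (diff G) Φ (freeDiff n), hgauge]
    _ = Φ * (freeDiff n * freeDiff n) * Ψ := by rw [← hgauge, mul_assoc Φ]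
    _ = 0 := by rw [freeDiff_sq hn, mul_zero, zero_mul]

end Homology

end GridCDP

end

open GridCDP in
theorem mainTheorem3 (n : ℕ) (hn : 2 ≤ n) (G : GridDiagram n) :
    ((∀ T : Triple n, ∃ k : ℕ, T.grading = (k : ℚ)) ∧
      (∀ c ∈ gradedChains n 0, diff G c = 0) ∧
      (∀ k : ℕ, ∀ c ∈ gradedChains n (k + 1), diff G c ∈ gradedChains n k) ∧
      (∀ c : Chains n, diff G (diff G c) = 0)) ∧
    Nonempty (Homology G 0 ≃ₗ[ZMod 2] ZMod 2) ∧
    Nonempty (Homology G 1 ≃ₗ[ZMod 2] (Fin n → ZMod 2)) ∧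
    Nonempty (Homology G 2 ≃ₗ[ZMod 2] (Fin (n.choose 2 + 1) → ZMod 2)) ∧
    Nonempty (Homology G 3 ≃ₗ[ZMod 2] (Fin (n.choose 3 + n) → ZMod 2)) := by
  refine ⟨⟨fun T => ?_, fun c hc => ?_, fun k c hc => ?_, LinearMap.congr_fun (diff_sq hn G)⟩,
    ?_, ?_, ?_, ?_⟩
  · obtain ⟨k, hk⟩ := exists_nat_maslov T.isPos
    exact ⟨k + T.totalLength, by rw [Triple.grading, hk]; push_cast; rfl⟩
  · have h := (shifts_diff G).apply_mem hc
    rw [Set.eq_empty_of_forall_notMem (s := {T : Triple n | T.grading = _}),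
      Finsupp.supported_empty] at h
    · exact h
    · intro T hT
      have h0 : (0 : ℚ) ≤ T.grading := add_nonneg (maslov_nonneg T.isPos.2) (Nat.cast_nonneg _)
      rw [show T.grading = ((0 : ℕ) : ℚ) + -1 from hT] at h0
      norm_num at h0
  · have h := (shifts_diff G).apply_mem hc
    rwa [Nat.cast_succ, add_neg_cancel_right] at h
  · obtain ⟨f⟩ := nonempty_homology_equiv_fin hn G 0 1 (by simp [card_homologyIndex])
    exact ⟨f.trans (LinearEquiv.funUnique _ _ _)⟩
  · exact nonempty_homology_equiv_fin hn G 1 _ (by simp [card_homologyIndex, Finset.sum_range_succ])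
  · exact nonempty_homology_equiv_fin hn G 2 _
      (by simp [card_homologyIndex, Finset.sum_range_succ, add_comm])
  · exact nonempty_homology_equiv_fin hn G 3 _
      (by simp [card_homologyIndex, Finset.sum_range_succ, add_comm])
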